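/- Setting. Let $m,n\ge 1$, $N=mn$, and consider $$\min_{x\in\mathbb R^d} P(x)=\frac1N\sum_{\tau=1}^n\sum_{i=1}^m\phi_{i\tau}(A_{i\tau}^\top x)+g(x),\qquad A_{i\tau}\in\mathbb R^{d\times t},$$ where each $\phi_{i\tau}:\mathbb R^t\to\mathbb R$ is convex, $\frac1\gamma$-smooth and bounded below, and $g:\mathbb R^d\to\mathbb R$ is $\lambda$-strongly convex ($\lambda,\gamma>0$). Put $R_m=\max_{i,\tau}\|A_{i\tau}\|$, $R^2=\frac1N\lambda_{\max}\big(\sum_{\tau,i}A_{i\tau}A_{i\tau}^\top\big)$. Let $\delta\in(0,1)$ and let $Q$ be a randomized map on $\mathbb R^d$ with $\mathbb E\|x-Q(x)\|^2\le(1-\delta)\|x\|^2$ and $\mathbb E[Q(x)]=\delta x$ for all $x$. Let $\kappa\ge0$, $q=\frac{\lambda}{\lambda+\kappa}$, $0\le\rho_0<\sqrt q$, let $P^*=\min P$, let $x^0$ satisfy $P(x^0)>P^*$, and $\epsilon_k=\frac29(P(x^0)-P^*)(1-\rho_0)^k$. Outer loop (Catalyst). $y^0=x^0$, $\alpha_0=\sqrt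 q$; for $k\ge1$, $x^k$ approximately minimizes $G_k(x)=P(x)+\frac\kappa2\|x-y^{k-1}\|^2$ (computed by the inner loop), $\alpha_k>0$ solves $\alpha_k^2=(1-\alpha_k)\alpha_{k-1}^2+q\alpha_k$, $\beta_k=\frac{\alpha_{k-1}(1-\alpha_{k-1})}{\alpha_{k-1}^2+\alpha_k}$, and $y^k=x^k+\beta_k(x^k-x^{k-1})$. Let $G_k^*=\min G_k$, $\xi_k(x)=\frac{1}{\lambda+\kappa}\big(g(x)+\frac\kappa2\|x-y^{k-1}\|^2\big)$, and let $$D_k(\alpha)=-\frac1N\sum_{\tau,i}\phi_{i\tau}^*(-\alpha_{i\tau})-(\lambda+\kappa)\,\xi_k^*\Big(\frac{1}{(\lambda+\kappa)N}\sum_{\tau,i}A_{i\tau}\alpha_{i\tau}\Big)$$ be the dual objective. Inner loop (EC-SDCA on $G_k$ with step parameter $\theta$). Given $\alpha^K_{i\tau},u^K,e^K_\tau$, set $x^{K+1}=\nabla\xi_k^*(u^K)$; every node $\tau$ draws $i=i_K^\tau$ uniformly from $\{1,\dots,m\}$, sets $\Delta_\tau=-\theta m\,\alpha^K_{i\tau}-\theta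 m\nabla\phi_{i\tau}(A_{i\tau}^\top x^{K+1})$, $\alpha^{K+1}_{i\tau}=\alpha^K_{i\tau}+\Delta_\tau$ (its other dual variables are unchanged), $z_\tau=\frac{1}{(\lambda+\kappa)m}A_{i\tau}\Delta_\tau+e^K_\tau$, sends $Q(z_\tau)$, and sets $e^{K+1}_\tau=z_\tau-Q(z_\tau)$; then $u^{K+1}=u^K+\frac1n\sum_\tau Q(z_\tau)$. All index draws and compressor draws are independent across nodes, inner and outer iterations, and of one another. Warm start and stopping. The first inner loop starts from $\alpha^0=0,u^0=0,e^0_\tau=0$; each later one starts from the final $\alpha,u,e_\tau$ of the preceding inner loop. The $k$-th inner loop stops at $$T_k=\inf\Big\{K\ge1:\ 3\sqrt{2+\delta m}\,\Psi^K_{4,(k)}+2\big(G_k(x^{K+1}_{(k)})-G_k^*\big)\le\epsilon_k\Big\}$$ and outputs $x^k=x_{(k)}^{T_k+1}$. Here, with $e^K=\frac1n\sum_\tau e^K_\tau$, $$\Psi^K_{4,(k)}=G_k^*-D_k(\alpha^K_{(k)})+w_1\|e^K_{(k)}\|^2+\frac{w_2}{n^2}\sum_{\tau=1}^n\|e^K_{\tau,(k)}\|^2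 .$$ Parameters. Let $$a_4=\frac{R_m^2}{n\gamma}+\frac{R^2}{\gamma}+\frac{\sqrt{1-\delta}\,R^2}{\delta\gamma},\qquad X=\frac1\delta+m+\frac{a_4}{\lambda+\kappa},\qquad w=\frac{\lambda+\kappa}{\sqrt{(1-\delta)\big(1+\delta R_m^2/(nR^2)\big)}}$$ (with $R_m^2/R^2$ read as $0$ if $R=0$). Fix $b\ge100$ and suppose that $\frac{1}{bX}\le\theta\le\frac{1}{100X}$, $\frac wb\le w_1\le bw$ and $(1-\delta)\frac wb\le w_2\le bw$. Claim. For every $b\ge 100$ there is a constant $C=C(b)$, depending on nothing else, such that in every such situation $$\mathbb E[T_k]\le C\Big(\frac1\delta+m+\frac{a_4}{\lambda+\kappa}\Big)\Big(1+\log X+\log\frac{1}{\sqrt q-\rho_0}\Big)\qquad(k\ge2),$$ and for $k=1$ the same bound holds with $\log\Big(1+\frac{G_1^*-D_1(0)}{P(x^0)-P^*}\Big)$ added inside the last bracket. That is, $\mathbb E[T_k]\le\tilde{\mathcal O}\big(\frac1\delta+m+\frac{a_4}{\lambda+\kappa}\big)$. -/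

import Mathlib

open MeasureTheory ProbabilityTheory

noncomputable section

namespace ECSDCA

/-- `ℝᵏ` with the Euclidean norm. -/
abbrev Rn (k : ℕ) : Type := EuclideanSpace ℝ (Fin k)

/-- The convex conjugate `f*(y) = sup_x ⟨y, x⟩ - f(x)`, as a real number.  It is only ever used
where the supremum is finite: for strongly convex `f` this is the case at every `y`, and for the
losses at all the dual iterates, because `0` and every gradient of a convex loss that is bounded
below lie in the (convex) domain of its conjugate. -/
def conjugate {k : ℕ} (f : Rn k → ℝ) (y : Rn k) : ℝ := ⨆ x : Rn k, (inner ℝ y x - f x)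

/-- The largest eigenvalue of a symmetric operator. -/
def lamMax {k : ℕ} (T : Rn k →L[ℝ] Rn k) : ℝ :=
  sSup {μ : ℝ | Module.End.HasEigenvalue (T : Rn k →ₗ[ℝ] Rn k) μ}

/-- The data of `min_x P(x) = (1/N) ∑_τ ∑_i φ_{iτ}(A_{iτ}ᵀ x) + g(x)`, `N = mn`.  A `d × t` matrix
is given as the linear map `ℝᵗ → ℝᵈ` it represents; its transpose is the adjoint. -/
structure Problem (d t m n : ℕ) where
  φ : Fin m → Fin n → Rn t → ℝ
  A : Fin m → Fin n → (Rn t →L[ℝ] Rn d)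
  g : Rn d → ℝ

/-- The numerical parameters: strong convexity `lam`, Catalyst parameter `kap`, smoothness `1/gam`,
compression parameter `del`, step parameter `theta` of EC-SDCA, weights `w₁`, `w₂` of the
error terms in the Lyapunov function, and `rho0` in the Catalyst accuracies. -/
structure Params where
  lam : ℝ
  kap : ℝ
  gam : ℝ
  del : ℝ
  theta : ℝ
  w₁ : ℝ
  w₂ : ℝ
  rho0 : ℝ

/-- `f` is differentiable with `L`-Lipschitz gradient. -/
def IsSmooth {k : ℕ} (f : Rn k → ℝ) (L : ℝ) : Prop :=
  Differentiable ℝ f ∧ ∀ x y, ‖gradient f x - gradient f y‖ ≤ L * ‖x - y‖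

/-- Each loss is convex, `1/gam`-smooth and bounded below; `g` is `lam`-strongly convex. -/
structure Problem.Admissible {d t m n : ℕ} (p : Problem d t m n) (lam gam : ℝ) : Prop where
  convex : ∀ i τ, ConvexOn ℝ Set.univ (p.φ i τ)
  smooth : ∀ i τ, IsSmooth (p.φ i τ) (1 / gam)
  bddBelow : ∀ i τ, BddBelow (Set.range (p.φ i τ))
  strong : StrongConvexOn Set.univ lam p.g

/-- The randomized map `Q`, driven by a seed with law `ν`, is a contraction compressor:
`E‖x - Q(x)‖² ≤ (1 - δ)‖x‖²`, with `δ ∈ (0, 1]`. -/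
structure IsContraction {Ξ : Type*} [MeasurableSpace Ξ] {d : ℕ} (ν : Measure Ξ)
    (Q : Ξ → Rn d → Rn d) (δ : ℝ) : Prop where
  measurable : Measurable (fun z : Ξ × Rn d => Q z.1 z.2)
  pos : 0 < δ
  le_one : δ ≤ 1
  contraction : ∀ x, ∫⁻ ζ, ENNReal.ofReal (‖x - Q ζ x‖ ^ 2) ∂ν
    ≤ ENNReal.ofReal ((1 - δ) * ‖x‖ ^ 2)

section Objective

variable {d t m n : ℕ} (p : Problem d t m n) (c : Params)

/-- The primal objective `P`. -/
def Problem.P (x : Rn d) : ℝ :=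
  (1 / ((m : ℝ) * n)) * ∑ τ, ∑ i, p.φ i τ (ContinuousLinearMap.adjoint (p.A i τ) x) + p.g x

/-- The minimum `P*`. -/
def Problem.Pstar : ℝ := ⨅ x, p.P x

/-- `R_m = max ‖A_{iτ}‖`. -/
def Problem.Rm : ℝ := ⨆ z : Fin m × Fin n, ‖p.A z.1 z.2‖

/-- `R² = (1/N) λ_max(∑ A_{iτ} A_{iτ}ᵀ)`. -/
def Problem.Rsq : ℝ :=
  (1 / ((m : ℝ) * n)) *
    lamMax (∑ τ, ∑ i, (p.A i τ).comp (ContinuousLinearMap.adjoint (p.A i τ)))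

/-- `a₄ = R_m²/(nγ) + R²/γ + √(1-δ) R²/(δγ)`. -/
def a4 : ℝ :=
  p.Rm ^ 2 / (n * c.gam) + p.Rsq / c.gam + Real.sqrt (1 - c.del) * p.Rsq / (c.del * c.gam)

/-- `1/δ + m + a₄/(λ+κ)`. -/
def complexity : ℝ := 1 / c.del + m + a4 p c / (c.lam + c.kap)

/-- The reference scale `(λ+κ) / √((1-δ)(1 + δ R_m²/(n R²)))` of the weights of the error terms
(if `R = 0` then all `A_{iτ}` and all error vectors vanish). -/
def weightScale : ℝ :=
  (c.lam + c.kap) / Real.sqrt ((1 - c.del) * (1 + c.del * p.Rm ^ 2 / (n * p.Rsq)))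

/-- The Catalyst subproblem objective `G(x) = P(x) + (κ/2)‖x - y‖²` with prox-center `y`. -/
def G (y x : Rn d) : ℝ := p.P x + c.kap / 2 * ‖x - y‖ ^ 2

/-- The minimum of `G`. -/
def Gstar (y : Rn d) : ℝ := ⨅ x, G p c y x

/-- The normalized regularizer of the subproblem, `(g(x) + (κ/2)‖x - y‖²)/(λ+κ)`. -/
def xi (y x : Rn d) : ℝ := (p.g x + c.kap / 2 * ‖x - y‖ ^ 2) / (c.lam + c.kap)

/-- `v(α) = (1/((λ+κ)N)) ∑ A_{iτ} α_{iτ}`. -/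
def vOf (α : Fin m → Fin n → Rn t) : Rn d :=
  (1 / ((c.lam + c.kap) * (m * n))) • ∑ τ, ∑ i, p.A i τ (α i τ)

/-- The dual objective of the subproblem. -/
def dual (y : Rn d) (α : Fin m → Fin n → Rn t) : ℝ :=
  -((1 / ((m : ℝ) * n)) * ∑ τ, ∑ i, conjugate (p.φ i τ) (-(α i τ)))
    - (c.lam + c.kap) * conjugate (xi p c y) (vOf p c α)

end Objective

/-- The variables of EC-SDCA: dual variables `α_{iτ}`, aggregated vector `u`, errors `e_τ`. -/
structure State (d t m n : ℕ) where
  α : Fin m → Fin n → Rn t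
  u : Rn d
  e : Fin n → Rn d

section Algorithm

variable {d t m n : ℕ} (p : Problem d t m n) (c : Params)

/-- The primal iterate `x^{K+1} = ∇ξ*(u^K)`. -/
def primal (y : Rn d) (s : State d t m n) : Rn d := gradient (conjugate (xi p c y)) s.u

/-- The increment `-θ p⁻¹ (α_{iτ} + ∇φ_{iτ}(A_{iτ}ᵀ x^{K+1}))` of a sampled dual variable, `p = 1/m`. -/
def incr (y : Rn d) (s : State d t m n) (i : Fin m) (τ : Fin n) : Rn t :=
  -((c.theta * m) • s.α i τ)
    - (c.theta * m) •
      gradient (p.φ i τ) (ContinuousLinearMap.adjoint (p.A i τ) (primal p c y s))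

/-- The vector that node `τ` compresses when it has sampled the index `i`. -/
def toSend (y : Rn d) (s : State d t m n) (i : Fin m) (τ : Fin n) : Rn d :=
  (1 / ((c.lam + c.kap) * m)) • p.A i τ (incr p c y s i τ) + s.e τ

/-- One EC-SDCA iteration on the subproblem with prox-center `y`; node `τ` uses the sampled
index `(r τ).1` and the compressor seed `(r τ).2`. -/
def step {Ξ : Type*} (Q : Ξ → Rn d → Rn d) (y : Rn d) (r : Fin n → Fin m × Ξ)
    (s : State d t m n) : State d t m n where
  α := fun i τ => if i = (r τ).1 then s.α i τ + incr p c y s i τ else s.α i τ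
  u := s.u + (1 / (n : ℝ)) • ∑ τ, Q (r τ).2 (toSend p c y s (r τ).1 τ)
  e := fun τ => toSend p c y s (r τ).1 τ - Q (r τ).2 (toSend p c y s (r τ).1 τ)

/-- The state after `K` EC-SDCA iterations started from `s₀`; iteration `K` uses the draws `r K`. -/
def innerIter {Ξ : Type*} (Q : Ξ → Rn d → Rn d) (y : Rn d) (r : ℕ → Fin n → Fin m × Ξ)
    (s₀ : State d t m n) : ℕ → State d t m n
  | 0 => s₀
  | K + 1 => step p c Q y (r K) (innerIter Q y r s₀ K)

/-- The Lyapunov function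
`Ψ₄ = G* - D(α) + w₁ ‖(1/n) ∑ e_τ‖² + (w₂/n²) ∑ ‖e_τ‖²`. -/
def psi4 (y : Rn d) (s : State d t m n) : ℝ :=
  (Gstar p c y - dual p c y s.α)
    + c.w₁ * ‖(1 / (n : ℝ)) • ∑ τ, s.e τ‖ ^ 2
    + c.w₂ / (n : ℝ) ^ 2 * ∑ τ, ‖s.e τ‖ ^ 2

/-- The stopping quantity `3 √(2+δm) Ψ₄^K + 2 (G(x^{K+1}) - G*)`. -/
def merit (y : Rn d) (s : State d t m n) : ℝ :=
  3 * Real.sqrt (2 + c.del * m) * psi4 p c y s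
    + 2 * (G p c y (primal p c y s) - Gstar p c y)

/-- `q = λ/(λ+κ)`. -/
def Params.q : ℝ := c.lam / (c.lam + c.kap)

/-- The Catalyst sequence: `α₀ = √q`, and `α_{k+1}` is the positive root of
`α² = (1-α) α_k² + q α`. -/
def Params.acc : ℕ → ℝ
  | 0 => Real.sqrt c.q
  | k + 1 => ((c.q - acc k ^ 2) + Real.sqrt ((c.q - acc k ^ 2) ^ 2 + 4 * acc k ^ 2)) / 2

/-- `β_{k+1} = α_k (1-α_k)/(α_k² + α_{k+1})`. -/
def Params.beta (k : ℕ) : ℝ :=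
  c.acc k * (1 - c.acc k) / (c.acc k ^ 2 + c.acc (k + 1))

/-- The accuracies `ε_k = (2/9)(P(x⁰) - P*)(1-ρ₀)^k`. -/
def eps (x₀ : Rn d) (k : ℕ) : ℝ := 2 / 9 * (p.P x₀ - p.Pstar) * (1 - c.rho0) ^ k

/-- The stopping time `inf {K ≥ 1 : merit at inner iteration K ≤ ε}`, with value `⊤` if the
accuracy is never reached. -/
def stopTime {Ξ : Type*} (Q : Ξ → Rn d → Rn d) (y : Rn d) (r : ℕ → Fin n → Fin m × Ξ)
    (s₀ : State d t m n) (ε : ℝ) : ℕ∞ :=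
  sInf {T : ℕ∞ | ∃ K : ℕ, 1 ≤ K ∧ merit p c y (innerIter p c Q y r s₀ K) ≤ ε ∧ T = K}

/-- What is carried from one outer iteration to the next: `x^k`, `y^k`, and the final EC-SDCA
variables, from which the next inner loop is started. -/
structure Outer (d t m n : ℕ) where
  x : Rn d
  y : Rn d
  s : State d t m n

/-- The outer loop.  `r k K τ` is the draw of node `τ` in inner iteration `K` of outer
iteration `k`. -/
def outer {Ξ : Type*} (Q : Ξ → Rn d → Rn d) (x₀ : Rn d) (r : ℕ → ℕ → Fin n → Fin m × Ξ) :
    ℕ → Outer d t m n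
  | 0 => ⟨x₀, x₀, ⟨fun _ _ => 0, 0, fun _ => 0⟩⟩
  | k + 1 =>
    let o := outer Q x₀ r k
    let s' := innerIter p c Q o.y (r (k + 1)) o.s
      (stopTime p c Q o.y (r (k + 1)) o.s (eps p c x₀ (k + 1))).toNat
    let x' := primal p c o.y s'
    ⟨x', x' + c.beta k • (x' - o.x), s'⟩

/-- The number `T_{k+1}` of inner iterations in outer iteration `k + 1`. -/
def innerCount {Ξ : Type*} (Q : Ξ → Rn d → Rn d) (x₀ : Rn d)
    (r : ℕ → ℕ → Fin n → Fin m × Ξ) (k : ℕ) : ℕ∞ :=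
  stopTime p c Q (outer p c Q x₀ r k).y (r (k + 1)) (outer p c Q x₀ r k).s (eps p c x₀ (k + 1))

/-- The relative initial dual gap `(G₁* - D₁(0))/(P(x⁰) - P*)`. -/
def initGap (x₀ : Rn d) : ℝ :=
  (Gstar p c x₀ - dual p c x₀ (fun _ _ => 0)) / (p.P x₀ - p.Pstar)

end Algorithm

end ECSDCA

end

namespace ECSDCA

set_option linter.unusedSectionVars false

/-! ### Strongly convex functions and their conjugates -/

/-! Write σ = λ+κ, X for `complexity`, ρ = R_m²/(nR²), and w for `weightScale`. Within one
subproblem the argument rests on the Lyapunov function `lyap`: the dual gap plus W‖e‖² plus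
8W·n⁻²∑‖e_τ‖², with W = w/5. A step moves -α_{iτ} towards ∇φ_{iτ}(A_{iτ}ᵀx). The conjugates of the
losses are strongly convex and ξ* is 1-smooth, so the expected dual progress is θ times the whole
primal-dual gap plus a multiple of θγB, where B (`dirSq`) is the mean squared direction. The price
is terms in ‖e‖, since x is ∇ξ* at u and not at v(α) = u + e (`mean_dualDrop_le`). Because E Q(x) =
δx, the compression errors of different nodes interact only through their means, which shrink by
1-δ. Hence the averaged error contracts and receives only a fraction of order δ of the individual
errors (`errMean_step`, `errSq_step`). The scale w = σ/√((1-δ)(1+δρ)) balances the cross term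
between ‖e‖ and √(R²B) against the fresh error of size θ²R²B/σ², and θ ≤ 1/(100X) makes the good
terms win (`absorb`). The result is E lyap⁺ + θ·E(primal gap) ≤ (1-θ)·E lyap (`expLyap_contract`).
Before the stopping time the stopping quantity exceeds ε, so pathwise T ≤ K₀ + 1 + ∑_{K>K₀}
merit_K/ε (`stopTime_le_add_tsum`). The expected stopping quantity is at most 32bX·E lyap, so K₀ of
order log(X·lyap₀/ε)/θ leaves a geometric tail of sum 1/θ ≤ bX. What remains is a bound on the
starting Lyapunov value in units of ε_k, which enters only through a logarithm. That bound is the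
warm start. At the stop the old gaps are at most of order ε, and the factor √(2+δm) in the stopping
rule controls σ‖e‖² as well; moving the prox-center then costs these plus κ‖y'-y‖² (`gap_center_le`,
`of_merit_le`). The displacement is bounded by a constant times ε_k/(√q-ρ₀)⁶ through the potential
of the inexact accelerated proximal point method (`potential_step`, `norm_center_step_le`). These
bounds are pathwise and need only that the earlier loops stopped, which holds almost surely by
induction because their expected lengths are finite. -/

theorem StrongConvexOn.continuous_of_univ {k : ℕ} {f : Rn k → ℝ} {μ : ℝ} (hμ : 0 ≤ μ)
    (hf : StrongConvexOn Set.univ μ f) : Continuous f := by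
  have h : ConvexOn ℝ Set.univ f := UniformConvexOn.convexOn hf (fun r => by positivity)
  exact h.locallyLipschitz.continuous

/-- Compare the minimizer with a point slightly moved towards z, divide by the step s, and let s
tend to 0. -/
theorem StrongConvexOn.quadratic_growth {k : ℕ} {f : Rn k → ℝ} {μ : ℝ}
    (hf : StrongConvexOn Set.univ μ f) {x : Rn k} (hx : ∀ z, f x ≤ f z) (z : Rn k) :
    f x + μ / 2 * ‖z - x‖ ^ 2 ≤ f z := by
  have key : ∀ s : ℝ, 0 < s → s < 1 → f x + (1 - s) * (μ / 2 * ‖z - x‖ ^ 2) ≤ f z := by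
    intro s hs hs1
    have h1 := hf.2 (Set.mem_univ x) (Set.mem_univ z) (show 0 ≤ 1 - s by linarith) hs.le
      (by ring)
    have h2 := hx ((1 - s) • x + s • z)
    simp only [smul_eq_mul] at h1
    rw [norm_sub_rev x z] at h1
    have : s * (f x + (1 - s) * (μ / 2 * ‖z - x‖ ^ 2)) ≤ s * f z := by nlinarith
    exact le_of_mul_le_mul_left this hs
  have hlim : Filter.Tendsto (fun s : ℝ => f x + (1 - s) * (μ / 2 * ‖z - x‖ ^ 2))
      (nhdsWithin 0 (Set.Ioi 0)) (nhds (f x + (1 - 0) * (μ / 2 * ‖z - x‖ ^ 2))) := by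
    apply Filter.Tendsto.mono_left _ nhdsWithin_le_nhds
    exact Continuous.tendsto (by fun_prop) 0
  have := le_of_tendsto hlim (b := f z) (by
    filter_upwards [Ioo_mem_nhdsGT (zero_lt_one (α := ℝ))] with s hs
    exact key s hs.1 hs.2)
  linarith

theorem StrongConvexOn.exists_min {k : ℕ} {f : Rn k → ℝ} {μ : ℝ} (hμ : 0 < μ)
    (hf : StrongConvexOn Set.univ μ f) :
    ∃ x, ∀ z, f x + μ / 2 * ‖z - x‖ ^ 2 ≤ f z := by
  have hc := StrongConvexOn.continuous_of_univ hμ.le hf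
  obtain ⟨w, -, hw⟩ := (isCompact_closedBall (0 : Rn k) 1).exists_isMinOn
    ⟨0, by simp⟩ hc.continuousOn
  have hw0 : f w ≤ f 0 := hw (by simp)
  -- Coercivity: the radial projection of x to the unit sphere has value at least the minimum f w
  -- over the ball, and strong convexity on the segment from 0 to x then forces f x ≥ f 0 once ‖x‖
  -- passes the threshold.
  obtain ⟨x, hx⟩ := hc.exists_forall_le' 0 (by
    have : ∀ᶠ x : Rn k in Filter.cocompact _, 1 + 2 * (f 0 - f w) / μ ≤ ‖x‖ :=
      (tendsto_norm_cocompact_atTop).eventually (Filter.eventually_ge_atTop _)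
    filter_upwards [this] with x hx
    have h0 : 0 ≤ 2 * (f 0 - f w) / μ := by apply div_nonneg <;> linarith
    have hx1 : 1 ≤ ‖x‖ := by linarith
    have hpos : 0 < ‖x‖ := by linarith
    have hs1 : ‖x‖⁻¹ ≤ 1 := inv_le_one_of_one_le₀ hx1
    have h1 := hf.2 (Set.mem_univ (0 : Rn k)) (Set.mem_univ x) (show 0 ≤ 1 - ‖x‖⁻¹ by linarith)
      (show 0 ≤ ‖x‖⁻¹ by positivity) (by ring)
    have h2 : f w ≤ f (‖x‖⁻¹ • x) := hw (by
      simp [norm_smul, hpos.ne'])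
    simp only [smul_zero, zero_add, smul_eq_mul, zero_sub, norm_neg] at h1
    have h3 : (1 - ‖x‖⁻¹) * ‖x‖⁻¹ * (μ / 2 * ‖x‖ ^ 2) = μ / 2 * (‖x‖ - 1) := by
      field_simp
    have h4 : f 0 - f w ≤ μ / 2 * (‖x‖ - 1) := by
      have : 2 * (f 0 - f w) / μ ≤ ‖x‖ - 1 := by linarith
      rw [div_le_iff₀ hμ] at this
      linarith
    rw [h3] at h1
    have h5 : 0 ≤ ‖x‖⁻¹ * (f x - f 0) := by linarith
    have := nonneg_of_mul_nonneg_right h5 (by positivity)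
    linarith)
  exact ⟨x, fun z => StrongConvexOn.quadratic_growth hf hx z⟩

theorem StrongConvexOn.exists_argmax {k : ℕ} {f : Rn k → ℝ}
    (hf : StrongConvexOn Set.univ 1 f) (u : Rn k) :
    ∃ x, ∀ z, inner ℝ u z - f z + 1 / 2 * ‖z - x‖ ^ 2 ≤ inner ℝ u x - f x := by
  have h : StrongConvexOn Set.univ 1 (fun z => f z - inner ℝ u z) := by
    refine ⟨convex_univ, fun x _ y _ a b ha hb hab => ?_⟩
    have := hf.2 (Set.mem_univ x) (Set.mem_univ y) ha hb hab
    simp only [inner_add_right, inner_smul_right, smul_eq_mul] at this ⊢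
    linarith
  obtain ⟨x, hx⟩ := StrongConvexOn.exists_min one_pos h
  exact ⟨x, fun z => by linarith [hx z]⟩

theorem conjugate_eq_of_isMax {k : ℕ} {f : Rn k → ℝ} {u x : Rn k}
    (hx : ∀ z, inner ℝ u z - f z ≤ inner ℝ u x - f x) :
    conjugate f u = inner ℝ u x - f x :=
  le_antisymm (ciSup_le hx) (le_ciSup (f := fun z => inner ℝ u z - f z)
    ⟨_, by rintro _ ⟨z, rfl⟩; exact hx z⟩ x)

theorem le_conjugate {k : ℕ} {f : Rn k → ℝ} {u : Rn k}
    (h : BddAbove (Set.range fun z => inner ℝ u z - f z)) (x : Rn k) :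
    inner ℝ u x - f x ≤ conjugate f u := le_ciSup h x

theorem StrongConvexOn.bddAbove {k : ℕ} {f : Rn k → ℝ}
    (hf : StrongConvexOn Set.univ 1 f) (u : Rn k) :
    BddAbove (Set.range fun z => inner ℝ u z - f z) := by
  obtain ⟨x, hx⟩ := StrongConvexOn.exists_argmax hf u
  refine ⟨inner ℝ u x - f x, ?_⟩
  rintro _ ⟨z, rfl⟩
  exact (le_add_of_nonneg_right (by positivity)).trans (hx z)

/-- Descent inequality for the conjugate of a `1`-strongly convex function at a maximizer. -/
theorem StrongConvexOn.conjugate_le {k : ℕ} {f : Rn k → ℝ} {u x : Rn k}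
    (hx : ∀ z, inner ℝ u z - f z + 1 / 2 * ‖z - x‖ ^ 2 ≤ inner ℝ u x - f x) (u' : Rn k) :
    conjugate f u' ≤ conjugate f u + inner ℝ x (u' - u) + 1 / 2 * ‖u' - u‖ ^ 2 := by
  have e : conjugate f u = inner ℝ u x - f x := conjugate_eq_of_isMax fun z => by
    have := hx z
    have : 0 ≤ ‖z - x‖ ^ 2 := by positivity
    linarith
  rw [e]
  refine ciSup_le fun z => ?_
  have h1 := hx z
  -- The curvature -½‖z-x‖² at the maximizer pays for half of the cross term ⟨u'-u, z-x⟩; the other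
  -- half is ½‖u'-u‖².
  have h2 : 0 ≤ ‖(u' - u) - (z - x)‖ ^ 2 := by positivity
  rw [norm_sub_sq_real] at h2
  have h3 : inner ℝ (u' - u) (z - x)
      = inner ℝ u' z - inner ℝ u z - inner ℝ x (u' - u) := by
    rw [real_inner_comm (u' - u) x]
    simp only [inner_sub_left, inner_sub_right]
  linarith

/-- The conjugate lies between its affine minorant with slope x and that minorant plus ½‖u'-u‖². -/
theorem StrongConvexOn.hasGradientAt_conjugate {k : ℕ} {f : Rn k → ℝ}
    (hf : StrongConvexOn Set.univ 1 f) {u x : Rn k}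
    (hx : ∀ z, inner ℝ u z - f z + 1 / 2 * ‖z - x‖ ^ 2 ≤ inner ℝ u x - f x) :
    HasGradientAt (conjugate f) x u := by
  rw [hasGradientAt_iff_isLittleO]
  have e : conjugate f u = inner ℝ u x - f x := conjugate_eq_of_isMax fun z => by
    have := hx z
    have : 0 ≤ ‖z - x‖ ^ 2 := by positivity
    linarith
  have hO : (fun u' => conjugate f u' - conjugate f u - inner ℝ x (u' - u))
      =O[nhds u] fun u' => ‖u' - u‖ ^ 2 := by
    refine Asymptotics.IsBigO.of_bound 1 (Filter.Eventually.of_forall fun u' => ?_)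
    have h1 := StrongConvexOn.conjugate_le hx u'
    have h2 := le_conjugate (StrongConvexOn.bddAbove hf u') x
    have h3 : inner ℝ u' x = inner ℝ u x + inner ℝ x (u' - u) := by
      rw [real_inner_comm (u' - u) x, inner_sub_left]; ring
    have h4 : 0 ≤ ‖u' - u‖ ^ 2 := by positivity
    rw [Real.norm_eq_abs, Real.norm_eq_abs, abs_of_nonneg h4, abs_le]
    constructor <;> linarith
  refine hO.trans_isLittleO ?_
  have : Filter.Tendsto (fun u' : Rn k => u' - u) (nhds u) (nhds 0) := by
    have : Continuous fun u' : Rn k => u' - u := by fun_prop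
    simpa using this.tendsto u
  exact (Asymptotics.isLittleO_norm_pow_id (one_lt_two)).comp_tendsto this

theorem StrongConvexOn.argmax_gradient {k : ℕ} {f : Rn k → ℝ}
    (hf : StrongConvexOn Set.univ 1 f) (u z : Rn k) :
    inner ℝ u z - f z + 1 / 2 * ‖z - gradient (conjugate f) u‖ ^ 2
      ≤ inner ℝ u (gradient (conjugate f) u) - f (gradient (conjugate f) u) := by
  obtain ⟨x, hx⟩ := StrongConvexOn.exists_argmax hf u
  rw [(StrongConvexOn.hasGradientAt_conjugate hf hx).gradient]
  exact hx z

theorem StrongConvexOn.conjugate_eq {k : ℕ} {f : Rn k → ℝ}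
    (hf : StrongConvexOn Set.univ 1 f) (u : Rn k) :
    conjugate f u = inner ℝ u (gradient (conjugate f) u) - f (gradient (conjugate f) u) :=
  conjugate_eq_of_isMax fun z =>
    (le_add_of_nonneg_right (by positivity)).trans (StrongConvexOn.argmax_gradient hf u z)

/-- Add the strong maximality inequalities of the two maximizers, each tested at the other one. -/
theorem StrongConvexOn.gradient_conjugate_lipschitz {k : ℕ} {f : Rn k → ℝ}
    (hf : StrongConvexOn Set.univ 1 f) (u u' : Rn k) :
    ‖gradient (conjugate f) u - gradient (conjugate f) u'‖ ≤ ‖u - u'‖ := by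
  set x := gradient (conjugate f) u
  set x' := gradient (conjugate f) u'
  have h1 := StrongConvexOn.argmax_gradient hf u x'
  have h2 := StrongConvexOn.argmax_gradient hf u' x
  have h3 : inner ℝ (u - u') (x - x')
      = inner ℝ u x - inner ℝ u x' - inner ℝ u' x + inner ℝ u' x' := by
    simp only [inner_sub_left, inner_sub_right]; ring
  have h4 := real_inner_le_norm (u - u') (x - x')
  have h5 : ‖x' - x‖ = ‖x - x'‖ := norm_sub_rev _ _
  change inner ℝ u x' - f x' + 1 / 2 * ‖x' - x‖ ^ 2 ≤ inner ℝ u x - f x at h1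
  change inner ℝ u' x - f x + 1 / 2 * ‖x - x'‖ ^ 2 ≤ inner ℝ u' x' - f x' at h2
  rw [h5] at h1
  by_contra hcon
  push Not at hcon
  nlinarith [norm_nonneg (u - u'), norm_nonneg (x - x')]

/-! ### Smooth convex functions and their conjugates -/

theorem convex_gradient_le {k : ℕ} {f : Rn k → ℝ} (hf : ConvexOn ℝ Set.univ f)
    (hd : Differentiable ℝ f) (x y : Rn k) :
    f x + inner ℝ (gradient f x) (y - x) ≤ f y := by
  have hline : HasDerivAt (fun s : ℝ => f (x + s • (y - x))) (inner ℝ (gradient f x) (y - x)) 0 := by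
    have h1 : HasFDerivAt f (fderiv ℝ f x) (x + (0 : ℝ) • (y - x)) := by
      simpa using (hd x).hasFDerivAt
    have h2 : HasDerivAt (fun s : ℝ => x + s • (y - x)) (y - x) 0 := by
      simpa using ((hasDerivAt_id (0 : ℝ)).smul_const (y - x)).const_add x
    have := h1.comp_hasDerivAt (0 : ℝ) h2
    rwa [← ((hd x).hasGradientAt).fderiv_apply (y := y - x)]
  have hlim := hline.hasDerivWithinAt (s := Set.Ioi 0)
  rw [hasDerivWithinAt_iff_tendsto_slope' (by simp)] at hlim
  have := le_of_tendsto hlim (b := f y - f x) (by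
    filter_upwards [Ioo_mem_nhdsGT (zero_lt_one (α := ℝ))] with s hs
    have h := hf.2 (Set.mem_univ x) (Set.mem_univ y) (show 0 ≤ 1 - s by linarith [hs.2])
      hs.1.le (by ring)
    have e : (1 - s) • x + s • y = x + s • (y - x) := by module
    rw [e] at h
    simp only [smul_eq_mul] at h
    rw [slope_def_field]
    simp only [zero_smul, add_zero, sub_zero]
    rw [div_le_iff₀ hs.1]
    linarith)
  linarith

/-- The gradient inequality at x + h and the Lipschitz bound suffice. The constant L in place of L/2
costs a factor 2 in the strong convexity of the conjugates, which is why γ/4 appears below. -/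
theorem IsSmooth.le_quadratic {k : ℕ} {f : Rn k → ℝ} {L : ℝ} (hf : ConvexOn ℝ Set.univ f)
    (hs : IsSmooth f L) (x h : Rn k) :
    f (x + h) ≤ f x + inner ℝ (gradient f x) h + L * ‖h‖ ^ 2 := by
  have h1 := convex_gradient_le hf hs.1 (x + h) x
  have h2 := hs.2 (x + h) x
  have h3 := real_inner_le_norm (gradient f (x + h) - gradient f x) h
  have e : x - (x + h) = -h := by abel
  rw [e, inner_neg_right] at h1
  rw [inner_sub_left] at h3
  have e2 : x + h - x = h := by abel
  rw [e2] at h2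
  nlinarith [norm_nonneg h]

theorem conjugate_gradient {k : ℕ} {f : Rn k → ℝ} (hf : ConvexOn ℝ Set.univ f)
    (hd : Differentiable ℝ f) (x : Rn k) :
    conjugate f (gradient f x) = inner ℝ (gradient f x) x - f x :=
  conjugate_eq_of_isMax fun z => by
    have := convex_gradient_le hf hd x z
    rw [inner_sub_right] at this
    linarith

theorem bddAbove_gradient {k : ℕ} {f : Rn k → ℝ} (hf : ConvexOn ℝ Set.univ f)
    (hd : Differentiable ℝ f) (x : Rn k) :
    BddAbove (Set.range fun z => inner ℝ (gradient f x) z - f z) := by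
  refine ⟨inner ℝ (gradient f x) x - f x, ?_⟩
  rintro _ ⟨z, rfl⟩
  have := convex_gradient_le hf hd x z
  rw [inner_sub_right] at this
  simp only
  linarith

theorem norm_sq_convex_comb {k : ℕ} (a b : ℝ) (hab : a + b = 1) (x y : Rn k) :
    ‖a • x + b • y‖ ^ 2 = a * ‖x‖ ^ 2 + b * ‖y‖ ^ 2 - a * b * ‖x - y‖ ^ 2 := by
  rw [norm_add_sq_real, norm_sub_sq_real, norm_smul, norm_smul, inner_smul_left, inner_smul_right]
  obtain rfl : b = 1 - a := by linarith
  simp only [Real.norm_eq_abs, mul_pow, sq_abs, conj_trivial]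
  ring

/-- A Fenchel-Young inequality with a remainder: test the supremum at x + (γ/2)(p - ∇f x), which
maximizes the lower bound obtained from the quadratic majorant of f. -/
theorem inner_le_of_bddAbove_smooth {k : ℕ} {f : Rn k → ℝ} {gam : ℝ} (hgam : 0 < gam)
    (hf : ConvexOn ℝ Set.univ f) (hs : IsSmooth f (1 / gam)) {p : Rn k}
    (hp : BddAbove (Set.range fun z => inner ℝ p z - f z)) (x : Rn k) :
    inner ℝ p x - f x + gam / 4 * ‖p - gradient f x‖ ^ 2 ≤ conjugate f p := by
  set g := gradient f x
  have h1 := le_conjugate hp (x + (gam / 2) • (p - g))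
  have h2 := IsSmooth.le_quadratic hf hs x ((gam / 2) • (p - g))
  rw [norm_smul, inner_smul_right, mul_pow, Real.norm_eq_abs, sq_abs] at h2
  rw [inner_add_right, inner_smul_right] at h1
  have h3 : inner ℝ p (p - g) - inner ℝ g (p - g) = ‖p - g‖ ^ 2 := by
    rw [← inner_sub_left, real_inner_self_eq_norm_sq]
  have h4 : 1 / gam * ((gam / 2) ^ 2 * ‖p - g‖ ^ 2) = gam / 4 * ‖p - g‖ ^ 2 := by
    field_simp; ring
  have h5 : gam / 2 * inner ℝ p (p - g) - gam / 2 * inner ℝ g (p - g)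
      = gam / 2 * ‖p - g‖ ^ 2 := by rw [← mul_sub, h3]
  change f _ ≤ f x + gam / 2 * inner ℝ g (p - g) + _ at h2
  linarith

/-- The conjugate of a smooth convex function is strongly convex on its domain. -/
theorem conjugate_convex_comb {k : ℕ} {f : Rn k → ℝ} {gam : ℝ} (hgam : 0 < gam)
    (hf : ConvexOn ℝ Set.univ f) (hs : IsSmooth f (1 / gam)) {p p' : Rn k}
    (hp : BddAbove (Set.range fun z => inner ℝ p z - f z))
    (hp' : BddAbove (Set.range fun z => inner ℝ p' z - f z)) {s : ℝ} (hs0 : 0 ≤ s) (hs1 : s ≤ 1) :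
    BddAbove (Set.range fun z => inner ℝ ((1 - s) • p + s • p') z - f z) ∧
    conjugate f ((1 - s) • p + s • p') ≤ (1 - s) * conjugate f p + s * conjugate f p'
      - gam / 4 * s * (1 - s) * ‖p - p'‖ ^ 2 := by
  have key : ∀ x, inner ℝ ((1 - s) • p + s • p') x - f x
      ≤ (1 - s) * conjugate f p + s * conjugate f p' - gam / 4 * s * (1 - s) * ‖p - p'‖ ^ 2 := by
    intro x
    have h1 := inner_le_of_bddAbove_smooth hgam hf hs hp x
    have h2 := inner_le_of_bddAbove_smooth hgam hf hs hp' x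
    have h3 := norm_sq_convex_comb (1 - s) s (by ring) (p - gradient f x) (p' - gradient f x)
    rw [sub_sub_sub_cancel_right] at h3
    -- Averaging the two remainders gives γ/4 times this square plus γ/4·s(1-s)‖p-p'‖². Only the
    -- second part is free of x, so the square is dropped.
    have h4 : 0 ≤ gam / 4 * ‖(1 - s) • (p - gradient f x) + s • (p' - gradient f x)‖ ^ 2 := by
      positivity
    rw [h3] at h4
    rw [inner_add_left, real_inner_smul_left, real_inner_smul_left]
    have h5 := mul_le_mul_of_nonneg_left h1 (sub_nonneg.2 hs1)
    have h6 := mul_le_mul_of_nonneg_left h2 hs0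
    linarith
  exact ⟨⟨_, by rintro _ ⟨x, rfl⟩; exact key x⟩, ciSup_le key⟩

/-! ### The spectral constants of the data matrices -/

/-- In finite dimension the supremum of the Rayleigh quotient is itself an eigenvalue. -/
theorem le_lamMax {k : ℕ} {T : Rn k →L[ℝ] Rn k} (hT : (T : Rn k →ₗ[ℝ] Rn k).IsSymmetric)
    (y : Rn k) : inner ℝ (T y) y ≤ lamMax T * ‖y‖ ^ 2 := by
  rcases eq_or_ne y 0 with rfl | hy
  · simp
  have : Nontrivial (Rn k) := ⟨⟨y, 0, hy⟩⟩
  have h1 := hT.hasEigenvalue_iSup_of_finiteDimensional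
  have hfin : BddAbove {μ : ℝ | Module.End.HasEigenvalue (T : Rn k →ₗ[ℝ] Rn k) μ} :=
    (Module.End.finite_hasEigenvalue _).bddAbove
  have h2 := le_csSup hfin h1
  have hb : BddAbove (Set.range fun x : { x : Rn k // x ≠ 0 } =>
      RCLike.re (inner ℝ ((T : Rn k →ₗ[ℝ] Rn k) x) (x : Rn k)) / ‖(x : Rn k)‖ ^ 2) := by
    refine ⟨‖T‖, ?_⟩
    rintro _ ⟨⟨x, hx⟩, rfl⟩
    have hx' : 0 < ‖x‖ ^ 2 := by positivity
    simp only [ContinuousLinearMap.coe_coe]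
    rw [div_le_iff₀ hx']
    calc inner ℝ (T x) x ≤ ‖T x‖ * ‖x‖ := real_inner_le_norm _ _
      _ ≤ ‖T‖ * ‖x‖ * ‖x‖ := by gcongr; exact T.le_opNorm x
      _ = ‖T‖ * ‖x‖ ^ 2 := by ring
  have h3 := (le_ciSup hb ⟨y, hy⟩).trans h2
  have hy' : 0 < ‖y‖ ^ 2 := by positivity
  rw [div_le_iff₀ hy'] at h3
  exact h3

section

variable {d t m n : ℕ} (p : Problem d t m n)

theorem Problem.sum_adjoint_sq_le (hm : 0 < m) (hn : 0 < n) (y : Rn d) :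
    ∑ τ, ∑ i, ‖ContinuousLinearMap.adjoint (p.A i τ) y‖ ^ 2
      ≤ (m * n : ℝ) * p.Rsq * ‖y‖ ^ 2 := by
  set M := ∑ τ, ∑ i, (p.A i τ).comp (ContinuousLinearMap.adjoint (p.A i τ)) with hM
  have hN : (m * n : ℝ) * p.Rsq = lamMax M := by
    unfold Problem.Rsq
    field_simp
    simp [hM]
  have hsum : ∀ x y : Rn d, inner ℝ (M x) y
      = ∑ τ, ∑ i, inner ℝ (ContinuousLinearMap.adjoint (p.A i τ) x)
        (ContinuousLinearMap.adjoint (p.A i τ) y) := by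
    intro x y
    simp only [hM, sum_apply, sum_inner, ContinuousLinearMap.comp_apply]
    refine Finset.sum_congr rfl fun τ _ => Finset.sum_congr rfl fun i _ => ?_
    rw [ContinuousLinearMap.adjoint_inner_right]
  have hsym : (M : Rn d →ₗ[ℝ] Rn d).IsSymmetric := by
    intro x y
    rw [ContinuousLinearMap.coe_coe, hsum, real_inner_comm, hsum]
    refine Finset.sum_congr rfl fun τ _ => Finset.sum_congr rfl fun i _ => real_inner_comm _ _
  rw [hN]
  refine le_trans (le_of_eq ?_) (le_lamMax hsym y)
  rw [hsum]
  simp only [real_inner_self_eq_norm_sq]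

theorem Problem.Rsq_nonneg (hm : 0 < m) (hn : 0 < n) : 0 ≤ p.Rsq := by
  rcases Nat.eq_zero_or_pos d with rfl | hd
  · unfold Problem.Rsq lamMax
    apply mul_nonneg (by positivity)
    apply Real.sSup_nonneg
    intro x hx
    obtain ⟨v, hv⟩ := hx.exists_hasEigenvector
    exact absurd (Subsingleton.elim v 0) hv.2
  · have : Nonempty (Fin d) := ⟨⟨0, hd⟩⟩
    obtain ⟨y, hy⟩ := exists_ne (0 : Rn d)
    have h := p.sum_adjoint_sq_le hm hn y
    have h0 : 0 ≤ (m * n : ℝ) * p.Rsq * ‖y‖ ^ 2 :=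
      (Finset.sum_nonneg fun τ _ => Finset.sum_nonneg fun i _ => by positivity).trans h
    have hy' : 0 < ‖y‖ ^ 2 := by positivity
    have hN : (0 : ℝ) < m * n := by positivity
    exact nonneg_of_mul_nonneg_right (nonneg_of_mul_nonneg_left h0 hy') hN

/-- The block row (A_{iτ}) and its adjoint have the same norm: pair v with itself, apply Young's
inequality with weights 1/(2L) and L/2, and absorb half of ‖v‖². The case L = 0 is separate since
the weights degenerate. -/
theorem Problem.norm_sum_sq_le (hm : 0 < m) (hn : 0 < n) (x : Fin m → Fin n → Rn t) :
    ‖∑ τ, ∑ i, p.A i τ (x i τ)‖ ^ 2 ≤ (m * n : ℝ) * p.Rsq * ∑ τ, ∑ i, ‖x i τ‖ ^ 2 := by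
  set v := ∑ τ, ∑ i, p.A i τ (x i τ) with hv
  have h1 : ‖v‖ ^ 2 = ∑ τ, ∑ i, inner ℝ (ContinuousLinearMap.adjoint (p.A i τ) v) (x i τ) := by
    rw [← real_inner_self_eq_norm_sq]
    conv_lhs => rw [hv]
    simp only [sum_inner]
    refine Finset.sum_congr rfl fun τ _ => Finset.sum_congr rfl fun i _ => ?_
    rw [ContinuousLinearMap.adjoint_inner_left, real_inner_comm]
  have h2 := p.sum_adjoint_sq_le hm hn v
  set L := (m * n : ℝ) * p.Rsq with hL
  have hL0 : 0 ≤ L := mul_nonneg (by positivity) (p.Rsq_nonneg hm hn)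
  rcases hL0.eq_or_lt with h0 | hpos
  · rw [← h0, zero_mul] at h2 ⊢
    rw [h1]
    refine le_of_eq (Finset.sum_eq_zero fun τ _ => Finset.sum_eq_zero fun i _ => ?_)
    have h3 := (Finset.sum_eq_zero_iff_of_nonneg (fun τ _ => Finset.sum_nonneg fun i _ => by
      positivity)).1 (le_antisymm h2 (Finset.sum_nonneg fun τ _ => Finset.sum_nonneg fun i _ => by
      positivity)) τ (Finset.mem_univ τ)
    have h4 := (Finset.sum_eq_zero_iff_of_nonneg (fun i _ => by positivity)).1 h3 i
      (Finset.mem_univ i)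
    have h5 : ContinuousLinearMap.adjoint (p.A i τ) v = 0 := by simpa using h4
    rw [h5, inner_zero_left]
  · have h3 : ‖v‖ ^ 2 ≤ ∑ τ, ∑ i, (1 / (2 * L) * ‖ContinuousLinearMap.adjoint (p.A i τ) v‖ ^ 2
        + L / 2 * ‖x i τ‖ ^ 2) := by
      rw [h1]
      refine Finset.sum_le_sum fun τ _ => Finset.sum_le_sum fun i _ => ?_
      refine (real_inner_le_norm _ _).trans ?_
      set r := ‖ContinuousLinearMap.adjoint (p.A i τ) v‖
      set s := ‖x i τ‖
      have h : 0 ≤ 1 / (2 * L) * (r - L * s) ^ 2 := by positivity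
      have e : 1 / (2 * L) * (r - L * s) ^ 2 = 1 / (2 * L) * r ^ 2 + L / 2 * s ^ 2 - r * s := by
        field_simp; ring
      linarith
    simp only [Finset.sum_add_distrib, ← Finset.mul_sum] at h3
    have h4 : 1 / (2 * L) * ∑ τ, ∑ i, ‖ContinuousLinearMap.adjoint (p.A i τ) v‖ ^ 2
        ≤ 1 / (2 * L) * (L * ‖v‖ ^ 2) := by gcongr
    have h5 : 1 / (2 * L) * (L * ‖v‖ ^ 2) = ‖v‖ ^ 2 / 2 := by field_simp
    linarith

theorem Problem.norm_node_sum_sq_le (hm : 0 < m) (hn : 0 < n) (τ : Fin n) (x : Fin m → Rn t) :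
    ‖∑ i, p.A i τ (x i)‖ ^ 2 ≤ (m * n : ℝ) * p.Rsq * ∑ i, ‖x i‖ ^ 2 := by
  have h := p.norm_sum_sq_le hm hn (fun i τ' => if τ' = τ then x i else 0)
  have e1 : ∑ τ', ∑ i, p.A i τ' (if τ' = τ then x i else 0) = ∑ i, p.A i τ (x i) := by
    rw [Finset.sum_eq_single τ (fun τ' _ h => by simp [h]) (by simp)]
    simp
  have e2 : ∑ τ', ∑ i, ‖(if τ' = τ then x i else 0 : Rn t)‖ ^ 2 = ∑ i, ‖x i‖ ^ 2 := by
    rw [Finset.sum_eq_single τ (fun τ' _ h => by simp [h]) (by simp)]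
    simp
  rwa [e1, e2] at h

theorem Problem.norm_A_sq_le (hm : 0 < m) (hn : 0 < n) (i : Fin m) (τ : Fin n) (x : Rn t) :
    ‖p.A i τ x‖ ^ 2 ≤ (m * n : ℝ) * p.Rsq * ‖x‖ ^ 2 := by
  have h := p.norm_node_sum_sq_le hm hn τ (fun j => if j = i then x else 0)
  have e1 : ∑ j, p.A j τ (if j = i then x else 0) = p.A i τ x := by
    rw [Finset.sum_eq_single i (fun j _ h => by simp [h]) (by simp)]
    simp
  have e2 : ∑ j, ‖(if j = i then x else 0 : Rn t)‖ ^ 2 = ‖x‖ ^ 2 := by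
    rw [Finset.sum_eq_single i (fun j _ h => by simp [h]) (by simp)]
    simp
  rwa [e1, e2] at h

theorem Problem.norm_A_le_Rm (i : Fin m) (τ : Fin n) : ‖p.A i τ‖ ≤ p.Rm :=
  le_ciSup (f := fun z : Fin m × Fin n => ‖p.A z.1 z.2‖) (Set.finite_range _).bddAbove (i, τ)

theorem Problem.norm_A_apply_sq_le (i : Fin m) (τ : Fin n) (x : Rn t) :
    ‖p.A i τ x‖ ^ 2 ≤ p.Rm ^ 2 * ‖x‖ ^ 2 := by
  rw [← mul_pow]
  gcongr
  exact ((p.A i τ).le_opNorm x).trans (by gcongr; exact p.norm_A_le_Rm i τ)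

theorem Problem.Rm_nonneg : 0 ≤ p.Rm := Real.iSup_nonneg fun _ => norm_nonneg _

theorem Problem.Rm_sq_le (hm : 0 < m) (hn : 0 < n) : p.Rm ^ 2 ≤ (m * n : ℝ) * p.Rsq := by
  have h0 : 0 ≤ (m * n : ℝ) * p.Rsq := mul_nonneg (by positivity) (p.Rsq_nonneg hm hn)
  have h : p.Rm ≤ Real.sqrt ((m * n : ℝ) * p.Rsq) := by
    have : Nonempty (Fin m × Fin n) := ⟨(⟨0, hm⟩, ⟨0, hn⟩)⟩
    refine ciSup_le fun z => ContinuousLinearMap.opNorm_le_bound _ (Real.sqrt_nonneg _) fun x => ?_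
    apply le_of_sq_le_sq _ (by positivity)
    rw [mul_pow, Real.sq_sqrt h0]
    exact p.norm_A_sq_le hm hn z.1 z.2 x
  calc p.Rm ^ 2 ≤ Real.sqrt ((m * n : ℝ) * p.Rsq) ^ 2 := by
        gcongr; exact p.Rm_nonneg
    _ = _ := Real.sq_sqrt h0

/-- The ratio `R_m²/(n R²)`. -/
noncomputable def Problem.ratio : ℝ := p.Rm ^ 2 / (n * p.Rsq)

theorem Problem.ratio_nonneg (hm : 0 < m) (hn : 0 < n) : 0 ≤ p.ratio :=
  div_nonneg (by positivity) (mul_nonneg (by positivity) (p.Rsq_nonneg hm hn))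

/-- If R = 0 then R_m = 0, so the identity survives the convention that division by zero gives zero.
Later estimates can therefore use `ratio` without a case distinction. -/
theorem Problem.Rm_sq_eq (hm : 0 < m) (hn : 0 < n) : p.Rm ^ 2 = n * (p.ratio * p.Rsq) := by
  rcases (p.Rsq_nonneg hm hn).eq_or_lt with h | h
  · have := p.Rm_sq_le hm hn
    rw [← h, mul_zero] at this ⊢
    rw [mul_zero]
    exact le_antisymm this (by positivity)
  · unfold Problem.ratio
    have : (n : ℝ) ≠ 0 := by positivity
    field_simp

theorem Problem.ratio_le (hm : 0 < m) (hn : 0 < n) : p.ratio ≤ m := by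
  rcases (p.Rsq_nonneg hm hn).eq_or_lt with h | h
  · unfold Problem.ratio
    rw [← h]; simp
  · have := p.Rm_sq_le hm hn
    unfold Problem.ratio
    rw [div_le_iff₀ (by positivity)]
    linarith

end

/-! ### The Catalyst subproblem and its dual -/

/-- The standing assumptions on the problem and on the parameters. -/
structure Standing {d t m n : ℕ} (p : Problem d t m n) (c : Params) (b : ℝ) : Prop where
  hm : 0 < m
  hn : 0 < n
  lam_pos : 0 < c.lam
  kap_nonneg : 0 ≤ c.kap
  gam_pos : 0 < c.gam
  del_pos : 0 < c.del
  del_lt : c.del < 1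
  adm : p.Admissible c.lam c.gam
  hb : 100 ≤ b
  theta_ge : 1 / (b * complexity p c) ≤ c.theta
  theta_le : c.theta ≤ 1 / (100 * complexity p c)
  w₁_ge : weightScale p c / b ≤ c.w₁
  w₁_le : c.w₁ ≤ b * weightScale p c
  w₂_ge : (1 - c.del) * weightScale p c / b ≤ c.w₂
  w₂_le : c.w₂ ≤ b * weightScale p c

/-- All the conjugates in the dual objective are finite at `α`. -/
def Problem.DualFeasible {d t m n : ℕ} (p : Problem d t m n) (α : Fin m → Fin n → Rn t) : Prop :=
  ∀ i τ, BddAbove (Set.range fun z => inner ℝ (-(α i τ)) z - p.φ i τ z)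

theorem norm_sub_sq_convex_comb {k : ℕ} (a b : ℝ) (hab : a + b = 1) (x y z : Rn k) :
    ‖a • x + b • y - z‖ ^ 2 = a * ‖x - z‖ ^ 2 + b * ‖y - z‖ ^ 2 - a * b * ‖x - y‖ ^ 2 := by
  have h := norm_sq_convex_comb a b hab (x - z) (y - z)
  have e : a • (x - z) + b • (y - z) = a • x + b • y - z := by
    have : z = (a + b) • z := by rw [hab, one_smul]
    conv_rhs => rw [this]
    module
  rwa [e, sub_sub_sub_cancel_right] at h

section

variable {d t m n : ℕ} {p : Problem d t m n} {c : Params} {b : ℝ}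

theorem Standing.sig_pos (h : Standing p c b) : 0 < c.lam + c.kap := by
  linarith [h.lam_pos, h.kap_nonneg]

theorem Standing.N_pos (h : Standing p c b) : (0 : ℝ) < m * n := by
  have := h.hm; have := h.hn; positivity

theorem Standing.xi_strong (h : Standing p c b) (y : Rn d) :
    StrongConvexOn Set.univ 1 (xi p c y) := by
  refine ⟨convex_univ, fun u _ v _ a e ha he hae => ?_⟩
  have h1 := h.adm.strong.2 (Set.mem_univ u) (Set.mem_univ v) ha he hae
  have h2 := norm_sub_sq_convex_comb a e hae u v y
  have hs := h.sig_pos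
  simp only [smul_eq_mul, xi] at h1 ⊢
  rw [div_le_iff₀ hs, h2]
  have e1 : (a * ((p.g u + c.kap / 2 * ‖u - y‖ ^ 2) / (c.lam + c.kap))
      + e * ((p.g v + c.kap / 2 * ‖v - y‖ ^ 2) / (c.lam + c.kap))
      - a * e * (1 / 2 * ‖u - v‖ ^ 2)) * (c.lam + c.kap)
      = a * (p.g u + c.kap / 2 * ‖u - y‖ ^ 2) + e * (p.g v + c.kap / 2 * ‖v - y‖ ^ 2)
      - a * e * ((c.lam + c.kap) / 2 * ‖u - v‖ ^ 2) := by
    field_simp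
  rw [e1]
  linarith

theorem Standing.loss_convex (h : Standing p c b) (u v : Rn d) {a e : ℝ} (ha : 0 ≤ a) (he : 0 ≤ e)
    (hae : a + e = 1) :
    ∑ τ, ∑ i, p.φ i τ (ContinuousLinearMap.adjoint (p.A i τ) (a • u + e • v))
      ≤ a * ∑ τ, ∑ i, p.φ i τ (ContinuousLinearMap.adjoint (p.A i τ) u)
        + e * ∑ τ, ∑ i, p.φ i τ (ContinuousLinearMap.adjoint (p.A i τ) v) := by
  simp only [Finset.mul_sum, ← Finset.sum_add_distrib]
  refine Finset.sum_le_sum fun τ _ => Finset.sum_le_sum fun i _ => ?_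
  have := (h.adm.convex i τ).2 (Set.mem_univ (ContinuousLinearMap.adjoint (p.A i τ) u))
    (Set.mem_univ (ContinuousLinearMap.adjoint (p.A i τ) v)) ha he hae
  simpa only [map_add, map_smul, smul_eq_mul] using this

theorem Standing.P_strong (h : Standing p c b) : StrongConvexOn Set.univ c.lam p.P := by
  refine ⟨convex_univ, fun u _ v _ a e ha he hae => ?_⟩
  have h1 := h.adm.strong.2 (Set.mem_univ u) (Set.mem_univ v) ha he hae
  have h2 := h.loss_convex u v ha he hae
  have hN := h.N_pos
  have h3 := mul_le_mul_of_nonneg_left h2 (show 0 ≤ 1 / ((m : ℝ) * n) by positivity)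
  simp only [smul_eq_mul, Problem.P] at h1 ⊢
  linarith

theorem Standing.G_strong (h : Standing p c b) (y : Rn d) :
    StrongConvexOn Set.univ (c.lam + c.kap) (G p c y) := by
  refine ⟨convex_univ, fun u _ v _ a e ha he hae => ?_⟩
  have h1 := h.P_strong.2 (Set.mem_univ u) (Set.mem_univ v) ha he hae
  have h2 := norm_sub_sq_convex_comb a e hae u v y
  simp only [smul_eq_mul, G] at h1 ⊢
  rw [h2]
  linarith

theorem Standing.exists_min_P (h : Standing p c b) :
    ∃ x, ∀ z, p.P x + c.lam / 2 * ‖z - x‖ ^ 2 ≤ p.P z :=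
  StrongConvexOn.exists_min h.lam_pos h.P_strong

theorem iInf_eq_of_forall_le {α : Type*} {f : α → ℝ} {x : α} (hx : ∀ z, f x ≤ f z) :
    ⨅ z, f z = f x :=
  have : Nonempty α := ⟨x⟩
  le_antisymm (ciInf_le ⟨f x, by rintro _ ⟨z, rfl⟩; exact hx z⟩ x) (le_ciInf hx)

theorem Standing.exists_min_Pstar (h : Standing p c b) :
    ∃ x, p.P x = p.Pstar ∧ ∀ z, p.Pstar + c.lam / 2 * ‖z - x‖ ^ 2 ≤ p.P z := by
  obtain ⟨x, hx⟩ := h.exists_min_P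
  have e : p.Pstar = p.P x := iInf_eq_of_forall_le fun z =>
    (le_add_of_nonneg_right (by have := h.lam_pos; positivity)).trans (hx z)
  exact ⟨x, e.symm, fun z => e ▸ hx z⟩

theorem Standing.exists_min_Gstar (h : Standing p c b) (y : Rn d) :
    ∃ x, G p c y x = Gstar p c y ∧
      ∀ z, Gstar p c y + (c.lam + c.kap) / 2 * ‖z - x‖ ^ 2 ≤ G p c y z := by
  have hs := h.sig_pos
  obtain ⟨x, hx⟩ := StrongConvexOn.exists_min hs (h.G_strong y)
  have e : Gstar p c y = G p c y x := iInf_eq_of_forall_le fun z =>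
    (le_add_of_nonneg_right (by positivity)).trans (hx z)
  exact ⟨x, e.symm, fun z => e ▸ hx z⟩

theorem Standing.Gstar_le (h : Standing p c b) (y x : Rn d) : Gstar p c y ≤ G p c y x := by
  have hs := h.sig_pos
  obtain ⟨z, -, hz⟩ := h.exists_min_Gstar y
  exact (le_add_of_nonneg_right (by positivity)).trans (hz x)

theorem Standing.inner_vOf (h : Standing p c b) (x : Rn d) (α : Fin m → Fin n → Rn t) :
    (c.lam + c.kap) * inner ℝ x (vOf p c α)
      = 1 / ((m : ℝ) * n) * ∑ τ, ∑ i,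
        inner ℝ (ContinuousLinearMap.adjoint (p.A i τ) x) (α i τ) := by
  have hs := h.sig_pos
  have hN := h.N_pos
  simp only [vOf, inner_smul_right, inner_sum, ContinuousLinearMap.adjoint_inner_left]
  field_simp

/-- The primal-dual gap splits into Fenchel-Young defects, one for each loss and one for the
regularizer; the inner products cancel by `inner_vOf`. -/
theorem Standing.G_sub_dual (h : Standing p c b) (y x : Rn d) (α : Fin m → Fin n → Rn t) :
    G p c y x - dual p c y α
      = 1 / ((m : ℝ) * n) * ∑ τ, ∑ i, (p.φ i τ (ContinuousLinearMap.adjoint (p.A i τ) x)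
          + conjugate (p.φ i τ) (-(α i τ))
          + inner ℝ (ContinuousLinearMap.adjoint (p.A i τ) x) (α i τ))
        + (c.lam + c.kap) * (xi p c y x + conjugate (xi p c y) (vOf p c α)
          - inner ℝ x (vOf p c α)) := by
  have hs := h.sig_pos
  have e : (c.lam + c.kap) * xi p c y x = p.g x + c.kap / 2 * ‖x - y‖ ^ 2 := by
    unfold xi; field_simp
  have e2 := h.inner_vOf x α
  simp only [Finset.sum_add_distrib]
  simp only [mul_sub, mul_add, e, e2, G, Problem.P, dual]
  ring

theorem Problem.DualFeasible.fenchel_nonneg {α : Fin m → Fin n → Rn t} (hα : p.DualFeasible α)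
    (x : Rn d) : 0 ≤ ∑ τ, ∑ i, (p.φ i τ (ContinuousLinearMap.adjoint (p.A i τ) x)
          + conjugate (p.φ i τ) (-(α i τ))
          + inner ℝ (ContinuousLinearMap.adjoint (p.A i τ) x) (α i τ)) := by
  refine Finset.sum_nonneg fun τ _ => Finset.sum_nonneg fun i _ => ?_
  have := le_conjugate (hα i τ) (ContinuousLinearMap.adjoint (p.A i τ) x)
  rw [inner_neg_left, real_inner_comm] at this
  linarith

theorem Standing.dual_le_G (h : Standing p c b) (y x : Rn d) {α : Fin m → Fin n → Rn t}
    (hα : p.DualFeasible α) : dual p c y α ≤ G p c y x := by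
  have h1 := h.G_sub_dual y x α
  have h2 := hα.fenchel_nonneg x
  have h3 := le_conjugate (StrongConvexOn.bddAbove (h.xi_strong y) (vOf p c α)) x
  rw [real_inner_comm] at h3
  have hs := h.sig_pos
  have h4 : 0 ≤ (c.lam + c.kap) * (xi p c y x + conjugate (xi p c y) (vOf p c α)
          - inner ℝ x (vOf p c α)) := mul_nonneg hs.le (by linarith)
  have hN := h.N_pos
  have h5 := mul_nonneg (show 0 ≤ 1 / ((m : ℝ) * n) by positivity) h2
  linarith

theorem Standing.dual_le_Gstar (h : Standing p c b) (y : Rn d) {α : Fin m → Fin n → Rn t}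
    (hα : p.DualFeasible α) : dual p c y α ≤ Gstar p c y :=
  le_ciInf fun x => h.dual_le_G y x hα

/-- Lower boundedness of the losses makes their conjugates finite at 0, so the cold start is
feasible. -/
theorem Standing.dualFeasible_zero (h : Standing p c b) : p.DualFeasible fun _ _ => 0 := by
  intro i τ
  obtain ⟨B, hB⟩ := h.adm.bddBelow i τ
  refine ⟨-B, ?_⟩
  rintro _ ⟨z, rfl⟩
  have := hB ⟨z, rfl⟩
  simp only [neg_zero, inner_zero_left]
  linarith

/-- Change of the prox-center: the dual gap of the new subproblem in terms of the primal-dual gap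
of the old one. -/
theorem Standing.gap_center_le (h : Standing p c b) (y y' : Rn d) {s : State d t m n} {e : Rn d}
    (hu : s.u + e = vOf p c s.α) :
    Gstar p c y' - dual p c y' s.α ≤ G p c y (primal p c y s) - dual p c y s.α
      + (c.lam + c.kap) * ‖e‖ ^ 2 + c.kap ^ 2 / (c.lam + c.kap) * ‖y' - y‖ ^ 2 := by
  set σ := c.lam + c.kap with hσ
  have hs : 0 < σ := h.sig_pos
  set x := primal p c y s with hx
  set v := vOf p c s.α with hv
  have h1 := h.G_sub_dual y x s.α
  have h1' := h.G_sub_dual y' x s.α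
  have h2 := h.Gstar_le y' x
  have h3 := StrongConvexOn.argmax_gradient (h.xi_strong y) s.u
  have h3a : ∀ z, inner ℝ s.u z - xi p c y z + 1 / 2 * ‖z - x‖ ^ 2
    ≤ inner ℝ s.u x - xi p c y x := h3
  have hmx := StrongConvexOn.conjugate_eq (h.xi_strong y) s.u
  have hmx' : conjugate (xi p c y) s.u = inner ℝ s.u x - xi p c y x := hmx
  have h4 := le_conjugate (StrongConvexOn.bddAbove (h.xi_strong y) v) x
  -- Moving the center changes ξ only by the linear form q and a constant. The new conjugate at v is
  -- thus the old one at v + q = u + e + q, and descent from u costs ½‖e+q‖² ≤ ‖e‖² + ‖q‖².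
  set q : Rn d := (c.kap / σ) • (y' - y) with hq
  have hxi : ∀ z, xi p c y' z = xi p c y z - inner ℝ q z
      + c.kap / (2 * σ) * (‖y'‖ ^ 2 - ‖y‖ ^ 2) := by
    intro z
    simp only [xi, hq, inner_smul_left, inner_sub_left, norm_sub_sq_real, conj_trivial]
    rw [← hσ, real_inner_comm z y, real_inner_comm z y']
    field_simp
    ring
  have h5 : conjugate (xi p c y') v
      ≤ conjugate (xi p c y) s.u + inner ℝ x (e + q) + 1 / 2 * ‖e + q‖ ^ 2
        - c.kap / (2 * σ) * (‖y'‖ ^ 2 - ‖y‖ ^ 2) := by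
    refine ciSup_le fun z => ?_
    have h6 := le_conjugate (StrongConvexOn.bddAbove (h.xi_strong y) (v + q)) z
    have h7 := StrongConvexOn.conjugate_le h3a (v + q)
    have e1 : v + q - s.u = e + q := by rw [← hu]; abel
    rw [e1] at h7
    rw [inner_add_left] at h6
    rw [hxi]
    linarith
  have h8 : ‖e + q‖ ^ 2 ≤ 2 * ‖e‖ ^ 2 + 2 * ‖q‖ ^ 2 := by
    have := norm_add_le e q
    have h9 : ‖e + q‖ ^ 2 ≤ (‖e‖ + ‖q‖) ^ 2 := by gcongr
    nlinarith [sq_nonneg (‖e‖ - ‖q‖)]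
  have h9 : σ * ‖q‖ ^ 2 = c.kap ^ 2 / σ * ‖y' - y‖ ^ 2 := by
    rw [hq, norm_smul, mul_pow, Real.norm_eq_abs, sq_abs]
    field_simp
  have h10 : xi p c y' x + conjugate (xi p c y') v - inner ℝ x v ≤ ‖e‖ ^ 2 + ‖q‖ ^ 2 := by
    rw [hxi]
    have e2 : inner ℝ x v = inner ℝ s.u x + inner ℝ x e := by
      rw [← hu, inner_add_right, real_inner_comm x s.u]
    rw [inner_add_right, real_inner_comm q x] at h5
    linarith
  have h11 := mul_le_mul_of_nonneg_left h10 hs.le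
  have h12 : 0 ≤ σ * (xi p c y x + conjugate (xi p c y) v - inner ℝ x v) := by
    rw [real_inner_comm] at h4
    exact mul_nonneg hs.le (by linarith)
  rw [mul_add, h9] at h11
  linarith

end

/-! ### Second moments of sums of independent vectors; the draws -/

section

variable {Ω : Type*} [MeasurableSpace Ω] {μ : Measure Ω} [IsProbabilityMeasure μ]

theorem integral_inner_of_indepFun {k : ℕ} {X Y : Ω → Rn k} (h : IndepFun X Y μ)
    (hX : Integrable X μ) (hY : Integrable Y μ) :
    Integrable (fun ω => inner ℝ (X ω) (Y ω)) μ ∧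
    ∫ ω, inner ℝ (X ω) (Y ω) ∂μ = inner ℝ (∫ ω, X ω ∂μ) (∫ ω, Y ω ∂μ) :=
  ⟨h.integrable_bilin hX hY (isBoundedBilinearMap_inner (𝕜 := ℝ) (E := Rn k)).toContinuousLinearMap,
    h.integral_bilin hX hY (isBoundedBilinearMap_inner (𝕜 := ℝ) (E := Rn k)).toContinuousLinearMap⟩

/-- Variances of pairwise independent vectors add. Keeping the squared mean separate lets the factor
(1-δ)² act on the interaction between nodes. -/
theorem integral_norm_sum_sq {k n : ℕ} {H : Fin n → Ω → Rn k}
    (hH : ∀ τ, MemLp (H τ) 2 μ) (hind : Pairwise fun τ τ' => IndepFun (H τ) (H τ') μ) :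
    Integrable (fun ω => ‖∑ τ, H τ ω‖ ^ 2) μ ∧
    ∫ ω, ‖∑ τ, H τ ω‖ ^ 2 ∂μ = ‖∑ τ, ∫ ω, H τ ω ∂μ‖ ^ 2
      + ∑ τ, (∫ ω, ‖H τ ω‖ ^ 2 ∂μ - ‖∫ ω, H τ ω ∂μ‖ ^ 2) := by
  have hI : ∀ τ, Integrable (H τ) μ := fun τ => (hH τ).integrable one_le_two
  have hsq : ∀ τ, Integrable (fun ω => ‖H τ ω‖ ^ 2) μ := fun τ => (hH τ).integrable_norm_pow two_ne_zero
  have hpair : ∀ τ τ', Integrable (fun ω => inner ℝ (H τ ω) (H τ' ω)) μ := by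
    intro τ τ'
    rcases eq_or_ne τ τ' with rfl | hne
    · simpa only [real_inner_self_eq_norm_sq] using hsq τ
    · exact (integral_inner_of_indepFun (hind hne) (hI τ) (hI τ')).1
  have hval : ∀ τ τ', ∫ ω, inner ℝ (H τ ω) (H τ' ω) ∂μ
      = inner ℝ (∫ ω, H τ ω ∂μ) (∫ ω, H τ' ω ∂μ)
        + if τ = τ' then (∫ ω, ‖H τ ω‖ ^ 2 ∂μ - ‖∫ ω, H τ ω ∂μ‖ ^ 2) else 0 := by
    intro τ τ'
    rcases eq_or_ne τ τ' with rfl | hne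
    · simp only [real_inner_self_eq_norm_sq, if_true]; ring
    · rw [if_neg hne, add_zero]
      exact (integral_inner_of_indepFun (hind hne) (hI τ) (hI τ')).2
  have hexp : ∀ v : Fin n → Rn k, ‖∑ τ, v τ‖ ^ 2 = ∑ τ, ∑ τ', inner ℝ (v τ) (v τ') := by
    intro v
    rw [← real_inner_self_eq_norm_sq, sum_inner]
    simp only [inner_sum]
  constructor
  · simp only [hexp]
    exact integrable_finsetSum _ fun τ _ => integrable_finsetSum _ fun τ' _ => hpair τ τ'
  · simp only [hexp]
    rw [integral_finsetSum _ fun τ _ => integrable_finsetSum _ fun τ' _ => hpair τ τ']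
    rw [← Finset.sum_add_distrib]
    refine Finset.sum_congr rfl fun τ _ => ?_
    rw [integral_finsetSum _ fun τ' _ => hpair τ τ']
    simp only [hval, Finset.sum_add_distrib, Finset.sum_ite_eq, Finset.mem_univ, if_true]

end

/-! ### The law of a single draw -/

section

variable {m : ℕ} {Ξ : Type*} [MeasurableSpace Ξ] {ν : Measure Ξ} [IsProbabilityMeasure ν]

theorem uniformOn_real_singleton (i : Fin m) :
    (uniformOn (Set.univ : Set (Fin m))).real {i} = 1 / m := by
  rw [measureReal_def, uniformOn_univ]
  simp

theorem isProbabilityMeasure_uniformOn_fin (hm : 0 < m) :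
    IsProbabilityMeasure (uniformOn (Set.univ : Set (Fin m))) :=
  have : Nonempty (Fin m) := ⟨⟨0, hm⟩⟩
  isProbabilityMeasure_uniformOn Set.finite_univ Set.univ_nonempty

variable {E : Type*} [NormedAddCommGroup E] [NormedSpace ℝ E] [MeasurableSpace E] [BorelSpace E]
  [SecondCountableTopology E]

theorem integrable_draw (hm : 0 < m) {f : Fin m × Ξ → E} (hf : Measurable f)
    (hi : ∀ i, Integrable (fun ζ => f (i, ζ)) ν) :
    Integrable f ((uniformOn (Set.univ : Set (Fin m))).prod ν) := by
  have := isProbabilityMeasure_uniformOn_fin hm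
  rw [integrable_prod_iff hf.aestronglyMeasurable]
  exact ⟨Filter.Eventually.of_forall hi, Integrable.of_finite⟩

variable [CompleteSpace E]

theorem integral_draw (hm : 0 < m) {f : Fin m × Ξ → E} (hf : Measurable f)
    (hi : ∀ i, Integrable (fun ζ => f (i, ζ)) ν) :
    ∫ z, f z ∂((uniformOn (Set.univ : Set (Fin m))).prod ν)
      = (1 / (m : ℝ)) • ∑ i, ∫ ζ, f (i, ζ) ∂ν := by
  have := isProbabilityMeasure_uniformOn_fin hm
  rw [integral_prod _ (integrable_draw hm hf hi), integral_fintype Integrable.of_finite]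
  simp only [uniformOn_real_singleton, Finset.smul_sum]

end

/-! ### Moments of the compressor -/

section

variable {Ξ : Type*} [MeasurableSpace Ξ] {ν : Measure Ξ} [IsProbabilityMeasure ν]
  {d : ℕ} {Q : Ξ → Rn d → Rn d} {δ : ℝ}

theorem IsContraction.measurable_at (hQ : IsContraction ν Q δ) (x : Rn d) :
    Measurable fun ζ => Q ζ x :=
  hQ.measurable.comp (measurable_id.prodMk measurable_const)

theorem IsContraction.memLp (hQ : IsContraction ν Q δ) (x : Rn d) :
    MemLp (fun ζ => x - Q ζ x) 2 ν := by
  have hmeas : Measurable fun ζ => x - Q ζ x := measurable_const.sub (hQ.measurable_at x)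
  rw [memLp_two_iff_integrable_sq_norm hmeas.aestronglyMeasurable]
  refine ⟨(hmeas.norm.pow_const 2).aestronglyMeasurable, ?_⟩
  rw [hasFiniteIntegral_iff_ofReal (Filter.Eventually.of_forall fun _ => by positivity)]
  exact (hQ.contraction x).trans_lt ENNReal.ofReal_lt_top

theorem IsContraction.integral_sq_le (hQ : IsContraction ν Q δ) (x : Rn d) :
    ∫ ζ, ‖x - Q ζ x‖ ^ 2 ∂ν ≤ (1 - δ) * ‖x‖ ^ 2 := by
  have h0 : 0 ≤ (1 - δ) * ‖x‖ ^ 2 := mul_nonneg (by linarith [hQ.le_one]) (by positivity)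
  have hi := (hQ.memLp x).integrable_norm_pow two_ne_zero
  have h := hQ.contraction x
  rw [← ofReal_integral_eq_lintegral_ofReal hi (Filter.Eventually.of_forall fun _ => by positivity)] at h
  exact (ENNReal.ofReal_le_ofReal_iff h0).1 h

theorem IsContraction.integral_sub (hQ : IsContraction ν Q δ)
    (hmean : ∀ x, ∫ ζ, Q ζ x ∂ν = δ • x) (x : Rn d) :
    ∫ ζ, (x - Q ζ x) ∂ν = (1 - δ) • x := by
  have h1 : Integrable (fun ζ => x - Q ζ x) ν := (hQ.memLp x).integrable one_le_two
  have h2 : Integrable (fun ζ => Q ζ x) ν := by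
    refine ((integrable_const x).sub h1).congr (Filter.Eventually.of_forall fun ζ => ?_)
    simp
  rw [MeasureTheory.integral_sub (integrable_const x) h2, hmean]
  simp [sub_smul]

end

/-- Independent draws of the nodes. -/
structure IsDraw {n m : ℕ} {Ω Ξ : Type*} [MeasurableSpace Ω] [MeasurableSpace Ξ] (μ : Measure Ω)
    (ν : Measure Ξ) (r : Fin n → Ω → Fin m × Ξ) : Prop where
  meas : ∀ τ, Measurable (r τ)
  indep : iIndepFun r μ
  law : ∀ τ, μ.map (r τ) = (uniformOn (Set.univ : Set (Fin m))).prod ν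

section

variable {n m d : ℕ} {Ω Ξ : Type*} [MeasurableSpace Ω] [MeasurableSpace Ξ] {μ : Measure Ω}
  [IsProbabilityMeasure μ] {ν : Measure Ξ} [IsProbabilityMeasure ν] {r : Fin n → Ω → Fin m × Ξ}

section

variable {E : Type*} [NormedAddCommGroup E] [NormedSpace ℝ E] [MeasurableSpace E] [BorelSpace E]
  [SecondCountableTopology E]

theorem IsDraw.integrable (hr : IsDraw μ ν r) (hm : 0 < m) (τ : Fin n) {f : Fin m × Ξ → E}
    (hf : Measurable f) (hi : ∀ i, Integrable (fun ζ => f (i, ζ)) ν) :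
    Integrable (fun ω => f (r τ ω)) μ := by
  have h := integrable_draw hm hf hi
  rw [← hr.law τ] at h
  exact h.comp_measurable (hr.meas τ)

theorem IsDraw.integral [CompleteSpace E] (hr : IsDraw μ ν r) (hm : 0 < m) (τ : Fin n)
    {f : Fin m × Ξ → E}
    (hf : Measurable f) (hi : ∀ i, Integrable (fun ζ => f (i, ζ)) ν) :
    ∫ ω, f (r τ ω) ∂μ = (1 / (m : ℝ)) • ∑ i, ∫ ζ, f (i, ζ) ∂ν := by
  rw [← integral_draw hm hf hi, ← hr.law τ,
    integral_map (hr.meas τ).aemeasurable hf.aestronglyMeasurable]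

theorem IsDraw.integrable_index (hr : IsDraw μ ν r) (hm : 0 < m) (τ : Fin n) (f : Fin m → E) :
    Integrable (fun ω => f (r τ ω).1) μ :=
  hr.integrable hm τ (f := fun z => f z.1) ((measurable_of_finite f).comp measurable_fst)
    fun i => integrable_const (f i)

theorem IsDraw.integral_index [CompleteSpace E] (hr : IsDraw μ ν r) (hm : 0 < m) (τ : Fin n)
    (f : Fin m → E) :
    ∫ ω, f (r τ ω).1 ∂μ = (1 / (m : ℝ)) • ∑ i, f i := by
  rw [hr.integral hm τ (f := fun z => f z.1) ((measurable_of_finite f).comp measurable_fst)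
    fun i => integrable_const (f i)]
  simp

end

/-- Second moment of a sum of vectors that depend on the sampled indices. -/
theorem IsDraw.second_moment_index (hr : IsDraw μ ν r) (hm : 0 < m) (f : Fin n → Fin m → Rn d) :
    Integrable (fun ω => ‖∑ τ, f τ (r τ ω).1‖ ^ 2) μ ∧
    ∫ ω, ‖∑ τ, f τ (r τ ω).1‖ ^ 2 ∂μ ≤ ‖∑ τ, (1 / (m : ℝ)) • ∑ i, f τ i‖ ^ 2
      + ∑ τ, 1 / (m : ℝ) * ∑ i, ‖f τ i‖ ^ 2 := by
  have hmeas : ∀ τ, Measurable fun z : Fin m × Ξ => f τ z.1 := fun τ =>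
    (measurable_of_finite (f τ)).comp measurable_fst
  have h2 : ∀ τ, MemLp (fun ω => f τ (r τ ω).1) 2 μ := fun τ => by
    exact (memLp_two_iff_integrable_sq_norm
      ((hmeas τ).comp (hr.meas τ)).aestronglyMeasurable).2
      (hr.integrable_index hm τ fun i => ‖f τ i‖ ^ 2)
  obtain ⟨hI, hE⟩ := integral_norm_sum_sq h2 fun τ τ' hne =>
    (hr.indep.indepFun hne).comp (hmeas τ) (hmeas τ')
  refine ⟨hI, ?_⟩
  rw [hE]
  simp only [hr.integral_index hm]
  gcongr with τ
  have := hr.integral_index hm τ fun i => ‖f τ i‖ ^ 2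
  simp only [this, smul_eq_mul]
  exact sub_le_self _ (by positivity)

/-- First and second moments of the compression errors. -/
theorem IsDraw.moments_compress (hr : IsDraw μ ν r) (hm : 0 < m) {Q : Ξ → Rn d → Rn d} {δ : ℝ}
    (hQ : IsContraction ν Q δ) (hmean : ∀ x, ∫ ζ, Q ζ x ∂ν = δ • x) (z : Fin n → Fin m → Rn d) :
    (Integrable (fun ω => ‖∑ τ, (z τ (r τ ω).1 - Q (r τ ω).2 (z τ (r τ ω).1))‖ ^ 2) μ ∧
    ∫ ω, ‖∑ τ, (z τ (r τ ω).1 - Q (r τ ω).2 (z τ (r τ ω).1))‖ ^ 2 ∂μ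
      ≤ (1 - δ) ^ 2 * ‖∑ τ, (1 / (m : ℝ)) • ∑ i, z τ i‖ ^ 2
      + ∑ τ, ((1 - δ) * (1 / (m : ℝ) * ∑ i, ‖z τ i‖ ^ 2)
        - (1 - δ) ^ 2 * ‖(1 / (m : ℝ)) • ∑ i, z τ i‖ ^ 2)) ∧
    ∀ τ, Integrable (fun ω => ‖z τ (r τ ω).1 - Q (r τ ω).2 (z τ (r τ ω).1)‖ ^ 2) μ ∧
      ∫ ω, ‖z τ (r τ ω).1 - Q (r τ ω).2 (z τ (r τ ω).1)‖ ^ 2 ∂μ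
        ≤ (1 - δ) * (1 / (m : ℝ) * ∑ i, ‖z τ i‖ ^ 2) := by
  have hmeas : ∀ τ, Measurable fun w : Fin m × Ξ => z τ w.1 - Q w.2 (z τ w.1) := fun τ => by
    have h1 : Measurable fun w : Fin m × Ξ => z τ w.1 :=
      (measurable_of_finite (z τ)).comp measurable_fst
    exact h1.sub (hQ.measurable.comp (measurable_snd.prodMk h1))
  have hsq : ∀ τ i, Integrable (fun ζ => ‖z τ i - Q ζ (z τ i)‖ ^ 2) ν := fun τ i =>
    (hQ.memLp (z τ i)).integrable_norm_pow two_ne_zero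
  have hsqI : ∀ τ, Integrable (fun ω => ‖z τ (r τ ω).1 - Q (r τ ω).2 (z τ (r τ ω).1)‖ ^ 2) μ :=
    fun τ => hr.integrable hm τ (f := fun w => ‖z τ w.1 - Q w.2 (z τ w.1)‖ ^ 2)
      ((hmeas τ).norm.pow_const 2) (hsq τ)
  have hsqE : ∀ τ, ∫ ω, ‖z τ (r τ ω).1 - Q (r τ ω).2 (z τ (r τ ω).1)‖ ^ 2 ∂μ
        ≤ (1 - δ) * (1 / (m : ℝ) * ∑ i, ‖z τ i‖ ^ 2) := fun τ => by
    rw [hr.integral hm τ (f := fun w => ‖z τ w.1 - Q w.2 (z τ w.1)‖ ^ 2)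
      ((hmeas τ).norm.pow_const 2) (hsq τ), smul_eq_mul, mul_left_comm]
    rw [Finset.mul_sum _ _ (1 - δ)]
    exact mul_le_mul_of_nonneg_left
      (Finset.sum_le_sum fun i _ => hQ.integral_sq_le (z τ i)) (one_div_nonneg.2 m.cast_nonneg)
  -- Here E Q(x) = δx enters: the mean error is exactly 1-δ times the mean of the compressed vector.
  -- The contraction property alone would not give the factor (1-δ)² on the cross terms between
  -- nodes.
  have hE : ∀ τ, ∫ ω, (z τ (r τ ω).1 - Q (r τ ω).2 (z τ (r τ ω).1)) ∂μ
      = (1 - δ) • ((1 / (m : ℝ)) • ∑ i, z τ i) := fun τ => by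
    rw [hr.integral hm τ (f := fun w => z τ w.1 - Q w.2 (z τ w.1)) (hmeas τ)
      fun i => (hQ.memLp (z τ i)).integrable one_le_two, smul_comm, Finset.smul_sum (r := 1 - δ)]
    simp only [hQ.integral_sub hmean]
  refine ⟨?_, fun τ => ⟨hsqI τ, hsqE τ⟩⟩
  obtain ⟨hI, hV⟩ := integral_norm_sum_sq (μ := μ)
    (H := fun τ ω => z τ (r τ ω).1 - Q (r τ ω).2 (z τ (r τ ω).1))
    (fun τ => (memLp_two_iff_integrable_sq_norm
      ((hmeas τ).comp (hr.meas τ)).aestronglyMeasurable).2 (hsqI τ))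
    (fun τ τ' hne => (hr.indep.indepFun hne).comp (hmeas τ) (hmeas τ'))
  refine ⟨hI, hV.trans_le ?_⟩
  simp only [hE, ← Finset.smul_sum (r := 1 - δ)]
  simp only [norm_smul (1 - δ), mul_pow, Real.norm_eq_abs, sq_abs]
  gcongr with τ
  exact hsqE τ

end

/-! ### Parameter estimates -/

/-- The ratio between `λ + κ` and the scale of the weights. -/
noncomputable def rootTerm {d t m n : ℕ} (p : Problem d t m n) (c : Params) : ℝ :=
  Real.sqrt ((1 - c.del) * (1 + c.del * p.ratio))

section

variable {d t m n : ℕ} {p : Problem d t m n} {c : Params} {b : ℝ}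

theorem weightScale_eq : weightScale p c = (c.lam + c.kap) / rootTerm p c := by
  unfold weightScale rootTerm Problem.ratio
  rw [mul_div_assoc]

theorem Standing.ratio_nonneg (h : Standing p c b) : 0 ≤ p.ratio := p.ratio_nonneg h.hm h.hn

theorem Standing.Rsq_nonneg (h : Standing p c b) : 0 ≤ p.Rsq := p.Rsq_nonneg h.hm h.hn

theorem Standing.rootTerm_pos (h : Standing p c b) : 0 < rootTerm p c := by
  have := h.ratio_nonneg
  have := h.del_pos
  have : 0 < 1 - c.del := by linarith [h.del_lt]
  unfold rootTerm
  positivity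

theorem Standing.rootTerm_sq (h : Standing p c b) :
    rootTerm p c ^ 2 = (1 - c.del) * (1 + c.del * p.ratio) := by
  have := h.ratio_nonneg
  have := h.del_pos
  have : 0 < 1 - c.del := by linarith [h.del_lt]
  exact Real.sq_sqrt (by positivity)

theorem Standing.rootTerm_le (h : Standing p c b) : rootTerm p c ≤ Real.sqrt (2 + c.del * m) := by
  apply Real.sqrt_le_sqrt
  have h1 := h.ratio_nonneg
  have h2 := p.ratio_le h.hm h.hn
  have h3 := h.del_pos
  have h4 : c.del * p.ratio ≤ c.del * m := by gcongr
  have h5 : 0 ≤ c.del * p.ratio := by positivity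
  nlinarith

theorem Standing.a4_eq (h : Standing p c b) :
    a4 p c = (p.ratio + 1 + Real.sqrt (1 - c.del) / c.del) * (p.Rsq / c.gam) := by
  have hn : (0 : ℝ) < n := by exact_mod_cast h.hn
  have := h.gam_pos
  have := h.del_pos
  unfold a4
  rw [p.Rm_sq_eq h.hm h.hn]
  field_simp

theorem Standing.a4_nonneg (h : Standing p c b) : 0 ≤ a4 p c := by
  have := h.ratio_nonneg
  have := h.del_pos
  have := h.gam_pos
  have := h.Rsq_nonneg
  rw [h.a4_eq]
  positivity

theorem Standing.complexity_ge (h : Standing p c b) : 1 / c.del + m ≤ complexity p c := by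
  have := div_nonneg h.a4_nonneg h.sig_pos.le
  unfold complexity
  linarith

theorem Standing.two_le_complexity (h : Standing p c b) : 2 ≤ complexity p c := by
  have h1 := h.complexity_ge
  have h2 : 1 ≤ 1 / c.del := by
    rw [le_div_iff₀ h.del_pos]; linarith [h.del_lt]
  have h3 : (1 : ℝ) ≤ m := by exact_mod_cast h.hm
  linarith

theorem Standing.complexity_pos (h : Standing p c b) : 0 < complexity p c := by
  linarith [h.two_le_complexity]

theorem Standing.theta_pos (h : Standing p c b) : 0 < c.theta := by
  have := h.complexity_pos
  have := h.hb
  exact lt_of_lt_of_le (by positivity) h.theta_ge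

theorem Standing.theta_mul_le (h : Standing p c b) : c.theta * complexity p c ≤ 1 / 100 := by
  have h1 := h.theta_le
  have h2 := h.complexity_pos
  rw [le_div_iff₀ (by positivity)] at h1
  linarith

theorem Standing.theta_mul_add_le (h : Standing p c b) : c.theta * (1 / c.del + m) ≤ 1 / 100 :=
  (mul_le_mul_of_nonneg_left h.complexity_ge h.theta_pos.le).trans h.theta_mul_le

theorem Standing.theta_le_del (h : Standing p c b) : c.theta ≤ c.del / 100 := by
  have h1 := h.theta_mul_add_le
  have h2 : 0 ≤ c.theta * m := mul_nonneg h.theta_pos.le m.cast_nonneg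
  have h3 : c.theta * (1 / c.del) ≤ 1 / 100 := by linarith
  rw [mul_one_div, div_le_iff₀ h.del_pos] at h3
  linarith

theorem Standing.theta_mul_m_le (h : Standing p c b) : c.theta * m ≤ 1 / 100 := by
  have h1 := h.theta_mul_add_le
  have h2 : 0 ≤ c.theta * (1 / c.del) := mul_nonneg h.theta_pos.le (by
    have := h.del_pos; positivity)
  linarith

theorem Standing.theta_mul_a4_le (h : Standing p c b) :
    c.theta * a4 p c ≤ (c.lam + c.kap) / 100 := by
  have h1 := h.theta_mul_le
  have h2 : a4 p c / (c.lam + c.kap) ≤ complexity p c := by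
    have : 0 ≤ 1 / c.del + m := by have := h.del_pos; positivity
    unfold complexity; linarith
  have h3 := (mul_le_mul_of_nonneg_left h2 h.theta_pos.le).trans h1
  rw [mul_div_assoc', div_le_iff₀ h.sig_pos] at h3
  linarith

theorem Standing.theta_smooth_le (h : Standing p c b) :
    c.theta * ((1 + p.ratio) * p.Rsq) ≤ c.gam * (c.lam + c.kap) / 100 := by
  have h1 := h.theta_mul_a4_le
  have h2 : (1 + p.ratio) * (p.Rsq / c.gam) ≤ a4 p c := by
    rw [h.a4_eq]
    have := h.Rsq_nonneg
    have := h.gam_pos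
    have := h.del_pos
    have : 0 ≤ Real.sqrt (1 - c.del) / c.del := by positivity
    exact mul_le_mul_of_nonneg_right (by linarith) (by positivity)
  have h3 := (mul_le_mul_of_nonneg_left h2 h.theta_pos.le).trans h1
  have e : c.theta * ((1 + p.ratio) * (p.Rsq / c.gam))
      = c.theta * ((1 + p.ratio) * p.Rsq) / c.gam := by ring
  rw [e, div_le_iff₀ h.gam_pos] at h3
  linarith

/-- With r = √(1-δ) ≤ 1 and u = δρ one has r²(1+u) ≤ r² + ru ≤ (r+u)². This is how the term
√(1-δ)R²/(δγ) of a₄ covers the error weight. -/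
theorem Standing.rootTerm_div_le (h : Standing p c b) :
    rootTerm p c / c.del ≤ 3 / 2 * (p.ratio + 1 + Real.sqrt (1 - c.del) / c.del) := by
  have hd := h.del_pos
  have h1d : 0 < 1 - c.del := by linarith [h.del_lt]
  have hρ := h.ratio_nonneg
  set r := Real.sqrt (1 - c.del) with hr
  have hr0 : 0 < r := Real.sqrt_pos.2 h1d
  have hr2 : r ^ 2 = 1 - c.del := Real.sq_sqrt h1d.le
  have hr1 : r ≤ 1 := by nlinarith
  rw [div_le_iff₀ hd]
  have e : 3 / 2 * (p.ratio + 1 + r / c.del) * c.del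
      = 3 / 2 * (c.del * p.ratio + c.del + r) := by field_simp
  rw [e]
  apply Real.sqrt_le_iff.2
  constructor
  · positivity
  · rw [← hr2]
    have h3 : 0 ≤ c.del * p.ratio := by positivity
    set u := c.del * p.ratio
    have h4 : r ^ 2 * (1 + u) ≤ r ^ 2 + r * u := by nlinarith [mul_nonneg hr0.le h3]
    have h5 : (u + r) ^ 2 ≤ (u + c.del + r) ^ 2 := by gcongr; linarith
    nlinarith [mul_nonneg hr0.le h3, sq_nonneg u]

/-- The step-size condition used for compression, both for the cross term with e and for the newly
created error; `theta_smooth_le` plays this role for the sampling variance of the dual step. -/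
theorem Standing.theta_root_Rsq_le (h : Standing p c b) :
    c.theta * (rootTerm p c / c.del * p.Rsq) ≤ 3 / 200 * (c.gam * (c.lam + c.kap)) := by
  have h1 := h.theta_mul_a4_le
  have hg := h.gam_pos
  have h2 : rootTerm p c / c.del * (p.Rsq / c.gam) ≤ 3 / 2 * a4 p c := by
    rw [h.a4_eq, ← mul_assoc]
    have := h.Rsq_nonneg
    gcongr
    exact h.rootTerm_div_le
  have h3 := mul_le_mul_of_nonneg_left h2 h.theta_pos.le
  have e : c.theta * (rootTerm p c / c.del * (p.Rsq / c.gam))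
      = c.theta * (rootTerm p c / c.del * p.Rsq) / c.gam := by ring
  rw [e, div_le_iff₀ h.gam_pos] at h3
  nlinarith

theorem Standing.theta_root_le (h : Standing p c b) :
    c.theta * (rootTerm p c / c.del) ≤ 1 / 100 := by
  refine le_trans (mul_le_mul_of_nonneg_left ?_ h.theta_pos.le) h.theta_mul_add_le
  have hd := h.del_pos
  rw [div_le_iff₀ hd]
  have e : (1 / c.del + m) * c.del = 1 + c.del * m := by field_simp
  rw [e]
  apply Real.sqrt_le_iff.2
  have h0 : 0 ≤ c.del * m := by positivity
  have h1 : c.del * p.ratio ≤ c.del * m := by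
    gcongr; exact p.ratio_le h.hm h.hn
  have h2 : 0 ≤ c.del * p.ratio := mul_nonneg hd.le h.ratio_nonneg
  constructor
  · positivity
  · nlinarith

theorem Standing.weightScale_pos (h : Standing p c b) : 0 < weightScale p c := by
  rw [weightScale_eq]
  exact div_pos h.sig_pos h.rootTerm_pos

/-- The scalar inequality behind the contraction of the Lyapunov function. -/
theorem Standing.absorb (h : Standing p c b) {e c' B : ℝ} (hB : 0 ≤ B) (hcB : c' ^ 2 ≤ p.Rsq * B) :
    c.theta * (c.lam + c.kap) / 2 * e ^ 2 + c.theta * (e * c')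
      - c.gam / 4 * c.theta * (1 - c.theta * m) * B
      + (c.lam + c.kap) / 2 * ((1 + p.ratio) * (c.theta ^ 2 * p.Rsq * B / (c.lam + c.kap) ^ 2))
      + 9 * (weightScale p c / 5) * ((1 - c.del) * ((3 / c.del + p.ratio)
        * (c.theta ^ 2 * p.Rsq * B / (c.lam + c.kap) ^ 2)))
      ≤ weightScale p c / 5 * (c.del - c.theta) * e ^ 2 := by
  set σ := c.lam + c.kap with hσ
  have hs : 0 < σ := h.sig_pos
  have hg := h.gam_pos
  have hd := h.del_pos
  have hθ := h.theta_pos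
  have hR := h.Rsq_nonneg
  have hρ := h.ratio_nonneg
  have hk := h.rootTerm_pos
  rw [weightScale_eq, ← hσ]
  set κ := rootTerm p c with hκ
  have hκ2 : κ ^ 2 = (1 - c.del) * (1 + c.del * p.ratio) := h.rootTerm_sq
  have k1 : c.theta * (κ / c.del * p.Rsq) ≤ 3 / 200 * (c.gam * σ) := h.theta_root_Rsq_le
  have k2 : c.theta * (κ / c.del) ≤ 1 / 100 := h.theta_root_le
  have k3 : c.theta * ((1 + p.ratio) * p.Rsq) ≤ c.gam * σ / 100 := h.theta_smooth_le
  have hθm := h.theta_mul_m_le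
  have hθd := h.theta_le_del
  -- the cross term
  have t1 : e * c' ≤ c.gam * B / 12 + 3 * (p.Rsq / c.gam) * e ^ 2 := by
    apply le_of_sq_le_sq _ (by positivity)
    -- The weights make the product match R²B·e² exactly in the arithmetic-geometric mean
    -- inequality, while using only γB/12 of the available γB/4.
    have h4 : 4 * (c.gam * B / 12) * (3 * (p.Rsq / c.gam) * e ^ 2) = p.Rsq * B * e ^ 2 := by
      field_simp; ring
    have h5 : (e * c') ^ 2 ≤ p.Rsq * B * e ^ 2 := by
      rw [mul_pow, mul_comm]; gcongr
    nlinarith [sq_nonneg (c.gam * B / 12 - 3 * (p.Rsq / c.gam) * e ^ 2)]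
  have t1' : c.theta * (e * c') ≤ c.theta * (c.gam * B / 12)
      + 3 * (c.theta * p.Rsq / c.gam) * e ^ 2 := by
    have := mul_le_mul_of_nonneg_left t1 hθ.le
    calc _ ≤ _ := this
      _ = _ := by ring
  have t2 : c.theta * p.Rsq / c.gam ≤ 3 / 200 * (σ * c.del / κ) := by
    rw [div_le_iff₀ hg]
    have : c.theta * p.Rsq = c.theta * (κ / c.del * p.Rsq) * (c.del / κ) := by field_simp
    rw [this]
    calc _ ≤ 3 / 200 * (c.gam * σ) * (c.del / κ) := by gcongr
      _ = _ := by ring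
  have t3 : c.theta * σ / 2 ≤ 1 / 200 * (σ * c.del / κ) := by
    have : c.theta * σ / 2 = c.theta * (κ / c.del) * (σ * c.del / κ / 2) := by field_simp
    rw [this]
    calc _ ≤ 1 / 100 * (σ * c.del / κ / 2) := by gcongr
      _ = _ := by ring
  have t4 : σ / 2 * ((1 + p.ratio) * (c.theta ^ 2 * p.Rsq * B / σ ^ 2))
      ≤ c.theta * (c.gam * B / 200) := by
    have : σ / 2 * ((1 + p.ratio) * (c.theta ^ 2 * p.Rsq * B / σ ^ 2))
        = c.theta * ((1 + p.ratio) * p.Rsq) * (c.theta * B / (2 * σ)) := by field_simp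
    rw [this]
    calc _ ≤ c.gam * σ / 100 * (c.theta * B / (2 * σ)) := by gcongr
      _ = _ := by field_simp; ring
  -- The weight has κ in the denominator and the injected error a factor κ²/δ, so a single κ/δ
  -- remains, which the step size controls.
  have t5 : 9 * (σ / κ / 5) * ((1 - c.del) * ((3 / c.del + p.ratio)
        * (c.theta ^ 2 * p.Rsq * B / σ ^ 2))) ≤ c.theta * (c.gam * B * (81 / 1000)) := by
    have h1d : 0 < 1 - c.del := by linarith [h.del_lt]
    have h6 : (1 - c.del) * (3 / c.del + p.ratio) ≤ 3 * κ ^ 2 / c.del := by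
      rw [hκ2, le_div_iff₀ hd]
      have : (1 - c.del) * (3 / c.del + p.ratio) * c.del
        = (1 - c.del) * (3 + c.del * p.ratio) := by field_simp
      rw [this]
      have : 0 ≤ (1 - c.del) * (c.del * p.ratio) := by positivity
      nlinarith
    calc _ = 9 * (σ / κ / 5) * (((1 - c.del) * (3 / c.del + p.ratio))
        * (c.theta ^ 2 * p.Rsq * B / σ ^ 2)) := by ring
      _ ≤ 9 * (σ / κ / 5) * ((3 * κ ^ 2 / c.del) * (c.theta ^ 2 * p.Rsq * B / σ ^ 2)) := by gcongr
      _ = 27 / 5 * (c.theta * (κ / c.del * p.Rsq)) * (c.theta * B / σ) := by field_simp; ring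
      _ ≤ 27 / 5 * (3 / 200 * (c.gam * σ)) * (c.theta * B / σ) := by gcongr
      _ = _ := by field_simp; ring
  have t6 : c.gam / 4 * c.theta * (99 / 100) * B
      ≤ c.gam / 4 * c.theta * (1 - c.theta * m) * B := by gcongr; linarith
  have t7 : σ / κ / 5 * (c.del * (99 / 100)) * e ^ 2 ≤ σ / κ / 5 * (c.del - c.theta) * e ^ 2 := by
    gcongr; linarith
  have t8 : (c.theta * σ / 2 + 3 * (c.theta * p.Rsq / c.gam)) * e ^ 2
      ≤ (1 / 200 * (σ * c.del / κ) + 3 * (3 / 200 * (σ * c.del / κ))) * e ^ 2 := by gcongr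
  have t9 : σ / κ / 5 * (c.del * (99 / 100)) * e ^ 2 = 99 / 500 * ((σ * c.del / κ) * e ^ 2) := by
    ring
  have t10 : 0 ≤ (σ * c.del / κ) * e ^ 2 := by positivity
  have t11 : 0 ≤ c.theta * c.gam * B := by positivity
  -- Balance of coefficients: for θγB, 1/12 + 1/200 + 81/1000 stays below 99/400; for (σδ/κ)e²,
  -- 1/200 + 9/200 stays below 99/500.
  rw [t9] at t7
  linarith

end

/-! ### One iteration of EC-SDCA -/

section

variable {d t m n : ℕ}

/-- The direction in which a sampled dual variable is moved. -/
noncomputable def dir (p : Problem d t m n) (c : Params) (y : Rn d) (s : State d t m n) (i : Fin m)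
    (τ : Fin n) : Rn t :=
  -gradient (p.φ i τ) (ContinuousLinearMap.adjoint (p.A i τ) (primal p c y s)) - s.α i τ

/-- The sum of the squared lengths of the directions, over `N`. -/
noncomputable def dirSq (p : Problem d t m n) (c : Params) (y : Rn d) (s : State d t m n) : ℝ :=
  1 / ((m : ℝ) * n) * ∑ τ, ∑ i, ‖dir p c y s i τ‖ ^ 2

/-- The contribution of the dual increment to the vector that a node compresses. -/
noncomputable def zeta (p : Problem d t m n) (c : Params) (y : Rn d) (s : State d t m n)
    (i : Fin m) (τ : Fin n) : Rn d :=
  (c.theta / (c.lam + c.kap)) • p.A i τ (dir p c y s i τ)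

/-- The averaged error vector. -/
noncomputable def State.errMean (s : State d t m n) : Rn d := (1 / (n : ℝ)) • ∑ τ, s.e τ

/-- The scaled sum of the squared errors. -/
noncomputable def State.errSq (s : State d t m n) : ℝ := 1 / (n : ℝ) ^ 2 * ∑ τ, ‖s.e τ‖ ^ 2

theorem State.errSq_nonneg (s : State d t m n) : 0 ≤ s.errSq := by
  unfold State.errSq; positivity

/-- The invariants of EC-SDCA. -/
structure Invariant (p : Problem d t m n) (c : Params) (s : State d t m n) : Prop where
  sum_eq : s.u + s.errMean = vOf p c s.α
  feasible : p.DualFeasible s.α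

variable {p : Problem d t m n} {c : Params} {b : ℝ}

theorem incr_eq (y : Rn d) (s : State d t m n) (i : Fin m) (τ : Fin n) :
    incr p c y s i τ = (c.theta * m) • dir p c y s i τ := by
  unfold incr dir
  module

theorem Standing.toSend_eq (h : Standing p c b) (y : Rn d) (s : State d t m n) (i : Fin m)
    (τ : Fin n) : toSend p c y s i τ = zeta p c y s i τ + s.e τ := by
  have hm : (m : ℝ) ≠ 0 := by exact_mod_cast h.hm.ne'
  have hs := h.sig_pos.ne'
  unfold toSend zeta
  rw [incr_eq, map_smul, smul_smul]
  congr 2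
  field_simp

variable {Ξ : Type*} {Q : Ξ → Rn d → Rn d}

theorem Standing.vOf_step (h : Standing p c b) (y : Rn d) (r : Fin n → Fin m × Ξ)
    (s : State d t m n) :
    vOf p c (step p c Q y r s).α
      = vOf p c s.α + ∑ τ, (1 / (n : ℝ)) • zeta p c y s (r τ).1 τ := by
  have hm : (m : ℝ) ≠ 0 := by exact_mod_cast h.hm.ne'
  have hn : (n : ℝ) ≠ 0 := by exact_mod_cast h.hn.ne'
  have hs := h.sig_pos.ne'
  have e1 : ∀ τ i, p.A i τ ((step p c Q y r s).α i τ)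
      = p.A i τ (s.α i τ) + if i = (r τ).1 then p.A i τ (incr p c y s i τ) else 0 := by
    intro τ i
    simp only [step]
    split_ifs <;> simp
  simp only [vOf, e1, Finset.sum_add_distrib, Finset.sum_ite_eq', Finset.mem_univ, if_true,
    smul_add]
  congr 1
  rw [Finset.smul_sum]
  refine Finset.sum_congr rfl fun τ _ => ?_
  rw [incr_eq, map_smul, zeta, smul_smul, smul_smul]
  congr 1
  field_simp

theorem Standing.theta_m_mem (h : Standing p c b) : 0 ≤ c.theta * m ∧ c.theta * m ≤ 1 :=
  ⟨mul_nonneg h.theta_pos.le m.cast_nonneg, h.theta_mul_m_le.trans (by norm_num)⟩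

theorem neg_step_α (y : Rn d) (s : State d t m n) (i : Fin m) (τ : Fin n) :
    -(s.α i τ + incr p c y s i τ) = (1 - c.theta * m) • -(s.α i τ)
      + (c.theta * m) • gradient (p.φ i τ)
        (ContinuousLinearMap.adjoint (p.A i τ) (primal p c y s)) := by
  unfold incr
  module

/-- The new -α_{iτ} is a convex combination, with weight θm, of the old one and a gradient, and the
conjugate is finite and strongly convex between two such points. -/
theorem Standing.step_conj (h : Standing p c b) (y : Rn d) {s : State d t m n}
    (hs : p.DualFeasible s.α) (i : Fin m) (τ : Fin n) :
    BddAbove (Set.range fun z => inner ℝ (-(s.α i τ + incr p c y s i τ)) z - p.φ i τ z) ∧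
    conjugate (p.φ i τ) (-(s.α i τ + incr p c y s i τ))
      ≤ (1 - c.theta * m) * conjugate (p.φ i τ) (-(s.α i τ))
        + c.theta * m * conjugate (p.φ i τ) (gradient (p.φ i τ)
          (ContinuousLinearMap.adjoint (p.A i τ) (primal p c y s)))
        - c.gam / 4 * (c.theta * m) * (1 - c.theta * m) * ‖dir p c y s i τ‖ ^ 2 := by
  have h1 := conjugate_convex_comb h.gam_pos (h.adm.convex i τ) (h.adm.smooth i τ) (hs i τ)
    (bddAbove_gradient (h.adm.convex i τ) (h.adm.smooth i τ).1
      (ContinuousLinearMap.adjoint (p.A i τ) (primal p c y s)))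
    h.theta_m_mem.1 h.theta_m_mem.2
  rw [neg_step_α]
  have e : dir p c y s i τ = -(s.α i τ) - gradient (p.φ i τ)
        (ContinuousLinearMap.adjoint (p.A i τ) (primal p c y s)) := by unfold dir; abel
  rw [e]
  exact h1

/-- Error feedback loses nothing: what is not sent is stored, so u + e follows v(α) exactly whatever
the compressor returns. -/
theorem Standing.invariant_step (h : Standing p c b) (y : Rn d) (r : Fin n → Fin m × Ξ)
    {s : State d t m n} (hs : Invariant p c s) : Invariant p c (step p c Q y r s) := by
  constructor
  · rw [h.vOf_step, ← hs.sum_eq]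
    simp only [State.errMean, step, h.toSend_eq, Finset.sum_sub_distrib, Finset.sum_add_distrib,
      ← Finset.smul_sum]
    module
  · intro i τ
    by_cases hi : i = (r τ).1
    · simp only [step, if_pos hi]
      exact (h.step_conj y hs.feasible i τ).1
    · simp only [step, if_neg hi]
      exact hs.feasible i τ

/-- The change of the dual objective through the sampled index of one node, up to second order. -/
noncomputable def dualDrop (p : Problem d t m n) (c : Params) (y : Rn d) (s : State d t m n)
    (τ : Fin n) (i : Fin m) : ℝ :=
  1 / ((m : ℝ) * n) * (c.theta * m * (conjugate (p.φ i τ) (gradient (p.φ i τ)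
          (ContinuousLinearMap.adjoint (p.A i τ) (primal p c y s)))
        - conjugate (p.φ i τ) (-(s.α i τ)))
      - c.gam / 4 * (c.theta * m) * (1 - c.theta * m) * ‖dir p c y s i τ‖ ^ 2)
    + (c.lam + c.kap) / n *
      inner ℝ (gradient (conjugate (xi p c y)) (vOf p c s.α)) (zeta p c y s i τ)

/-- Strong convexity of the loss conjugates handles each sampled coordinate, and 1-smoothness of ξ*
the aggregate. Only the final quadratic term couples the nodes. -/
theorem Standing.neg_dual_step_le (h : Standing p c b) (y : Rn d) (r : Fin n → Fin m × Ξ)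
    {s : State d t m n} (hs : p.DualFeasible s.α) :
    -dual p c y (step p c Q y r s).α ≤ -dual p c y s.α + ∑ τ, dualDrop p c y s τ (r τ).1
      + (c.lam + c.kap) / 2 * ‖∑ τ, (1 / (n : ℝ)) • zeta p c y s (r τ).1 τ‖ ^ 2 := by
  have hσ := h.sig_pos
  have h1 : ∑ τ, ∑ i, conjugate (p.φ i τ) (-((step p c Q y r s).α i τ))
      ≤ ∑ τ, ∑ i, (conjugate (p.φ i τ) (-(s.α i τ)) + if i = (r τ).1 then
          c.theta * m * (conjugate (p.φ i τ) (gradient (p.φ i τ)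
          (ContinuousLinearMap.adjoint (p.A i τ) (primal p c y s)))
        - conjugate (p.φ i τ) (-(s.α i τ)))
      - c.gam / 4 * (c.theta * m) * (1 - c.theta * m) * ‖dir p c y s i τ‖ ^ 2 else 0) := by
    refine Finset.sum_le_sum fun τ _ => Finset.sum_le_sum fun i _ => ?_
    by_cases hi : i = (r τ).1
    · simp only [step, if_pos hi]
      have := (h.step_conj y hs i τ).2
      linarith
    · simp only [step, if_neg hi, add_zero, le_refl]
  simp only [Finset.sum_add_distrib, Finset.sum_ite_eq', Finset.mem_univ, if_true] at h1
  have h2 := StrongConvexOn.conjugate_le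
    (fun z => StrongConvexOn.argmax_gradient (h.xi_strong y) (vOf p c s.α) z)
    (vOf p c (step p c Q y r s).α)
  rw [h.vOf_step, add_sub_cancel_left] at h2
  have hN := h.N_pos
  have h3 := mul_le_mul_of_nonneg_left h1 (show 0 ≤ 1 / ((m : ℝ) * n) by positivity)
  have h4 := mul_le_mul_of_nonneg_left h2 hσ.le
  simp only [inner_sum, inner_smul_right] at h4
  simp only [dual, dualDrop, Finset.sum_add_distrib, ← Finset.mul_sum]
  rw [h.vOf_step]
  have e : (c.lam + c.kap) / n * ∑ τ, inner ℝ (gradient (conjugate (xi p c y)) (vOf p c s.α))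
      (zeta p c y s (r τ).1 τ) = (c.lam + c.kap) * ∑ τ, 1 / (n : ℝ) *
        inner ℝ (gradient (conjugate (xi p c y)) (vOf p c s.α)) (zeta p c y s (r τ).1 τ) := by
    rw [← Finset.mul_sum]; ring
  rw [e]
  linarith

theorem Standing.norm_sum_dir_le (h : Standing p c b) (y : Rn d) (s : State d t m n) :
    ‖(1 / ((m : ℝ) * n)) • ∑ τ, ∑ i, p.A i τ (dir p c y s i τ)‖ ^ 2
      ≤ p.Rsq * dirSq p c y s := by
  have h1 := p.norm_sum_sq_le h.hm h.hn fun i τ => dir p c y s i τ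
  have hN := h.N_pos
  rw [norm_smul, mul_pow, Real.norm_eq_abs, sq_abs]
  calc _ ≤ (1 / ((m : ℝ) * n)) ^ 2 *
        ((m * n : ℝ) * p.Rsq * ∑ τ, ∑ i, ‖dir p c y s i τ‖ ^ 2) := by gcongr
    _ = _ := by unfold dirSq; field_simp

/-- Sampling with probability 1/m cancels the factor m in the step. Fenchel equality at the
gradients produces the loss defects of the gap. Replacing ∇ξ*(v) by x = ∇ξ*(u) costs ‖v-u‖ = ‖e‖ in
the linear term, and completing the gap by the defect of the regularizer costs ½‖e‖². -/
theorem Standing.mean_dualDrop_le (h : Standing p c b) (y : Rn d) {s : State d t m n}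
    (hs : Invariant p c s) :
    ∑ τ, 1 / (m : ℝ) * ∑ i, dualDrop p c y s τ i
      ≤ -c.theta * (G p c y (primal p c y s) - dual p c y s.α)
        + c.theta * (c.lam + c.kap) / 2 * ‖s.errMean‖ ^ 2
        + c.theta * (‖s.errMean‖ * ‖(1 / ((m : ℝ) * n)) • ∑ τ, ∑ i, p.A i τ (dir p c y s i τ)‖)
        - c.gam / 4 * c.theta * (1 - c.theta * m) * dirSq p c y s := by
  have hσ := h.sig_pos
  have hθ := h.theta_pos
  have hm : (m : ℝ) ≠ 0 := by exact_mod_cast h.hm.ne'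
  have hn : (n : ℝ) ≠ 0 := by exact_mod_cast h.hn.ne'
  set σ := c.lam + c.kap with hσd
  set x := primal p c y s with hx
  set v := vOf p c s.α with hv
  set xv := gradient (conjugate (xi p c y)) v with hxv
  set V : Rn d := ∑ τ, ∑ i, p.A i τ (dir p c y s i τ) with hV
  have hgap := h.G_sub_dual y x s.α
  -- Fenchel equality at the gradients
  have hF : ∀ i τ, conjugate (p.φ i τ) (gradient (p.φ i τ)
        (ContinuousLinearMap.adjoint (p.A i τ) x)) - conjugate (p.φ i τ) (-(s.α i τ))
      = -(p.φ i τ (ContinuousLinearMap.adjoint (p.A i τ) x)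
          + conjugate (p.φ i τ) (-(s.α i τ))
          + inner ℝ (ContinuousLinearMap.adjoint (p.A i τ) x) (s.α i τ))
        - inner ℝ x (p.A i τ (dir p c y s i τ)) := by
    intro i τ
    rw [conjugate_gradient (h.adm.convex i τ) (h.adm.smooth i τ).1,
      ← ContinuousLinearMap.adjoint_inner_left (p.A i τ) (dir p c y s i τ) x, dir, ← hx, inner_sub_right, inner_neg_right,
      real_inner_comm (ContinuousLinearMap.adjoint (p.A i τ) x) (gradient _ _)]
    ring
  have e1 : ∀ i τ, 1 / (m : ℝ) * dualDrop p c y s τ i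
      = -c.theta * (1 / ((m : ℝ) * n) * (p.φ i τ (ContinuousLinearMap.adjoint (p.A i τ) x)
          + conjugate (p.φ i τ) (-(s.α i τ))
          + inner ℝ (ContinuousLinearMap.adjoint (p.A i τ) x) (s.α i τ)))
        + c.theta * (1 / ((m : ℝ) * n) * inner ℝ (xv - x) (p.A i τ (dir p c y s i τ)))
        - c.gam / 4 * c.theta * (1 - c.theta * m) *
          (1 / ((m : ℝ) * n) * ‖dir p c y s i τ‖ ^ 2) := by
    intro i τ
    unfold dualDrop
    rw [← hx, hF i τ, ← hv, ← hxv, zeta, inner_smul_right, inner_sub_left, ← hσd]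
    field_simp
    ring
  have e2 : ∑ τ, 1 / (m : ℝ) * ∑ i, dualDrop p c y s τ i
      = -c.theta * (1 / ((m : ℝ) * n) * ∑ τ, ∑ i,
          (p.φ i τ (ContinuousLinearMap.adjoint (p.A i τ) x)
          + conjugate (p.φ i τ) (-(s.α i τ))
          + inner ℝ (ContinuousLinearMap.adjoint (p.A i τ) x) (s.α i τ)))
        + c.theta * inner ℝ (xv - x) ((1 / ((m : ℝ) * n)) • V)
        - c.gam / 4 * c.theta * (1 - c.theta * m) * dirSq p c y s := by
    rw [inner_smul_right, hV]
    simp only [dirSq, inner_sum]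
    simp only [Finset.mul_sum, e1, ← Finset.sum_add_distrib, ← Finset.sum_sub_distrib]
  have h3 : inner ℝ (xv - x) ((1 / ((m : ℝ) * n)) • V)
      ≤ ‖s.errMean‖ * ‖(1 / ((m : ℝ) * n)) • V‖ := by
    refine (real_inner_le_norm _ _).trans ?_
    gcongr
    have := StrongConvexOn.gradient_conjugate_lipschitz (h.xi_strong y) v s.u
    have e3 : v - s.u = s.errMean := by rw [hv, ← hs.sum_eq]; abel
    rwa [e3] at this
  -- the Fenchel-Young defect of the regularizer
  have h4 := StrongConvexOn.conjugate_le
    (fun z => StrongConvexOn.argmax_gradient (h.xi_strong y) s.u z) v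
  have h5 : conjugate (xi p c y) s.u = inner ℝ s.u x - xi p c y x :=
    StrongConvexOn.conjugate_eq (h.xi_strong y) s.u
  have e3 : v - s.u = s.errMean := by rw [hv, ← hs.sum_eq]; abel
  rw [e3, h5] at h4
  have h6 : xi p c y x + conjugate (xi p c y) v - inner ℝ x v ≤ 1 / 2 * ‖s.errMean‖ ^ 2 := by
    have e4 : inner ℝ x v = inner ℝ s.u x + inner ℝ x s.errMean := by
      rw [hv, ← hs.sum_eq, inner_add_right, real_inner_comm x s.u]
    have h7 : conjugate (xi p c y) v ≤ inner ℝ s.u x - xi p c y x + inner ℝ x s.errMean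
      + 1 / 2 * ‖s.errMean‖ ^ 2 := h4
    linarith
  have h8 := mul_le_mul_of_nonneg_left h6 (mul_pos hθ hσ).le
  have h9 := mul_le_mul_of_nonneg_left h3 hθ.le
  rw [e2, hgap]
  linarith

end

/-! ### Expected decrease of the Lyapunov function -/

section

variable {d t m n : ℕ} {p : Problem d t m n} {c : Params} {b : ℝ}

/-- The Lyapunov function with reference weights; `a` scales the weight of the last term. -/
noncomputable def lyap (p : Problem d t m n) (c : Params) (a : ℝ) (y : Rn d) (s : State d t m n) :
    ℝ :=
  (Gstar p c y - dual p c y s.α) + weightScale p c / 5 * ‖s.errMean‖ ^ 2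
    + a * (8 * (weightScale p c / 5)) * s.errSq

/-- The size of the second moments of the increments. -/
noncomputable def incrSq (p : Problem d t m n) (c : Params) (y : Rn d) (s : State d t m n) : ℝ :=
  c.theta ^ 2 * p.Rsq * dirSq p c y s / (c.lam + c.kap) ^ 2

theorem dirSq_nonneg (y : Rn d) (s : State d t m n) : 0 ≤ dirSq p c y s := by
  unfold dirSq; positivity

theorem Standing.incrSq_nonneg (h : Standing p c b) (y : Rn d) (s : State d t m n) :
    0 ≤ incrSq p c y s := by
  have := h.Rsq_nonneg
  have := dirSq_nonneg (p := p) (c := c) y s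
  unfold incrSq; positivity

theorem Standing.norm_mean_zeta_le (h : Standing p c b) (y : Rn d) (s : State d t m n) :
    ‖∑ τ, (1 / (m : ℝ)) • ∑ i, (1 / (n : ℝ)) • zeta p c y s i τ‖ ^ 2 ≤ incrSq p c y s := by
  have h1 := h.norm_sum_dir_le y s
  have e : ∑ τ, (1 / (m : ℝ)) • ∑ i, (1 / (n : ℝ)) • zeta p c y s i τ
      = (c.theta / (c.lam + c.kap)) •
        ((1 / ((m : ℝ) * n)) • ∑ τ, ∑ i, p.A i τ (dir p c y s i τ)) := by
    simp only [zeta, Finset.smul_sum, smul_smul]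
    refine Finset.sum_congr rfl fun τ _ => Finset.sum_congr rfl fun i _ => ?_
    congr 1
    ring
  rw [e, norm_smul, mul_pow, Real.norm_eq_abs, sq_abs]
  calc _ ≤ (c.theta / (c.lam + c.kap)) ^ 2 * (p.Rsq * dirSq p c y s) := by gcongr
    _ = _ := by unfold incrSq; rw [div_pow]; ring

theorem Standing.sum_sq_zeta_le (h : Standing p c b) (y : Rn d) (s : State d t m n) :
    1 / (n : ℝ) ^ 2 * ∑ τ, 1 / (m : ℝ) * ∑ i, ‖zeta p c y s i τ‖ ^ 2
      ≤ p.ratio * incrSq p c y s := by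
  have hm : (0 : ℝ) < m := by exact_mod_cast h.hm
  have hn : (0 : ℝ) < n := by exact_mod_cast h.hn
  have h1 : ∀ i τ, ‖zeta p c y s i τ‖ ^ 2
      ≤ (c.theta / (c.lam + c.kap)) ^ 2 * (p.Rm ^ 2 * ‖dir p c y s i τ‖ ^ 2) := by
    intro i τ
    rw [zeta, norm_smul, mul_pow, Real.norm_eq_abs, sq_abs]
    gcongr
    exact p.norm_A_apply_sq_le i τ _
  calc _ ≤ 1 / (n : ℝ) ^ 2 * ∑ τ, 1 / (m : ℝ) * ∑ i,
        (c.theta / (c.lam + c.kap)) ^ 2 * (p.Rm ^ 2 * ‖dir p c y s i τ‖ ^ 2) := by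
        gcongr with τ _ i _
        exact h1 i τ
    _ = _ := by
        simp only [← Finset.mul_sum]
        unfold incrSq dirSq
        rw [p.Rm_sq_eq h.hm h.hn]
        field_simp

theorem Standing.sum_node_mean_zeta_le (h : Standing p c b) (y : Rn d) (s : State d t m n) :
    1 / (n : ℝ) ^ 2 * ∑ τ, ‖(1 / (m : ℝ)) • ∑ i, zeta p c y s i τ‖ ^ 2 ≤ incrSq p c y s := by
  have hm : (0 : ℝ) < m := by exact_mod_cast h.hm
  have hn : (0 : ℝ) < n := by exact_mod_cast h.hn
  have h1 : ∀ τ, ‖(1 / (m : ℝ)) • ∑ i, zeta p c y s i τ‖ ^ 2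
      ≤ (c.theta / (c.lam + c.kap) / m) ^ 2 *
        ((m * n : ℝ) * p.Rsq * ∑ i, ‖dir p c y s i τ‖ ^ 2) := by
    intro τ
    have e : (1 / (m : ℝ)) • ∑ i, zeta p c y s i τ = (c.theta / (c.lam + c.kap) / m) •
        ∑ i, p.A i τ (dir p c y s i τ) := by
      simp only [zeta, ← Finset.smul_sum, smul_smul]
      congr 1
      ring
    rw [e, norm_smul, mul_pow, Real.norm_eq_abs, sq_abs]
    gcongr
    exact p.norm_node_sum_sq_le h.hm h.hn τ _
  calc _ ≤ 1 / (n : ℝ) ^ 2 * ∑ τ, (c.theta / (c.lam + c.kap) / m) ^ 2 *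
        ((m * n : ℝ) * p.Rsq * ∑ i, ‖dir p c y s i τ‖ ^ 2) := by
        gcongr with τ _
        exact h1 τ
    _ = _ := by
        simp only [← Finset.mul_sum]
        unfold incrSq dirSq
        field_simp

theorem norm_add_sq_le_weighted {k : ℕ} {a : ℝ} (ha : 0 < a) (x y : Rn k) :
    ‖x + y‖ ^ 2 ≤ (1 + a) * ‖x‖ ^ 2 + (1 + 1 / a) * ‖y‖ ^ 2 := by
  have h0 : ‖x + y‖ ^ 2 ≤ (‖x‖ + ‖y‖) ^ 2 := by gcongr; exact norm_add_le x y
  have h1 : 0 ≤ 1 / a * (a * ‖x‖ - ‖y‖) ^ 2 := by positivity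
  have e : 1 / a * (a * ‖x‖ - ‖y‖) ^ 2 = a * ‖x‖ ^ 2 + 1 / a * ‖y‖ ^ 2 - 2 * ‖x‖ * ‖y‖ := by
    field_simp; ring
  linarith

/-- Young's inequality is applied only to the mean of the f i, so the full second moment enters with
coefficient 1 rather than 1 + 1/a. -/
theorem mean_norm_add_sq_le {k : ℕ} {a : ℝ} (ha : 0 < a) (hm : 0 < m) (f : Fin m → Rn k)
    (x : Rn k) :
    1 / (m : ℝ) * ∑ i, ‖f i + x‖ ^ 2 ≤ (1 + a) * ‖x‖ ^ 2
      + 1 / a * ‖(1 / (m : ℝ)) • ∑ i, f i‖ ^ 2 + 1 / (m : ℝ) * ∑ i, ‖f i‖ ^ 2 := by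
  have hm' : (m : ℝ) ≠ 0 := by exact_mod_cast hm.ne'
  set M := (1 / (m : ℝ)) • ∑ i, f i with hM
  have e : 1 / (m : ℝ) * ∑ i, ‖f i + x‖ ^ 2
      = 1 / (m : ℝ) * ∑ i, ‖f i‖ ^ 2 + 2 * inner ℝ M x + ‖x‖ ^ 2 := by
    simp only [norm_add_sq_real, Finset.sum_add_distrib, hM, inner_smul_left, sum_inner,
      ← Finset.mul_sum, conj_trivial]
    simp
    field_simp
  have h1 := norm_add_sq_le_weighted ha x M
  rw [norm_add_sq_real, real_inner_comm] at h1
  rw [e]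
  linarith

theorem norm_mean_add {k : ℕ} (hm : 0 < m) (f : Fin m → Rn k) (x : Rn k) :
    (1 / (m : ℝ)) • ∑ i, (f i + x) = (1 / (m : ℝ)) • ∑ i, f i + x := by
  have hm' : (m : ℝ) ≠ 0 := by exact_mod_cast hm.ne'
  rw [Finset.sum_add_distrib, smul_add]
  congr 1
  simp [← Nat.cast_smul_eq_nsmul ℝ, smul_smul, hm']

variable {Ξ : Type*} [MeasurableSpace Ξ] {ν : Measure Ξ} [IsProbabilityMeasure ν]
  {Q : Ξ → Rn d → Rn d} {Ω : Type*} [MeasurableSpace Ω] {μ : Measure Ω} [IsProbabilityMeasure μ]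
  {r : Fin n → Ω → Fin m × Ξ}

/-- Young's inequality with parameter δ/2 keeps the total factor (1-δ)(1+δ/2) below 1. The constant
3/δ, where 2/δ would do, matches `errMean_step` so that the two error terms combine. -/
theorem Standing.errSq_step (h : Standing p c b) (hQ : IsContraction ν Q c.del)
    (hmean : ∀ x, ∫ ζ, Q ζ x ∂ν = c.del • x) (hr : IsDraw μ ν r) (y : Rn d)
    (s : State d t m n) :
    Integrable (fun ω => (step p c Q y (fun τ => r τ ω) s).errSq) μ ∧
    ∫ ω, (step p c Q y (fun τ => r τ ω) s).errSq ∂μ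
      ≤ (1 - c.del) * ((1 + c.del / 2) * s.errSq
        + (3 / c.del + p.ratio) * incrSq p c y s) := by
  have hd := h.del_pos
  have h1d : 0 ≤ 1 - c.del := by linarith [h.del_lt]
  have hn : (0 : ℝ) < n := by exact_mod_cast h.hn
  obtain ⟨-, hM⟩ := hr.moments_compress h.hm hQ hmean fun τ i => toSend p c y s i τ
  simp only [State.errSq, step]
  refine ⟨(integrable_finsetSum _ fun τ _ => (hM τ).1).const_mul _, ?_⟩
  rw [integral_const_mul, integral_finsetSum _ fun τ _ => (hM τ).1]
  have h1 : ∀ τ, 1 / (m : ℝ) * ∑ i, ‖toSend p c y s i τ‖ ^ 2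
      ≤ (1 + c.del / 2) * ‖s.e τ‖ ^ 2
      + 1 / (c.del / 2) * ‖(1 / (m : ℝ)) • ∑ i, zeta p c y s i τ‖ ^ 2
      + 1 / (m : ℝ) * ∑ i, ‖zeta p c y s i τ‖ ^ 2 := by
    intro τ
    simp only [h.toSend_eq]
    exact mean_norm_add_sq_le (by positivity) h.hm _ _
  have h2 := h.sum_sq_zeta_le y s
  have h3 := h.sum_node_mean_zeta_le y s
  have h4 := h.incrSq_nonneg y s
  calc _ ≤ 1 / (n : ℝ) ^ 2 * ∑ τ, (1 - c.del) * ((1 + c.del / 2) * ‖s.e τ‖ ^ 2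
      + 1 / (c.del / 2) * ‖(1 / (m : ℝ)) • ∑ i, zeta p c y s i τ‖ ^ 2
      + 1 / (m : ℝ) * ∑ i, ‖zeta p c y s i τ‖ ^ 2) := by
        gcongr with τ _
        exact (hM τ).2.trans (mul_le_mul_of_nonneg_left (h1 τ) h1d)
    _ = (1 - c.del) * ((1 + c.del / 2) * (1 / (n : ℝ) ^ 2 * ∑ τ, ‖s.e τ‖ ^ 2)
      + 2 / c.del * (1 / (n : ℝ) ^ 2 * ∑ τ, ‖(1 / (m : ℝ)) • ∑ i, zeta p c y s i τ‖ ^ 2)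
      + 1 / (n : ℝ) ^ 2 * ∑ τ, 1 / (m : ℝ) * ∑ i, ‖zeta p c y s i τ‖ ^ 2) := by
        simp only [← Finset.mul_sum, Finset.sum_add_distrib]
        field_simp
    _ ≤ (1 - c.del) * ((1 + c.del / 2) * (1 / (n : ℝ) ^ 2 * ∑ τ, ‖s.e τ‖ ^ 2)
      + 2 / c.del * incrSq p c y s + p.ratio * incrSq p c y s) := by gcongr
    _ ≤ _ := by
        apply mul_le_mul_of_nonneg_left _ h1d
        have : 2 / c.del * incrSq p c y s ≤ 3 / c.del * incrSq p c y s := by gcongr; norm_num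
        linarith

/-- By independence across nodes, the squared mean of the sum carries (1-δ)² and is split with Young
parameter δ. The node variances are scaled by 1/n² and carry only 1-δ; they bring in the individual
errors with the small coefficient 2δ. -/
theorem Standing.errMean_step (h : Standing p c b) (hQ : IsContraction ν Q c.del)
    (hmean : ∀ x, ∫ ζ, Q ζ x ∂ν = c.del • x) (hr : IsDraw μ ν r) (y : Rn d)
    (s : State d t m n) :
    Integrable (fun ω => ‖(step p c Q y (fun τ => r τ ω) s).errMean‖ ^ 2) μ ∧
    ∫ ω, ‖(step p c Q y (fun τ => r τ ω) s).errMean‖ ^ 2 ∂μ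
      ≤ (1 - c.del) * (‖s.errMean‖ ^ 2 + (3 / c.del + p.ratio) * incrSq p c y s
        + 2 * c.del * s.errSq) := by
  have hd := h.del_pos
  have h1d : 0 ≤ 1 - c.del := by linarith [h.del_lt]
  have hn : (0 : ℝ) < n := by exact_mod_cast h.hn
  have hm : (0 : ℝ) < m := by exact_mod_cast h.hm
  obtain ⟨⟨hI, hE⟩, -⟩ := hr.moments_compress h.hm hQ hmean fun τ i => toSend p c y s i τ
  have e0 : ∀ ω, ‖(step p c Q y (fun τ => r τ ω) s).errMean‖ ^ 2 = 1 / (n : ℝ) ^ 2 *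
      ‖∑ τ, (toSend p c y s (r τ ω).1 τ - Q (r τ ω).2 (toSend p c y s (r τ ω).1 τ))‖ ^ 2 := by
    intro ω
    rw [State.errMean, norm_smul, mul_pow, Real.norm_eq_abs, sq_abs, one_div_pow]
    rfl
  simp only [e0]
  refine ⟨hI.const_mul _, ?_⟩
  rw [integral_const_mul]
  set M : Fin n → Rn d := fun τ => (1 / (m : ℝ)) • ∑ i, zeta p c y s i τ with hMdef
  set V : Fin n → ℝ := fun τ => 1 / (m : ℝ) * ∑ i, ‖zeta p c y s i τ‖ ^ 2 with hVdef
  have e1 : ∀ τ, (1 / (m : ℝ)) • ∑ i, toSend p c y s i τ = M τ + s.e τ := by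
    intro τ
    simp only [h.toSend_eq]
    exact norm_mean_add h.hm _ _
  have h1 : ∀ τ, 1 / (m : ℝ) * ∑ i, ‖toSend p c y s i τ‖ ^ 2 ≤ ‖M τ + s.e τ‖ ^ 2 + V τ := by
    intro τ
    have : 1 / (m : ℝ) * ∑ i, ‖zeta p c y s i τ + s.e τ‖ ^ 2
        = V τ + 2 * inner ℝ (M τ) (s.e τ) + ‖s.e τ‖ ^ 2 := by
      simp only [norm_add_sq_real, Finset.sum_add_distrib, hMdef, hVdef, inner_smul_left, sum_inner,
        ← Finset.mul_sum, conj_trivial]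
      simp
      field_simp
    simp only [h.toSend_eq]
    rw [this, norm_add_sq_real]
    have : 0 ≤ ‖M τ‖ ^ 2 := by positivity
    linarith
  have h2 : 1 / (n : ℝ) ^ 2 * ∑ τ, V τ ≤ p.ratio * incrSq p c y s := h.sum_sq_zeta_le y s
  have h3 : 1 / (n : ℝ) ^ 2 * ∑ τ, ‖M τ‖ ^ 2 ≤ incrSq p c y s := h.sum_node_mean_zeta_le y s
  have h4 := h.incrSq_nonneg y s
  have h5 : ‖(1 / (n : ℝ)) • ∑ τ, M τ‖ ^ 2 ≤ incrSq p c y s := by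
    have e : (1 / (n : ℝ)) • ∑ τ, M τ
        = ∑ τ, (1 / (m : ℝ)) • ∑ i, (1 / (n : ℝ)) • zeta p c y s i τ := by
      simp only [hMdef, Finset.smul_sum, smul_smul, mul_comm]
    rw [e]
    exact h.norm_mean_zeta_le y s
  have e2 : ‖∑ τ, (M τ + s.e τ)‖ ^ 2 = (n : ℝ) ^ 2 * ‖s.errMean + (1 / (n : ℝ)) • ∑ τ, M τ‖ ^ 2 := by
    have : ∑ τ, (M τ + s.e τ) = (n : ℝ) • (s.errMean + (1 / (n : ℝ)) • ∑ τ, M τ) := by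
      rw [State.errMean, ← smul_add, smul_smul, mul_one_div_cancel hn.ne', one_smul,
        Finset.sum_add_distrib, add_comm]
    rw [this, norm_smul, mul_pow, Real.norm_eq_abs, sq_abs]
  have h6 := norm_add_sq_le_weighted hd s.errMean ((1 / (n : ℝ)) • ∑ τ, M τ)
  simp only [e1] at hE
  -- Since (1-δ) - (1-δ)² = δ(1-δ), the part of the node's second moment due to its mean keeps only
  -- a factor δ.
  have h7 : ∀ τ, (1 - c.del) * (1 / (m : ℝ) * ∑ i, ‖toSend p c y s i τ‖ ^ 2)
        - (1 - c.del) ^ 2 * ‖M τ + s.e τ‖ ^ 2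
      ≤ (1 - c.del) * (V τ + c.del * (2 * ‖M τ‖ ^ 2 + 2 * ‖s.e τ‖ ^ 2)) := by
    intro τ
    have h8 := mul_le_mul_of_nonneg_left (h1 τ) h1d
    have h9 := norm_add_sq_le_weighted one_pos (M τ) (s.e τ)
    have h10 := mul_le_mul_of_nonneg_left h9 (mul_nonneg h1d hd.le)
    linarith
  -- Together with `h12` this gives 3/δ: 1/δ from the squared mean of the sum and 2/δ from the node
  -- means.
  have h11 : (1 - c.del) * (1 + 1 / c.del) ≤ 1 / c.del := by
    have : (1 - c.del) * (1 + 1 / c.del) = 1 / c.del - c.del := by field_simp; ring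
    linarith
  have h12 : 2 * c.del * incrSq p c y s ≤ 2 / c.del * incrSq p c y s := by
    gcongr
    rw [le_div_iff₀ hd]
    nlinarith [h.del_lt]
  calc _ ≤ 1 / (n : ℝ) ^ 2 * ((1 - c.del) ^ 2 * ‖∑ τ, (M τ + s.e τ)‖ ^ 2
        + ∑ τ, (1 - c.del) * (V τ + c.del * (2 * ‖M τ‖ ^ 2 + 2 * ‖s.e τ‖ ^ 2))) := by
        gcongr
        refine hE.trans ?_
        gcongr with τ _
        exact h7 τ
    _ = (1 - c.del) ^ 2 * ‖s.errMean + (1 / (n : ℝ)) • ∑ τ, M τ‖ ^ 2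
        + (1 - c.del) * (1 / (n : ℝ) ^ 2 * ∑ τ, V τ
          + 2 * c.del * (1 / (n : ℝ) ^ 2 * ∑ τ, ‖M τ‖ ^ 2) + 2 * c.del * s.errSq) := by
        rw [e2, State.errSq]
        simp only [← Finset.mul_sum, Finset.sum_add_distrib]
        field_simp
        ring
    _ ≤ (1 - c.del) ^ 2 * ((1 + c.del) * ‖s.errMean‖ ^ 2
          + (1 + 1 / c.del) * incrSq p c y s)
        + (1 - c.del) * (p.ratio * incrSq p c y s
          + 2 * c.del * incrSq p c y s + 2 * c.del * s.errSq) := by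
        gcongr
        refine h6.trans ?_
        gcongr
    _ = (1 - c.del) * ((1 - c.del ^ 2) * ‖s.errMean‖ ^ 2
          + (1 - c.del) * (1 + 1 / c.del) * incrSq p c y s + p.ratio * incrSq p c y s
          + 2 * c.del * incrSq p c y s + 2 * c.del * s.errSq) := by ring
    _ ≤ _ := by
        apply mul_le_mul_of_nonneg_left _ h1d
        have h13 := mul_le_mul_of_nonneg_right h11 h4
        have h14 : 0 ≤ c.del ^ 2 * ‖s.errMean‖ ^ 2 := by positivity
        have h15 : 3 / c.del * incrSq p c y s
          = 1 / c.del * incrSq p c y s + 2 / c.del * incrSq p c y s := by ring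
        linarith

theorem Standing.lyap_nonneg (h : Standing p c b) {a : ℝ} (ha : 0 ≤ a) (y : Rn d)
    {s : State d t m n} (hs : p.DualFeasible s.α) : 0 ≤ lyap p c a y s := by
  have h1 := h.dual_le_Gstar y hs
  have h2 := h.weightScale_pos
  have h3 := s.errSq_nonneg
  have h4 : 0 ≤ weightScale p c / 5 * ‖s.errMean‖ ^ 2 := by positivity
  have h5 : 0 ≤ a * (8 * (weightScale p c / 5)) * s.errSq := by positivity
  unfold lyap
  linarith

/-- The bound for the expected Lyapunov function after one iteration. -/
noncomputable def lyapNext (p : Problem d t m n) (c : Params) (y : Rn d) (s : State d t m n) : ℝ :=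
  (1 - c.theta) * ((Gstar p c y - dual p c y s.α) + weightScale p c / 5 * ‖s.errMean‖ ^ 2)
    - c.theta * (G p c y (primal p c y s) - Gstar p c y)
    + (1 + 3 * c.del / 4) * (1 - c.del) * (8 * (weightScale p c / 5)) * s.errSq

/-- The one-step estimate at a fixed state. Nonnegativity of `lyapNext` comes along as the bound of
a nonnegative expectation; it is needed to pass between real and extended nonnegative values. -/
theorem Standing.lintegral_lyap_step_le (h : Standing p c b) (hQ : IsContraction ν Q c.del)
    (hmean : ∀ x, ∫ ζ, Q ζ x ∂ν = c.del • x) (hr : IsDraw μ ν r) (y : Rn d)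
    {s : State d t m n} (hs : Invariant p c s) :
    0 ≤ lyapNext p c y s ∧
    ∫⁻ ω, ENNReal.ofReal (lyap p c 1 y (step p c Q y (fun τ => r τ ω) s)) ∂μ
      ≤ ENNReal.ofReal (lyapNext p c y s) := by
  have hσ := h.sig_pos
  have hw := h.weightScale_pos
  obtain ⟨hI1, hE1⟩ := h.errSq_step hQ hmean hr y s
  obtain ⟨hI2, hE2⟩ := h.errMean_step hQ hmean hr y s
  obtain ⟨hI3, hE3⟩ := hr.second_moment_index h.hm
    (fun τ i => (1 / (n : ℝ)) • zeta p c y s i τ)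
  have hI4 : Integrable (fun ω => ∑ τ, dualDrop p c y s τ (r τ ω).1) μ :=
    integrable_finsetSum _ fun τ _ => hr.integrable_index h.hm τ _
  have hE4 : ∫ ω, ∑ τ, dualDrop p c y s τ (r τ ω).1 ∂μ
      = ∑ τ, 1 / (m : ℝ) * ∑ i, dualDrop p c y s τ i := by
    rw [integral_finsetSum _ fun τ _ => hr.integrable_index h.hm τ _]
    simp only [hr.integral_index h.hm, smul_eq_mul]
  have hE3' : ∫ ω, ‖∑ τ, (1 / (n : ℝ)) • zeta p c y s (r τ ω).1 τ‖ ^ 2 ∂μ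
      ≤ (1 + p.ratio) * incrSq p c y s := by
    refine hE3.trans ?_
    have e : ∑ τ, 1 / (m : ℝ) * ∑ i, ‖(1 / (n : ℝ)) • zeta p c y s i τ‖ ^ 2
        = 1 / (n : ℝ) ^ 2 * ∑ τ, 1 / (m : ℝ) * ∑ i, ‖zeta p c y s i τ‖ ^ 2 := by
      simp only [norm_smul, mul_pow, ← Finset.mul_sum, Real.norm_eq_abs, sq_abs, one_div_pow]
      ring
    rw [e]
    linarith [h.norm_mean_zeta_le y s, h.sum_sq_zeta_le y s]
  have hmd := h.mean_dualDrop_le y hs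
  have habs := h.absorb (e := ‖s.errMean‖)
    (c' := ‖(1 / ((m : ℝ) * n)) • ∑ τ, ∑ i, p.A i τ (dir p c y s i τ)‖)
    (dirSq_nonneg (p := p) (c := c) y s) (h.norm_sum_dir_le y s)
  set W := weightScale p c / 5 with hW
  have hWpos : 0 < W := by positivity
  -- the majorant of the Lyapunov function
  set F : Ω → ℝ := fun ω => (Gstar p c y - dual p c y s.α)
    + ∑ τ, dualDrop p c y s τ (r τ ω).1
    + (c.lam + c.kap) / 2 * ‖∑ τ, (1 / (n : ℝ)) • zeta p c y s (r τ ω).1 τ‖ ^ 2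
    + W * ‖(step p c Q y (fun τ => r τ ω) s).errMean‖ ^ 2
    + 8 * W * (step p c Q y (fun τ => r τ ω) s).errSq with hF
  have hle : ∀ ω, lyap p c 1 y (step p c Q y (fun τ => r τ ω) s) ≤ F ω := by
    intro ω
    have := h.neg_dual_step_le (Q := Q) y (fun τ => r τ ω) hs.feasible
    simp only [lyap, hF, one_mul, ← hW]
    linarith
  -- The majorant inherits nonnegativity from the Lyapunov function because the step preserves
  -- feasibility; this identifies its lower integral with its Bochner integral.
  have h0 : ∀ ω, 0 ≤ F ω := fun ω =>
    (h.lyap_nonneg zero_le_one y (h.invariant_step y (fun τ => r τ ω) hs).feasible).trans (hle ω)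
  have J1 := (integrable_const (μ := μ) (Gstar p c y - dual p c y s.α)).add hI4
  have J2 := J1.add (hI3.const_mul ((c.lam + c.kap) / 2))
  have J3 := J2.add (hI2.const_mul W)
  have J4 := J3.add (hI1.const_mul (8 * W))
  have hFI : Integrable F μ := J4
  have hFE : ∫ ω, F ω ∂μ = (Gstar p c y - dual p c y s.α)
      + ∑ τ, 1 / (m : ℝ) * ∑ i, dualDrop p c y s τ i
      + (c.lam + c.kap) / 2 * ∫ ω, ‖∑ τ, (1 / (n : ℝ)) • zeta p c y s (r τ ω).1 τ‖ ^ 2 ∂μ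
      + W * ∫ ω, ‖(step p c Q y (fun τ => r τ ω) s).errMean‖ ^ 2 ∂μ
      + 8 * W * ∫ ω, (step p c Q y (fun τ => r τ ω) s).errSq ∂μ := by
    rw [hF, integral_add (f := fun ω => _ + _) J3 (hI1.const_mul (8 * W)),
      integral_add (f := fun ω => _ + _) J2 (hI2.const_mul W),
      integral_add (f := fun ω => _ + _) J1 (hI3.const_mul _),
      integral_add (integrable_const _) hI4, hE4]
    simp only [integral_const_mul, integral_const, probReal_univ, one_smul]
  have k0 : ∫ ω, F ω ∂μ ≤ lyapNext p c y s := by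
    rw [hFE, lyapNext, ← hW]
    have k1 := mul_le_mul_of_nonneg_left hE3' (show 0 ≤ (c.lam + c.kap) / 2 by positivity)
    have k2 := mul_le_mul_of_nonneg_left hE2 hWpos.le
    have k3 := mul_le_mul_of_nonneg_left hE1 (show 0 ≤ 8 * W by positivity)
    -- The 9 is 1 + 8, the two error weights in units of W. The leakage 2δ·W into `errSq` equals
    -- 8W·δ/4, which turns 1 + δ/2 into 1 + 3δ/4.
    change _ + (c.lam + c.kap) / 2 * ((1 + p.ratio) * incrSq p c y s)
      + 9 * W * ((1 - c.del) * ((3 / c.del + p.ratio) * incrSq p c y s)) ≤ _ at habs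
    linarith
  refine ⟨(integral_nonneg h0).trans k0,
    (lintegral_mono fun ω => ENNReal.ofReal_le_ofReal (hle ω)).trans ?_⟩
  rw [← ofReal_integral_eq_lintegral_ofReal hFI (Filter.Eventually.of_forall h0)]
  exact ENNReal.ofReal_le_ofReal k0

/-- The error factor (1+3δ/4)(1-δ) is at most 1 - δ/4, and θ ≤ δ/100. -/
theorem Standing.lyapNext_add_le (h : Standing p c b) (y : Rn d) (s : State d t m n) :
    lyapNext p c y s + c.theta * (G p c y (primal p c y s) - Gstar p c y)
      ≤ (1 - c.theta) * lyap p c 1 y s := by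
  have hw := h.weightScale_pos
  have hS := s.errSq_nonneg
  have hd := h.del_pos
  have hθ := h.theta_le_del
  have h1 : (1 + 3 * c.del / 4) * (1 - c.del) ≤ 1 - c.theta := by nlinarith
  have h2 := mul_le_mul_of_nonneg_right h1
    (show 0 ≤ 8 * (weightScale p c / 5) * s.errSq by positivity)
  unfold lyapNext lyap
  linarith

/-- Individual errors at the start of a loop are known only through w₂, which may be as small as
(1-δ)w/b. One iteration contracts them by 1-δ, so starting from the weaker function costs only a
factor 2. -/
theorem Standing.lyapNext_le (h : Standing p c b) (y : Rn d) {s : State d t m n}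
    (hs : p.DualFeasible s.α) : lyapNext p c y s ≤ 2 * lyap p c (1 - c.del) y s := by
  have hw := h.weightScale_pos
  have hS := s.errSq_nonneg
  have hd := h.del_pos
  have hθ := h.theta_pos
  have hG := mul_nonneg hθ.le (sub_nonneg.2 (h.Gstar_le y (primal p c y s)))
  have hgap := h.dual_le_Gstar y hs
  have h1d : 0 < 1 - c.del := by linarith [h.del_lt]
  have h0 : 0 ≤ (Gstar p c y - dual p c y s.α) + weightScale p c / 5 * ‖s.errMean‖ ^ 2 :=
    add_nonneg (by linarith) (by positivity)
  have h1 : 0 ≤ (1 + c.theta) * ((Gstar p c y - dual p c y s.α)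
    + weightScale p c / 5 * ‖s.errMean‖ ^ 2) := by positivity
  have h2 : 0 ≤ (1 - 3 * c.del / 4) * ((1 - c.del) * (8 * (weightScale p c / 5)) * s.errSq) := by
    have : 0 ≤ 1 - 3 * c.del / 4 := by linarith
    positivity
  unfold lyapNext lyap
  linarith

end

/-! ### Measurability of the iterates -/

theorem measurable_smul_rn {Z : Type*} [MeasurableSpace Z] {k : ℕ} {f : Z → Rn k}
    (hf : Measurable f) (a : ℝ) : Measurable fun z => a • f z :=
  (continuous_const_smul a).measurable.comp hf

theorem measurable_of_countable_index {Z I E : Type*} [MeasurableSpace Z] [MeasurableSpace I]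
    [MeasurableSpace E] [Countable I] [MeasurableSingletonClass I] {F : I → Z → E}
    (hF : ∀ i, Measurable (F i)) {j : Z → I} (hj : Measurable j) :
    Measurable fun z => F (j z) z := by
  have : Measurable fun w : I × Z => F w.1 w.2 := measurable_from_prod_countable_right hF
  exact this.comp (hj.prodMk measurable_id)

/-- By continuity the supremum may be taken over a countable dense set. -/
theorem measurable_iSup_of_continuous {Z : Type*} [MeasurableSpace Z] {k : ℕ} {f : Z → Rn k → ℝ}
    (hc : ∀ z, Continuous (f z)) (hm : ∀ x, Measurable fun z => f z x) :
    Measurable fun z => ⨆ x, f z x := by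
  obtain ⟨D, hD, hd⟩ := TopologicalSpace.exists_countable_dense (Rn k)
  have : Countable D := hD.to_subtype
  have e : (fun z => ⨆ x, f z x) = fun z => ⨆ x : D, f z x :=
    funext fun z => (hd.ciSup' (hc z)).symm
  rw [e]
  exact Measurable.iSup fun x => hm x

theorem measurable_iInf_of_continuous {Z : Type*} [MeasurableSpace Z] {k : ℕ} {f : Z → Rn k → ℝ}
    (hc : ∀ z, Continuous (f z)) (hm : ∀ x, Measurable fun z => f z x) :
    Measurable fun z => ⨅ x, f z x := by
  obtain ⟨D, hD, hd⟩ := TopologicalSpace.exists_countable_dense (Rn k)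
  have : Countable D := hD.to_subtype
  have e : (fun z => ⨅ x, f z x) = fun z => ⨅ x : D, f z x :=
    funext fun z => (hd.ciInf' (hc z)).symm
  rw [e]
  exact Measurable.iInf fun x => hm x

section

variable {d t m n : ℕ}

instance : MeasurableSpace (State d t m n) :=
  MeasurableSpace.comap (fun s => (s.α, s.u, s.e)) inferInstance

variable {Z : Type*} [MeasurableSpace Z]

theorem State.measurable_iff {f : Z → State d t m n} :
    Measurable f ↔ (∀ i τ, Measurable fun z => (f z).α i τ) ∧ (Measurable fun z => (f z).u) ∧
      ∀ τ, Measurable fun z => (f z).e τ := by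
  rw [measurable_comap_iff]
  constructor
  · intro h
    have h1 := measurable_fst.comp h
    have h2 := measurable_fst.comp (measurable_snd.comp h)
    have h3 := measurable_snd.comp (measurable_snd.comp h)
    refine ⟨fun i τ => ?_, h2, fun τ => measurable_pi_iff.1 h3 τ⟩
    exact measurable_pi_iff.1 (measurable_pi_iff.1 h1 i) τ
  · rintro ⟨h1, h2, h3⟩
    exact (measurable_pi_iff.2 fun i => measurable_pi_iff.2 fun τ => h1 i τ).prodMk
      (h2.prodMk (measurable_pi_iff.2 h3))

variable {p : Problem d t m n} {c : Params} {b : ℝ}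

theorem Standing.continuous_φ (h : Standing p c b) (i : Fin m) (τ : Fin n) :
    Continuous (p.φ i τ) := (h.adm.smooth i τ).1.continuous

theorem Standing.measurable_gradient (h : Standing p c b) (i : Fin m) (τ : Fin n) :
    Measurable (gradient (p.φ i τ)) := by
  have : LipschitzWith (Real.toNNReal (1 / c.gam)) (gradient (p.φ i τ)) :=
    LipschitzWith.of_dist_le_mul fun x y => by
      have hg := h.gam_pos
      rw [Real.coe_toNNReal _ (by positivity), dist_eq_norm, dist_eq_norm]
      exact (h.adm.smooth i τ).2 x y
  exact this.continuous.measurable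

/-- The center acts as a shift of the dual argument, so the primal iterate is one fixed Lipschitz
map applied to an affine function of (u, y); joint measurability follows. -/
theorem Standing.primal_eq (h : Standing p c b) (y : Rn d) (s : State d t m n) :
    primal p c y s
      = gradient (conjugate (xi p c 0)) (s.u + (c.kap / (c.lam + c.kap)) • y) := by
  have hσ := h.sig_pos
  refine ((StrongConvexOn.hasGradientAt_conjugate (h.xi_strong 0)
    (x := primal p c y s) fun z => ?_).gradient).symm
  have h1 := StrongConvexOn.argmax_gradient (h.xi_strong y) s.u z
  change inner ℝ s.u z - xi p c y z + 1 / 2 * ‖z - primal p c y s‖ ^ 2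
    ≤ inner ℝ s.u (primal p c y s) - xi p c y (primal p c y s) at h1
  have h2 : ∀ z, xi p c y z = xi p c 0 z - c.kap / (c.lam + c.kap) * inner ℝ y z
      + c.kap / (2 * (c.lam + c.kap)) * ‖y‖ ^ 2 := by
    intro z
    simp only [xi, norm_sub_sq_real, inner_zero_right, norm_zero]
    rw [real_inner_comm z y]
    field_simp
    ring
  rw [h2, h2] at h1
  simp only [inner_add_left, inner_smul_left, conj_trivial]
  linarith

theorem Standing.measurable_primal (h : Standing p c b) {y : Z → Rn d} {s : Z → State d t m n}
    (hy : Measurable y) (hs : Measurable s) : Measurable fun z => primal p c (y z) (s z) := by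
  have hc : Continuous (gradient (conjugate (xi p c 0))) := by
    have : LipschitzWith 1 (gradient (conjugate (xi p c 0))) :=
      LipschitzWith.of_dist_le_mul fun x y => by
        rw [dist_eq_norm, dist_eq_norm, NNReal.coe_one, one_mul]
        exact StrongConvexOn.gradient_conjugate_lipschitz (h.xi_strong 0) x y
    exact this.continuous
  simp only [h.primal_eq]
  exact hc.measurable.comp ((State.measurable_iff.1 hs).2.1.add (measurable_smul_rn hy _))

theorem Standing.continuous_G (h : Standing p c b) (y : Rn d) : Continuous (G p c y) :=
  StrongConvexOn.continuous_of_univ h.sig_pos.le (h.G_strong y)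

theorem Standing.continuous_P (h : Standing p c b) : Continuous p.P :=
  StrongConvexOn.continuous_of_univ h.lam_pos.le h.P_strong

theorem Standing.measurable_G (h : Standing p c b) {y x : Z → Rn d}
    (hy : Measurable y) (hx : Measurable x) : Measurable fun z => G p c (y z) (x z) :=
  (h.continuous_P.measurable.comp hx).add (((hx.sub hy).norm.pow_const 2).const_mul _)

theorem Standing.measurable_Gstar (h : Standing p c b) {y : Z → Rn d}
    (hy : Measurable y) : Measurable fun z => Gstar p c (y z) :=
  measurable_iInf_of_continuous (fun z => h.continuous_G (y z))
    fun _ => h.measurable_G hy measurable_const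

theorem measurable_vOf {α : Z → Fin m → Fin n → Rn t} (hα : ∀ i τ, Measurable fun z => α z i τ) :
    Measurable fun z => vOf p c (α z) := by
  have : Measurable fun z => ∑ τ, ∑ i, p.A i τ (α z i τ) :=
    Finset.measurable_fun_sum _ fun τ _ => Finset.measurable_fun_sum _ fun i _ =>
      (p.A i τ).measurable.comp (hα i τ)
  exact measurable_smul_rn this _

theorem Standing.measurable_dual (h : Standing p c b) {y : Z → Rn d} {s : Z → State d t m n}
    (hy : Measurable y) (hs : Measurable s) : Measurable fun z => dual p c (y z) (s z).α := by
  have hα := (State.measurable_iff.1 hs).1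
  have h1 : Measurable fun z => ∑ τ, ∑ i, conjugate (p.φ i τ) (-((s z).α i τ)) :=
    Finset.measurable_fun_sum _ fun τ _ => Finset.measurable_fun_sum _ fun i _ =>
      measurable_iSup_of_continuous
        (fun z => (continuous_const.inner continuous_id).sub (h.continuous_φ i τ))
        fun x => ((hα i τ).neg.inner_const).sub_const _
  have h2 : Measurable fun z => conjugate (xi p c (y z)) (vOf p c (s z).α) := by
    have hσ := h.sig_pos
    refine measurable_iSup_of_continuous (fun z => (continuous_const.inner continuous_id).sub
      (StrongConvexOn.continuous_of_univ zero_le_one (h.xi_strong (y z)))) fun x => ?_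
    refine ((measurable_vOf hα).inner_const).sub ?_
    unfold xi
    exact (measurable_const.add (((measurable_const.sub hy).norm.pow_const 2).const_mul _)).div_const _
  exact (h1.const_mul _).neg.sub (h2.const_mul _)

theorem measurable_errMean {s : Z → State d t m n} (hs : Measurable s) :
    Measurable fun z => (s z).errMean := by
  have : Measurable fun z => ∑ τ, (s z).e τ :=
    Finset.measurable_fun_sum _ fun τ _ => (State.measurable_iff.1 hs).2.2 τ
  exact measurable_smul_rn this _

theorem measurable_sum_errSq {s : Z → State d t m n} (hs : Measurable s) :
    Measurable fun z => ∑ τ, ‖(s z).e τ‖ ^ 2 :=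
  Finset.measurable_fun_sum _ fun τ _ => ((State.measurable_iff.1 hs).2.2 τ).norm.pow_const 2

theorem Standing.measurable_lyap (h : Standing p c b) (a : ℝ) {y : Z → Rn d}
    {s : Z → State d t m n} (hy : Measurable y) (hs : Measurable s) :
    Measurable fun z => lyap p c a (y z) (s z) :=
  (((h.measurable_Gstar hy).sub (h.measurable_dual hy hs)).add
    (((measurable_errMean hs).norm.pow_const 2).const_mul _)).add
    (((measurable_sum_errSq hs).const_mul _).const_mul _)

theorem Standing.measurable_primalGap (h : Standing p c b) {y : Z → Rn d}
    {s : Z → State d t m n} (hy : Measurable y) (hs : Measurable s) :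
    Measurable fun z => G p c (y z) (primal p c (y z) (s z)) - Gstar p c (y z) :=
  (h.measurable_G hy (h.measurable_primal hy hs)).sub (h.measurable_Gstar hy)

theorem Standing.measurable_merit (h : Standing p c b) {y : Z → Rn d}
    {s : Z → State d t m n} (hy : Measurable y) (hs : Measurable s) :
    Measurable fun z => merit p c (y z) (s z) := by
  have h1 : Measurable fun z => psi4 p c (y z) (s z) :=
    (((h.measurable_Gstar hy).sub (h.measurable_dual hy hs)).add
      (((measurable_errMean hs).norm.pow_const 2).const_mul _)).add
      ((measurable_sum_errSq hs).const_mul _)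
  exact (h1.const_mul _).add ((h.measurable_primalGap hy hs).const_mul _)

variable {Ξ : Type*} [MeasurableSpace Ξ] {Q : Ξ → Rn d → Rn d}

theorem Standing.measurable_toSend (h : Standing p c b) {y : Z → Rn d} {s : Z → State d t m n}
    (hy : Measurable y) (hs : Measurable s) (i : Fin m) (τ : Fin n) :
    Measurable (fun z => incr p c (y z) (s z) i τ) ∧
    Measurable fun z => toSend p c (y z) (s z) i τ := by
  have hα := (State.measurable_iff.1 hs).1 i τ
  have h1 : Measurable fun z => incr p c (y z) (s z) i τ := by
    unfold incr
    have h2 := (ContinuousLinearMap.adjoint (p.A i τ)).measurable.comp (h.measurable_primal hy hs)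
    have h3 := measurable_smul_rn ((h.measurable_gradient i τ).comp h2) (c.theta * m)
    exact (measurable_smul_rn hα (c.theta * m)).neg.sub h3
  refine ⟨h1, ?_⟩
  unfold toSend
  exact (measurable_smul_rn ((p.A i τ).measurable.comp h1) _).add
    ((State.measurable_iff.1 hs).2.2 τ)

theorem Standing.measurable_step (h : Standing p c b)
    (hQ : Measurable fun z : Ξ × Rn d => Q z.1 z.2) {y : Z → Rn d} {s : Z → State d t m n}
    {r : Z → Fin n → Fin m × Ξ} (hy : Measurable y) (hs : Measurable s)
    (hr : ∀ τ, Measurable fun z => r z τ) :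
    Measurable fun z => step p c Q (y z) (r z) (s z) := by
  have hα := (State.measurable_iff.1 hs).1
  have hsend : ∀ τ, Measurable fun z => toSend p c (y z) (s z) (r z τ).1 τ := by
    intro τ
    have h1 := fun i => (h.measurable_toSend hy hs i τ).2
    exact measurable_of_countable_index (F := fun i z => toSend p c (y z) (s z) i τ) h1
      (measurable_fst.comp (hr τ))
  have hQs : ∀ τ, Measurable fun z => Q (r z τ).2 (toSend p c (y z) (s z) (r z τ).1 τ) :=
    fun τ => hQ.comp ((measurable_snd.comp (hr τ)).prodMk (hsend τ))
  rw [State.measurable_iff]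
  refine ⟨fun i τ => ?_, ?_, fun τ => (hsend τ).sub (hQs τ)⟩
  · have hset : MeasurableSet {z | i = (r z τ).1} := by
      have : {z | i = (r z τ).1} = (fun z => (r z τ).1) ⁻¹' {i} := by
        ext z; simp [eq_comm]
      rw [this]
      exact (measurable_fst.comp (hr τ)) (measurableSet_singleton i)
    exact Measurable.ite hset ((hα i τ).add (h.measurable_toSend hy hs i τ).1) (hα i τ)
  · have : Measurable fun z => ∑ τ, Q (r z τ).2 (toSend p c (y z) (s z) (r z τ).1 τ) :=
      Finset.measurable_fun_sum _ fun τ _ => hQs τ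
    exact (State.measurable_iff.1 hs).2.1.add (measurable_smul_rn this _)

theorem Standing.measurable_innerIter (h : Standing p c b)
    (hQ : Measurable fun z : Ξ × Rn d => Q z.1 z.2) {y : Z → Rn d} {s : Z → State d t m n}
    {r : Z → ℕ → Fin n → Fin m × Ξ} (hy : Measurable y) (hs : Measurable s) (K : ℕ)
    (hr : ∀ K' < K, ∀ τ, Measurable fun z => r z K' τ) :
    Measurable fun z => innerIter p c Q (y z) (r z) (s z) K := by
  induction K with
  | zero => exact hs
  | succ K ih =>
    exact h.measurable_step hQ hy (ih fun K' hK' => hr K' (hK'.trans K.lt_succ_self))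
      (hr K K.lt_succ_self)

theorem stopTime_eq_coe_iff {y : Rn d} {r : ℕ → Fin n → Fin m × Ξ} {s₀ : State d t m n} {ε : ℝ}
    {N : ℕ} : stopTime p c Q y r s₀ ε = N ↔
      (1 ≤ N ∧ merit p c y (innerIter p c Q y r s₀ N) ≤ ε) ∧
        ∀ K < N, ¬(1 ≤ K ∧ merit p c y (innerIter p c Q y r s₀ K) ≤ ε) := by
  unfold stopTime
  constructor
  · intro hT
    have hne : {T : ℕ∞ | ∃ K : ℕ, 1 ≤ K ∧
        merit p c y (innerIter p c Q y r s₀ K) ≤ ε ∧ T = K}.Nonempty := by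
      by_contra hcon
      rw [Set.not_nonempty_iff_eq_empty] at hcon
      rw [hcon, sInf_empty] at hT
      exact ENat.top_ne_natCast N hT
    obtain ⟨K, hK1, hK2, hK3⟩ := csInf_mem hne
    rw [hT] at hK3
    obtain rfl : N = K := by exact_mod_cast hK3
    refine ⟨⟨hK1, hK2⟩, fun K hK hcon => ?_⟩
    have : sInf {T : ℕ∞ | ∃ K : ℕ, 1 ≤ K ∧
        merit p c y (innerIter p c Q y r s₀ K) ≤ ε ∧ T = K} ≤ K :=
      sInf_le ⟨K, hcon.1, hcon.2, rfl⟩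
    rw [hT] at this
    exact absurd hK (not_lt.2 (by exact_mod_cast this))
  · rintro ⟨⟨h1, h2⟩, h3⟩
    apply le_antisymm
    · exact sInf_le ⟨N, h1, h2, rfl⟩
    · refine le_sInf ?_
      rintro T ⟨K, hK1, hK2, rfl⟩
      by_contra hcon
      exact h3 K (by exact_mod_cast not_le.1 hcon) ⟨hK1, hK2⟩

theorem Standing.measurable_stopTime (h : Standing p c b)
    (hQ : Measurable fun z : Ξ × Rn d => Q z.1 z.2) {y : Z → Rn d} {s : Z → State d t m n}
    {r : Z → ℕ → Fin n → Fin m × Ξ} (hy : Measurable y) (hs : Measurable s)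
    (hr : ∀ K τ, Measurable fun z => r z K τ) (ε : ℝ) :
    Measurable fun z => stopTime p c Q (y z) (r z) (s z) ε := by
  have hset : ∀ K : ℕ, MeasurableSet
      {z | 1 ≤ K ∧ merit p c (y z) (innerIter p c Q (y z) (r z) (s z) K) ≤ ε} := fun K =>
    (MeasurableSet.const _).inter (measurableSet_le (h.measurable_merit hy
      (h.measurable_innerIter hQ hy hs K fun K' _ => hr K')) measurable_const)
  rw [ENat.measurable_iff]
  intro N
  have e : (fun z => stopTime p c Q (y z) (r z) (s z) ε) ⁻¹' {(N : ℕ∞)}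
      = {z | 1 ≤ N ∧ merit p c (y z) (innerIter p c Q (y z) (r z) (s z) N) ≤ ε} ∩
        ⋂ K : ℕ, ⋂ _ : K < N,
          {z | 1 ≤ K ∧ merit p c (y z) (innerIter p c Q (y z) (r z) (s z) K) ≤ ε}ᶜ := by
    ext z
    simp only [Set.mem_preimage, Set.mem_singleton_iff, stopTime_eq_coe_iff, Set.mem_inter_iff,
      Set.mem_ofPred_eq, Set.mem_iInter, Set.mem_compl_iff]
  rw [e]
  exact (hset N).inter (MeasurableSet.iInter fun K => MeasurableSet.iInter fun _ => (hset K).compl)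

theorem Standing.measurable_outer (h : Standing p c b)
    (hQ : Measurable fun z : Ξ × Rn d => Q z.1 z.2) (x₀ : Rn d)
    {r : Z → ℕ → ℕ → Fin n → Fin m × Ξ} (k : ℕ)
    (hr : ∀ k' ≤ k, ∀ K τ, Measurable fun z => r z k' K τ) :
    (Measurable fun z => (outer p c Q x₀ (r z) k).x) ∧
    (Measurable fun z => (outer p c Q x₀ (r z) k).y) ∧
    Measurable fun z => (outer p c Q x₀ (r z) k).s := by
  induction k with
  | zero => exact ⟨measurable_const, measurable_const, measurable_const⟩
  | succ k ih =>
    obtain ⟨hx, hy, hs⟩ := ih fun k' hk' => hr k' (hk'.trans k.le_succ)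
    have hr' := hr (k + 1) le_rfl
    have hN : Measurable fun z => (stopTime p c Q (outer p c Q x₀ (r z) k).y (r z (k + 1))
        (outer p c Q x₀ (r z) k).s (eps p c x₀ (k + 1))).toNat :=
      Measurable.of_discrete.comp (h.measurable_stopTime hQ hy hs hr' _)
    have hs' : Measurable fun z => (outer p c Q x₀ (r z) (k + 1)).s := by
      have h1 := fun K => h.measurable_innerIter hQ hy hs K fun K' _ => hr' K'
      exact measurable_of_countable_index (F := fun K z => innerIter p c Q
        (outer p c Q x₀ (r z) k).y (r z (k + 1)) (outer p c Q x₀ (r z) k).s K) h1 hN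
    have hx' : Measurable fun z => (outer p c Q x₀ (r z) (k + 1)).x :=
      h.measurable_primal hy hs'
    exact ⟨hx', hx'.add (measurable_smul_rn (hx'.sub hx) (c.beta k)), hs'⟩

end

/-! ### The outer loop -/

section

variable {d t m n : ℕ} {p : Problem d t m n} {c : Params} {b : ℝ}

theorem Standing.q_pos (h : Standing p c b) : 0 < c.q := div_pos h.lam_pos h.sig_pos

theorem Standing.q_le_one (h : Standing p c b) : c.q ≤ 1 := by
  unfold Params.q
  rw [div_le_one h.sig_pos]
  linarith [h.kap_nonneg]

theorem Standing.sqrt_q_pos (h : Standing p c b) : 0 < Real.sqrt c.q := Real.sqrt_pos.2 h.q_pos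

theorem Standing.sqrt_q_le_one (h : Standing p c b) : Real.sqrt c.q ≤ 1 :=
  Real.sqrt_le_one.2 h.q_le_one

theorem Standing.sqrt_q_sq (h : Standing p c b) :
    Real.sqrt c.q ^ 2 * (c.lam + c.kap) = c.lam := by
  rw [Real.sq_sqrt h.q_pos.le, Params.q, div_mul_cancel₀ _ h.sig_pos.ne']

/-- The value √q is a fixed point of the recursion, so the extrapolation coefficient is constant as
well. -/
theorem Standing.acc_eq (h : Standing p c b) (k : ℕ) : c.acc k = Real.sqrt c.q := by
  induction k with
  | zero => rfl
  | succ k ih =>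
    rw [Params.acc, ih, Real.sq_sqrt h.q_pos.le, sub_self]
    have : (0 : ℝ) ^ 2 + 4 * c.q = 2 ^ 2 * c.q := by ring
    rw [this, Real.sqrt_mul (by positivity), Real.sqrt_sq (by norm_num)]
    ring

theorem Standing.beta_eq (h : Standing p c b) (k : ℕ) :
    c.beta k = (1 - Real.sqrt c.q) / (1 + Real.sqrt c.q) := by
  have := h.sqrt_q_pos
  unfold Params.beta
  rw [h.acc_eq, h.acc_eq]
  field_simp
  ring

/-- The estimate sequence point of the accelerated proximal point method. -/
noncomputable def estPoint (η : ℝ) (x y : Rn d) : Rn d := (1 / η) • ((1 + η) • y - x)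

/-- The potential of the accelerated proximal point method. -/
noncomputable def potential (p : Problem d t m n) (c : Params) (xs x y : Rn d) : ℝ :=
  p.P x - p.Pstar + c.lam / 2 * ‖estPoint (Real.sqrt c.q) x y - xs‖ ^ 2

/-- One step of the inexact accelerated proximal point method. -/
theorem Standing.potential_step (h : Standing p c b) {xs : Rn d} (hxs : p.P xs = p.Pstar)
    (x y x' : Rn d) {ε u : ℝ} (hε : G p c y x' ≤ Gstar p c y + ε) (hu : 0 < u) (hu1 : u < 1) :
    (1 - u) * potential p c xs x' (x' + ((1 - Real.sqrt c.q) / (1 + Real.sqrt c.q)) • (x' - x))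
      ≤ (1 - Real.sqrt c.q) * potential p c xs x y + (1 + 1 / u) * ε := by
  set η := Real.sqrt c.q with hη
  have hη0 : 0 < η := h.sqrt_q_pos
  have hη1 : η ≤ 1 := h.sqrt_q_le_one
  have hηs : η ^ 2 * (c.lam + c.kap) = c.lam := h.sqrt_q_sq
  have hσ := h.sig_pos
  have hlam := h.lam_pos
  have hkap := h.kap_nonneg
  set σ := c.lam + c.kap with hσd
  obtain ⟨w, -, hw⟩ := h.exists_min_Gstar y
  set z : Rn d := (1 - η) • x + η • xs with hz
  set v := estPoint η x y with hv
  set v' := estPoint η x' (x' + ((1 - η) / (1 + η)) • (x' - x)) with hv'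
  -- The estimate point is defined so that the new residual at z is η times its error; with η²σ = λ,
  -- the growth of G becomes the term λ/2‖v'-xs‖² of the potential.
  have e1 : z - x' = -(η • (v' - xs)) := by
    have : (1 + η) • (x' + ((1 - η) / (1 + η)) • (x' - x)) - x'
        = x' - (1 - η) • x := by
      rw [smul_add, smul_smul, mul_div_cancel₀ _ (by positivity : (1 + η) ≠ 0)]
      module
    rw [hz, hv', estPoint, this, smul_sub η, smul_smul, mul_one_div_cancel hη0.ne', one_smul]
    module
  have e2 : z - y = -((η / (1 + η)) • ((v - xs) + η • (x - xs))) := by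
    have hy : y = (1 / (1 + η)) • (x + η • v) := by
      rw [hv, estPoint, smul_smul, mul_one_div_cancel hη0.ne', one_smul, add_sub_cancel, smul_smul,
        one_div_mul_cancel (by positivity), one_smul]
    have e3 : z - y = (1 / (1 + η)) • ((1 + η) • z - (x + η • v)) := by
      rw [smul_sub, smul_smul, one_div_mul_cancel (by positivity), one_smul, ← hy]
    have e4 : (1 + η) • z - (x + η • v) = η • -((v - xs) + η • (x - xs)) := by
      rw [hz]
      module
    rw [e3, e4, smul_smul, smul_neg]
    congr 2
    ring
  -- the objective at the comparison point
  have f1 := h.P_strong.2 (Set.mem_univ x) (Set.mem_univ xs) (show 0 ≤ 1 - η by linarith) hη0.le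
    (by ring)
  simp only [smul_eq_mul] at f1
  rw [hxs, ← hz] at f1
  have f2 : ‖z - y‖ ^ 2 ≤ (η / (1 + η)) ^ 2 * ((1 + η) * (‖v - xs‖ ^ 2 + η * ‖x - xs‖ ^ 2)) := by
    rw [e2, norm_neg, norm_smul, mul_pow, Real.norm_eq_abs, sq_abs]
    gcongr
    have := norm_add_sq_le_weighted hη0 (v - xs) (η • (x - xs))
    rw [norm_smul, mul_pow, Real.norm_eq_abs, sq_abs] at this
    refine this.trans (le_of_eq ?_)
    field_simp
    ring
  -- By κη² = λ(1-η²) the proximal term yields (1-η)λ/2‖v-xs‖², plus a multiple of ‖x-xs‖² that the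
  -- strong convexity of P in `f1` cancels exactly.
  have f3 : c.kap / 2 * ‖z - y‖ ^ 2
      ≤ c.lam / 2 * (1 - η) * (‖v - xs‖ ^ 2 + η * ‖x - xs‖ ^ 2) := by
    refine (mul_le_mul_of_nonneg_left f2 (by positivity)).trans (le_of_eq ?_)
    have e4 : c.kap * η ^ 2 = c.lam * (1 - η ^ 2) := by
      have : c.kap = σ - c.lam := by rw [hσd]; ring
      rw [this]
      nlinarith
    have e5 : (η / (1 + η)) ^ 2 * ((1 + η) * (‖v - xs‖ ^ 2 + η * ‖x - xs‖ ^ 2))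
      = η ^ 2 / (1 + η) * (‖v - xs‖ ^ 2 + η * ‖x - xs‖ ^ 2) := by field_simp
    rw [e5]
    have e6 : c.kap / 2 * (η ^ 2 / (1 + η) * (‖v - xs‖ ^ 2 + η * ‖x - xs‖ ^ 2))
      = c.kap * η ^ 2 / (2 * (1 + η)) * (‖v - xs‖ ^ 2 + η * ‖x - xs‖ ^ 2) := by field_simp
    rw [e6, e4]
    field_simp
    ring
  have f4 : G p c y z - p.Pstar ≤ (1 - η) * potential p c xs x y := by
    unfold G potential
    rw [← hη, ← hv]
    linarith
  -- the inexactness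
  have g1 := hw x'
  have g2 := hw z
  -- The growth of G is anchored at its exact minimizer w. Passing from w to x' gives up a fraction
  -- u of the squared distance and costs an error of order ε/u.
  have g3 := norm_add_sq_le_weighted (show 0 < u / (1 - u) by apply div_pos <;> linarith)
    (z - w) (w - x')
  rw [sub_add_sub_cancel] at g3
  have h1u : 0 < 1 - u := by linarith
  have g4 : (1 - u) * ‖z - x'‖ ^ 2 ≤ ‖z - w‖ ^ 2 + (1 - u) / u * ‖x' - w‖ ^ 2 := by
    have := mul_le_mul_of_nonneg_left g3 h1u.le
    refine this.trans (le_of_eq ?_)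
    rw [norm_sub_rev w x']
    field_simp
    ring
  have g5 := mul_le_mul_of_nonneg_left g4 (show 0 ≤ σ / 2 by positivity)
  have g6 : σ / 2 * ‖x' - w‖ ^ 2 ≤ ε := by linarith
  have hε0 : 0 ≤ ε := le_trans (by positivity) g6
  have g7 : σ / 2 * ((1 - u) / u * ‖x' - w‖ ^ 2) ≤ 1 / u * ε := by
    calc _ = (1 - u) / u * (σ / 2 * ‖x' - w‖ ^ 2) := by ring
      _ ≤ 1 / u * ε := by gcongr; linarith
  have g8 : σ / 2 * ((1 - u) * ‖z - x'‖ ^ 2) = (1 - u) * (c.lam / 2 * ‖v' - xs‖ ^ 2) := by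
    rw [e1, norm_neg, norm_smul, mul_pow, Real.norm_eq_abs, sq_abs, ← hηs]
    ring
  have g9 : p.P x' ≤ G p c y x' := le_add_of_nonneg_right (by positivity)
  have g10 : p.Pstar ≤ p.P x' := by
    obtain ⟨x₁, -, hx₁⟩ := h.exists_min_Pstar
    exact (le_add_of_nonneg_right (by positivity)).trans (hx₁ x')
  have g11 : 0 ≤ u * (p.P x' - p.Pstar) := mul_nonneg hu.le (by linarith)
  rw [potential, ← hη, ← hv']
  linarith

/-- The prox-center is the convex combination (x + ηv)/(1+η), and the potential controls the
distance of both points to the minimizer. -/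
theorem Standing.norm_center_sub_le (h : Standing p c b) {xs : Rn d}
    (hxs : ∀ z, p.Pstar + c.lam / 2 * ‖z - xs‖ ^ 2 ≤ p.P z) (x y : Rn d) :
    c.lam / 2 * ‖y - xs‖ ^ 2 ≤ potential p c xs x y := by
  have hη0 : 0 < Real.sqrt c.q := h.sqrt_q_pos
  have hlam := h.lam_pos
  unfold potential
  set η := Real.sqrt c.q
  set v := estPoint η x y with hv
  have hy : y - xs = (1 / (1 + η)) • (x - xs) + (η / (1 + η)) • (v - xs) := by
    have h1 : y = (1 / (1 + η)) • (x + η • v) := by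
      rw [hv, estPoint, smul_smul, mul_one_div_cancel hη0.ne', one_smul, add_sub_cancel, smul_smul,
        one_div_mul_cancel (by positivity), one_smul]
    have h2 : xs = (1 / (1 + η)) • ((1 + η) • xs) := by
      rw [smul_smul, one_div_mul_cancel (by positivity), one_smul]
    have h3 : η / (1 + η) = 1 / (1 + η) * η := by ring
    conv_lhs => rw [h1, h2]
    rw [h3, ← smul_smul, ← smul_sub, ← smul_add]
    congr 1
    module
  have h1 := norm_sq_convex_comb (1 / (1 + η)) (η / (1 + η)) (by field_simp) (x - xs) (v - xs)
  rw [← hy] at h1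
  have h2 := hxs x
  have a1 : 1 / (1 + η) ≤ 1 := by rw [div_le_one (by positivity)]; linarith
  have a2 : η / (1 + η) ≤ 1 := by rw [div_le_one (by positivity)]; linarith
  have h3 : ‖y - xs‖ ^ 2 ≤ 1 * ‖x - xs‖ ^ 2 + 1 * ‖v - xs‖ ^ 2 := by
    rw [h1]
    have : 0 ≤ 1 / (1 + η) * (η / (1 + η)) * ‖x - xs - (v - xs)‖ ^ 2 := by positivity
    have b1 := mul_le_mul_of_nonneg_right a1 (sq_nonneg ‖x - xs‖)
    have b2 := mul_le_mul_of_nonneg_right a2 (sq_nonneg ‖v - xs‖)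
    linarith
  have h4 := mul_le_mul_of_nonneg_left h3 (show 0 ≤ c.lam / 2 by positivity)
  linarith

variable {Ξ : Type*} {Q : Ξ → Rn d → Rn d}

theorem Standing.potential_outer_le (h : Standing p c b) (hρ0 : 0 ≤ c.rho0)
    (hρ : c.rho0 < Real.sqrt c.q) {xs x₀ : Rn d} (hxs : p.P xs = p.Pstar)
    (hmin : ∀ z, p.Pstar + c.lam / 2 * ‖z - xs‖ ^ 2 ≤ p.P z)
    (r : ℕ → ℕ → Fin n → Fin m × Ξ) (k : ℕ)
    (hacc : ∀ j < k, G p c (outer p c Q x₀ r j).y (outer p c Q x₀ r (j + 1)).x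
      ≤ Gstar p c (outer p c Q x₀ r j).y + eps p c x₀ (j + 1)) :
    potential p c xs (outer p c Q x₀ r k).x (outer p c Q x₀ r k).y
      ≤ 8 * (p.P x₀ - p.Pstar) / (Real.sqrt c.q - c.rho0) ^ 2 * (1 - c.rho0) ^ k := by
  have hη0 : 0 < Real.sqrt c.q := h.sqrt_q_pos
  have hη1 := h.sqrt_q_le_one
  set η := Real.sqrt c.q with hη
  have hlam := h.lam_pos
  set Δ := p.P x₀ - p.Pstar with hΔ
  have h0 := hmin x₀
  have hΔ0 : 0 ≤ Δ := by
    have : 0 ≤ c.lam / 2 * ‖x₀ - xs‖ ^ 2 := by positivity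
    linarith
  -- Half of the margin between the exact rate 1-η and the target rate 1-ρ₀ absorbs the loss 1-u,
  -- the other half the accumulated errors.
  set u := (η - c.rho0) / 2 with hu
  have hu0 : 0 < u := by linarith
  have hu1 : u ≤ 1 / 2 := by linarith
  have hM : 8 * Δ / (η - c.rho0) ^ 2 = 2 * Δ / u ^ 2 := by
    have : η - c.rho0 = 2 * u := by rw [hu]; ring
    rw [this]
    field_simp
    ring
  rw [hM]
  set M := 2 * Δ / u ^ 2 with hMd
  have hM0 : 0 ≤ M := by positivity
  induction k with
  | zero =>
    have e : estPoint η x₀ x₀ = x₀ := by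
      have : (1 + η) • x₀ - x₀ = η • x₀ := by module
      rw [estPoint, this, smul_smul, one_div_mul_cancel hη0.ne', one_smul]
    change potential p c xs x₀ x₀ ≤ _
    rw [potential, ← hη, e, pow_zero, mul_one]
    have h1 : 2 * Δ ≤ M := by
      rw [hMd, le_div_iff₀ (by positivity)]
      have : u ^ 2 ≤ 1 := by nlinarith
      nlinarith
    linarith
  | succ k ih =>
    have ih' := ih fun j hj => hacc j (hj.trans k.lt_succ_self)
    have hs := h.potential_step hxs (outer p c Q x₀ r k).x (outer p c Q x₀ r k).y
      (outer p c Q x₀ r (k + 1)).x (hacc k k.lt_succ_self) hu0 (by linarith)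
    have hy : (outer p c Q x₀ r (k + 1)).y = (outer p c Q x₀ r (k + 1)).x +
        ((1 - η) / (1 + η)) • ((outer p c Q x₀ r (k + 1)).x - (outer p c Q x₀ r k).x) := by
      rw [hη, ← h.beta_eq k]
      rfl
    rw [← hη, ← hy] at hs
    have h1ρ : 0 < 1 - c.rho0 := by linarith
    set D := (1 - c.rho0) ^ k with hD
    have hD0 : 0 < D := by positivity
    have e1 : eps p c x₀ (k + 1) = 2 / 9 * Δ * (D * (1 - c.rho0)) := by
      rw [eps, pow_succ]
    have h2 : (1 + 1 / u) * (2 / 9 * Δ) ≤ u * M := by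
      have : u * M = 2 / u * Δ := by rw [hMd]; field_simp
      rw [this]
      have h3 : 1 + 1 / u ≤ 2 / u := by
        rw [le_div_iff₀ hu0]; field_simp; linarith
      have := mul_le_mul_of_nonneg_right h3 hΔ0
      have h4 : 0 ≤ (1 + 1 / u) * Δ := by positivity
      linarith
    -- As η = ρ₀ + 2u, the two sides differ by 2uρ₀M ≥ 0; this closes the induction.
    have h5 : (1 - η) * M + u * M * (1 - c.rho0) ≤ (1 - u) * (1 - c.rho0) * M := by
      have : (1 - u) * (1 - c.rho0) * M - (1 - η) * M - u * M * (1 - c.rho0)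
          = (2 * u * c.rho0) * M := by
        have : η = c.rho0 + 2 * u := by rw [hu]; ring
        rw [this]; ring
      have h6 : 0 ≤ (2 * u * c.rho0) * M := by positivity
      linarith
    have h7 : (1 - u) * potential p c xs (outer p c Q x₀ r (k + 1)).x
        (outer p c Q x₀ r (k + 1)).y ≤ (1 - u) * (M * (D * (1 - c.rho0))) := by
      refine hs.trans ?_
      rw [e1]
      have h8 := mul_le_mul_of_nonneg_left ih' (show 0 ≤ 1 - η by linarith)
      have h9 := mul_le_mul_of_nonneg_right h2 (show 0 ≤ D * (1 - c.rho0) by positivity)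
      have h10 := mul_le_mul_of_nonneg_right h5 hD0.le
      linarith
    rw [pow_succ]
    exact le_of_mul_le_mul_left h7 (by linarith)

/-- Both centers lie near the minimizer of P. The six powers of √q-ρ₀ are two from the potential,
two from trading κ for λ, and two from a crude comparison of ε_{k+2} with the potential bound at k;
288 is 64·9/2. -/
theorem Standing.norm_center_step_le (h : Standing p c b) (hρ0 : 0 ≤ c.rho0)
    (hρ : c.rho0 < Real.sqrt c.q) {x₀ : Rn d} (r : ℕ → ℕ → Fin n → Fin m × Ξ) (k : ℕ)
    (hacc : ∀ j < k + 1, G p c (outer p c Q x₀ r j).y (outer p c Q x₀ r (j + 1)).x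
      ≤ Gstar p c (outer p c Q x₀ r j).y + eps p c x₀ (j + 1)) :
    c.kap * ‖(outer p c Q x₀ r (k + 1)).y - (outer p c Q x₀ r k).y‖ ^ 2
      ≤ 288 / (Real.sqrt c.q - c.rho0) ^ 6 * eps p c x₀ (k + 2) := by
  obtain ⟨xs, hxs, hmin⟩ := h.exists_min_Pstar
  have h1 := h.potential_outer_le (Q := Q) hρ0 hρ hxs hmin r (k + 1) hacc
  have h2 := h.potential_outer_le (Q := Q) hρ0 hρ hxs hmin r k
    fun j hj => hacc j (hj.trans k.lt_succ_self)
  have h3 := h.norm_center_sub_le hmin (outer p c Q x₀ r (k + 1)).x (outer p c Q x₀ r (k + 1)).y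
  have h4 := h.norm_center_sub_le hmin (outer p c Q x₀ r k).x (outer p c Q x₀ r k).y
  have hη1 := h.sqrt_q_le_one
  have hηs := h.sqrt_q_sq
  have hlam := h.lam_pos
  have hkap := h.kap_nonneg
  have hσ := h.sig_pos
  set η := Real.sqrt c.q
  set g := η - c.rho0 with hg
  have hg0 : 0 < g := by linarith
  have h0 := hmin x₀
  set Δ := p.P x₀ - p.Pstar with hΔ
  have hΔ0 : 0 ≤ Δ := by
    have : 0 ≤ c.lam / 2 * ‖x₀ - xs‖ ^ 2 := by positivity
    linarith
  set D := (1 - c.rho0) ^ k with hD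
  have h1ρ : 0 < 1 - c.rho0 := by linarith
  have hD0 : 0 < D := by positivity
  set Y' := (outer p c Q x₀ r (k + 1)).y
  set Y := (outer p c Q x₀ r k).y
  have h5 := norm_add_sq_le_weighted one_pos (Y' - xs) (xs - Y)
  rw [sub_add_sub_cancel, norm_sub_rev xs Y] at h5
  have h6 : c.lam * ‖Y' - Y‖ ^ 2 ≤ 64 * Δ / g ^ 2 * D := by
    have h7 : 8 * Δ / g ^ 2 * (1 - c.rho0) ^ (k + 1) ≤ 8 * Δ / g ^ 2 * D := by
      gcongr
      rw [pow_succ]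
      exact mul_le_of_le_one_right hD0.le (by linarith)
    have h8 := mul_le_mul_of_nonneg_left h5 hlam.le
    have e : 64 * Δ / g ^ 2 * D = 8 * (8 * Δ / g ^ 2 * D) := by ring
    have h9 : 0 ≤ 8 * Δ / g ^ 2 * D := by positivity
    linarith
  -- Because (√q-ρ₀)² ≤ q = λ/σ.
  have h10 : c.kap * g ^ 2 ≤ c.lam := by
    have : g ^ 2 ≤ η ^ 2 := by gcongr; linarith
    calc c.kap * g ^ 2 ≤ (c.lam + c.kap) * η ^ 2 := by gcongr; linarith
      _ = c.lam := by rw [mul_comm]; exact hηs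
  have h11 : c.kap * ‖Y' - Y‖ ^ 2 ≤ 64 * Δ / g ^ 4 * D := by
    have h12 : g ^ 2 * (c.kap * ‖Y' - Y‖ ^ 2) ≤ 64 * Δ / g ^ 2 * D :=
      le_trans (by
        calc g ^ 2 * (c.kap * ‖Y' - Y‖ ^ 2) = (c.kap * g ^ 2) * ‖Y' - Y‖ ^ 2 := by ring
          _ ≤ c.lam * ‖Y' - Y‖ ^ 2 := by gcongr) h6
    have e : 64 * Δ / g ^ 2 * D = g ^ 2 * (64 * Δ / g ^ 4 * D) := by field_simp
    rw [e] at h12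
    exact le_of_mul_le_mul_left h12 (by positivity)
  refine h11.trans ?_
  have e : eps p c x₀ (k + 2) = 2 / 9 * Δ * (D * (1 - c.rho0) ^ 2) := by
    rw [eps, pow_add]
  rw [e]
  have h13 : g ^ 2 ≤ (1 - c.rho0) ^ 2 := by gcongr; linarith
  calc 64 * Δ / g ^ 4 * D = 64 * Δ / g ^ 6 * D * g ^ 2 := by field_simp
    _ ≤ 64 * Δ / g ^ 6 * D * (1 - c.rho0) ^ 2 := by gcongr
    _ = _ := by ring

/-! ### The stopping quantity against the reference Lyapunov function -/

theorem psi4_eq (y : Rn d) (s : State d t m n) :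
    psi4 p c y s = (Gstar p c y - dual p c y s.α) + c.w₁ * ‖s.errMean‖ ^ 2 + c.w₂ * s.errSq := by
  unfold psi4 State.errMean State.errSq
  ring

theorem Standing.w₁_pos (h : Standing p c b) : 0 < c.w₁ := by
  have := h.weightScale_pos
  have := h.hb
  exact lt_of_lt_of_le (by positivity) h.w₁_ge

theorem Standing.w₂_pos (h : Standing p c b) : 0 < c.w₂ := by
  have := h.weightScale_pos
  have := h.hb
  have : 0 < 1 - c.del := by linarith [h.del_lt]
  exact lt_of_lt_of_le (by positivity) h.w₂_ge

/-- The state and the objective at the end of an inner loop. -/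
theorem Standing.of_merit_le (h : Standing p c b) {y : Rn d} {s : State d t m n}
    (hs : Invariant p c s) {ε : ℝ} (hε : merit p c y s ≤ ε) :
    G p c y (primal p c y s) ≤ Gstar p c y + ε ∧
    ∀ y', lyap p c (1 - c.del) y' s ≤ (1 + 3 * b) * ε + c.kap * ‖y' - y‖ ^ 2 := by
  have hw := h.weightScale_pos
  have hw1 := h.w₁_pos
  have hw2 := h.w₂_pos
  have hb := h.hb
  have hgap := h.dual_le_Gstar y hs.feasible
  have hS := s.errSq_nonneg
  have hG := h.Gstar_le y (primal p c y s)
  have h1d : 0 < 1 - c.del := by linarith [h.del_lt]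
  have hσ := h.sig_pos
  have hkap := h.kap_nonneg
  have hlam := h.lam_pos
  have hroot := h.rootTerm_le
  set R := Real.sqrt (2 + c.del * m) with hR
  have hR1 : 1 ≤ R := by
    rw [hR, Real.one_le_sqrt]
    have := h.del_pos
    have : 0 ≤ c.del * m := by positivity
    linarith
  rw [merit, psi4_eq, ← hR] at hε
  set E := ‖s.errMean‖ ^ 2 with hE
  have hE0 : 0 ≤ E := by positivity
  have a1 : 0 ≤ c.w₁ * E := by positivity
  have a2 : 0 ≤ c.w₂ * s.errSq := by positivity
  set Ψ := (Gstar p c y - dual p c y s.α) + c.w₁ * E + c.w₂ * s.errSq with hΨ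
  have hΨ0 : 0 ≤ Ψ := by linarith
  have hΨε : 3 * Ψ ≤ ε := by nlinarith
  have hGε : 2 * (G p c y (primal p c y s) - Gstar p c y) ≤ ε := by
    have : 0 ≤ 3 * R * Ψ := by positivity
    linarith
  have hRE : 3 * (R * (c.w₁ * E)) ≤ ε := by
    have : R * (c.w₁ * E) ≤ R * Ψ := by gcongr; linarith
    linarith
  refine ⟨by linarith, fun y' => ?_⟩
  have hc := h.gap_center_le y y' hs.sum_eq
  have b1 : weightScale p c ≤ b * c.w₁ := by
    have := h.w₁_ge
    rw [div_le_iff₀ (by positivity)] at this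
    linarith
  have b2 : (1 - c.del) * weightScale p c ≤ b * c.w₂ := by
    have := h.w₂_ge
    rw [div_le_iff₀ (by positivity)] at this
    linarith
  -- Here the factor √(2+δm) of the stopping rule is needed: σ exceeds w by `rootTerm`, which that
  -- factor dominates, so σ‖e‖² is at most bε/3 by `hRE`.
  have b3 : (c.lam + c.kap) * E ≤ b * (R * (c.w₁ * E)) := by
    have : c.lam + c.kap = weightScale p c * rootTerm p c := by
      rw [weightScale_eq, div_mul_cancel₀ _ h.rootTerm_pos.ne']
    rw [this]
    have := h.rootTerm_pos
    calc _ ≤ (b * c.w₁) * R * E := by gcongr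
      _ = _ := by ring
  have b4 : c.kap ^ 2 / (c.lam + c.kap) * ‖y' - y‖ ^ 2 ≤ c.kap * ‖y' - y‖ ^ 2 := by
    gcongr
    rw [div_le_iff₀ hσ]
    nlinarith
  have b5 := mul_le_mul_of_nonneg_right b1 hE0
  have b6 := mul_le_mul_of_nonneg_right b2 hS
  have b7 : b * (3 * (R * (c.w₁ * E))) ≤ b * ε := by gcongr
  have b8 : b * (3 * (c.w₁ * E)) ≤ b * ε := by gcongr; linarith
  have b9 : b * (3 * (c.w₂ * s.errSq)) ≤ b * ε := by gcongr; linarith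
  have b10 : 0 ≤ b * ε := mul_nonneg (by linarith) (by linarith)
  rw [← hE] at hc
  unfold lyap
  rw [← hE]
  linarith

/-- The 30 is 3·2·5: √(2+δm) ≤ 2X, and 5b compares the weights w₁, w₂ with those built from w/5. -/
theorem Standing.merit_le (h : Standing p c b) {y : Rn d} {s : State d t m n}
    (hs : p.DualFeasible s.α) :
    merit p c y s ≤ 30 * b * complexity p c * lyap p c 1 y s
      + 2 * (G p c y (primal p c y s) - Gstar p c y) := by
  have hb := h.hb
  have hw := h.weightScale_pos
  have hgap := h.dual_le_Gstar y hs
  have hS := s.errSq_nonneg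
  have hX := h.two_le_complexity
  have h1 : psi4 p c y s ≤ 5 * b * lyap p c 1 y s := by
    rw [psi4_eq, lyap]
    have a1 := mul_le_mul_of_nonneg_right h.w₁_le (sq_nonneg ‖s.errMean‖)
    have a2 := mul_le_mul_of_nonneg_right h.w₂_le hS
    have a3 : 0 ≤ b * weightScale p c * s.errSq := by positivity
    have a4 : 0 ≤ (5 * b - 1) * (Gstar p c y - dual p c y s.α) :=
      mul_nonneg (by linarith) (by linarith)
    linarith
  have h2 : Real.sqrt (2 + c.del * m) ≤ 2 * complexity p c := by
    apply Real.sqrt_le_iff.2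
    refine ⟨by linarith, ?_⟩
    have h3 := h.complexity_ge
    have h4 : (0 : ℝ) ≤ 1 / c.del := by have := h.del_pos; positivity
    have h5 : c.del * m ≤ 1 * m := by gcongr; exact h.del_lt.le
    nlinarith
  have h6 := h.lyap_nonneg zero_le_one y hs
  have h7 : 3 * Real.sqrt (2 + c.del * m) * psi4 p c y s
      ≤ 3 * (2 * complexity p c) * (5 * b * lyap p c 1 y s) :=
    (mul_le_mul_of_nonneg_left h1 (by positivity)).trans (by gcongr)
  unfold merit
  linarith

end

/-! ### The inner loop as a stochastic process -/

/-- Freezing the past: the joint law is a product, so Tonelli's theorem integrates the fresh draws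
first. -/
theorem lintegral_comp_of_indepFun {Ω A B : Type*} [MeasurableSpace Ω] [MeasurableSpace A]
    [MeasurableSpace B] {μ : Measure Ω} [IsProbabilityMeasure μ] {X : Ω → A} {D : Ω → B}
    (hX : Measurable X) (hD : Measurable D) (hind : IndepFun X D μ) {F : A × B → ENNReal}
    (hF : Measurable F) :
    ∫⁻ ω, F (X ω, D ω) ∂μ = ∫⁻ ω, ∫⁻ ω', F (X ω, D ω') ∂μ ∂μ := by
  have e1 : ∫⁻ ω, F (X ω, D ω) ∂μ = ∫⁻ z, F z ∂(μ.map fun ω => (X ω, D ω)) :=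
    (lintegral_map hF (hX.prodMk hD)).symm
  rw [e1, hind.map_prod_eq_prod_map_map hX.aemeasurable hD.aemeasurable,
    lintegral_prod _ hF.aemeasurable, lintegral_map hF.lintegral_prod_right' hX]
  refine lintegral_congr fun ω => ?_
  exact lintegral_map (hF.comp measurable_prodMk_left) hD

theorem iIndepFun.isDraw {d t m n : ℕ} {p : Problem d t m n} {c : Params} {b : ℝ}
    (_ : Standing p c b) {Ω Ξ : Type*} [MeasurableSpace Ω] [MeasurableSpace Ξ] {μ : Measure Ω}
    {ν : Measure Ξ} {S : ℕ × ℕ × Fin n → Ω → Fin m × Ξ} (hS : ∀ z, Measurable (S z))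
    (hind : iIndepFun S μ)
    (hlaw : ∀ z, μ.map (S z) = (uniformOn (Set.univ : Set (Fin m))).prod ν) (k K : ℕ) :
    IsDraw μ ν fun τ => S (k, K, τ) where
  meas τ := hS _
  indep := hind.precomp (g := fun τ : Fin n => (k, K, τ)) fun τ τ' h => by simpa using h
  law τ := hlaw _

section

variable {d t m n : ℕ} {p : Problem d t m n} {c : Params} {b : ℝ}
  {Ξ : Type*} [MeasurableSpace Ξ] {Q : Ξ → Rn d → Rn d}

theorem Standing.invariant_innerIter (h : Standing p c b) (y : Rn d)
    (r : ℕ → Fin n → Fin m × Ξ) {s : State d t m n} (hs : Invariant p c s) (K : ℕ) :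
    Invariant p c (innerIter p c Q y r s K) := by
  induction K with
  | zero => exact hs
  | succ K ih => exact h.invariant_step y (r K) ih

theorem Standing.invariant_outer (h : Standing p c b) (x₀ : Rn d)
    (r : ℕ → ℕ → Fin n → Fin m × Ξ) (k : ℕ) : Invariant p c (outer p c Q x₀ r k).s := by
  induction k with
  | zero => exact ⟨by simp [outer, State.errMean, vOf], h.dualFeasible_zero⟩
  | succ k ih => exact h.invariant_innerIter _ _ ih _

/-- The prox-center of the outer iteration and the state after `K` inner iterations. -/
noncomputable def process (p : Problem d t m n) (c : Params) (Q : Ξ → Rn d → Rn d) (x₀ : Rn d)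
    (k K : ℕ) (r : ℕ → ℕ → Fin n → Fin m × Ξ) : Rn d × State d t m n :=
  ((outer p c Q x₀ r k).y,
    innerIter p c Q (outer p c Q x₀ r k).y (r (k + 1)) (outer p c Q x₀ r k).s K)

/-- Only draws that have already occurred must be measurable, over an arbitrary σ-algebra. Taking
the one generated by the past draws yields independence from the current ones. -/
theorem Standing.measurable_process (h : Standing p c b)
    (hQ : Measurable fun z : Ξ × Rn d => Q z.1 z.2) (x₀ : Rn d) (k K : ℕ) {Z : Type*}
    [MeasurableSpace Z] {r : Z → ℕ → ℕ → Fin n → Fin m × Ξ}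
    (h1 : ∀ k' ≤ k, ∀ K τ, Measurable fun z => r z k' K τ)
    (h2 : ∀ K' < K, ∀ τ, Measurable fun z => r z (k + 1) K' τ) :
    Measurable fun z => process p c Q x₀ k K (r z) := by
  obtain ⟨-, hy, hs⟩ := h.measurable_outer hQ x₀ k h1
  exact hy.prodMk (h.measurable_innerIter hQ hy hs K h2)

theorem Standing.invariant_process (h : Standing p c b) (x₀ : Rn d) (k K : ℕ)
    (r : ℕ → ℕ → Fin n → Fin m × Ξ) : Invariant p c (process p c Q x₀ k K r).2 :=
  h.invariant_innerIter _ _ (h.invariant_outer x₀ r k) K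

variable {Ω : Type*} [mΩ : MeasurableSpace Ω] {μ : Measure Ω} [IsProbabilityMeasure μ]
  {ν : Measure Ξ} [IsProbabilityMeasure ν] {S : ℕ × ℕ × Fin n → Ω → Fin m × Ξ}

/-- The draws of one inner iteration are independent of everything before. -/
theorem Standing.indepFun_process (h : Standing p c b)
    (hQ : Measurable fun z : Ξ × Rn d => Q z.1 z.2)
    (hS : ∀ z, Measurable (S z)) (hind : iIndepFun S μ) (x₀ : Rn d) (k K : ℕ) :
    IndepFun (fun ω => process p c Q x₀ k K fun k K τ => S (k, K, τ) ω)
      (fun ω τ => S (k + 1, K, τ) ω) μ := by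
  -- The past consists of all inner draws of the outer rows up to k, since stopping times are
  -- unbounded, and of the draws before K in row k + 1.
  set A : Set (ℕ × ℕ × Fin n) := {z | z.1 ≤ k ∨ (z.1 = k + 1 ∧ z.2.1 < K)} with hA
  set B : Set (ℕ × ℕ × Fin n) := {z | z.1 = k + 1 ∧ z.2.1 = K} with hB
  have hdisj : Disjoint A B := by
    rw [Set.disjoint_left]
    rintro ⟨k', K', τ⟩ h1 h2
    simp only [hA, hB, Set.mem_ofPred_eq] at h1 h2
    omega
  set ms : ℕ × ℕ × Fin n → MeasurableSpace Ω := fun z => MeasurableSpace.comap (S z) inferInstance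
    with hms
  have hle : ∀ z, ms z ≤ mΩ := fun z => (hS z).comap_le
  have hI : Indep (⨆ z ∈ A, ms z) (⨆ z ∈ B, ms z) μ :=
    indep_iSup_of_disjoint hle ((iIndepFun_iff_iIndep _ _ _).1 hind) hdisj
  have hmeas : ∀ (T : Set (ℕ × ℕ × Fin n)) z, z ∈ T →
      Measurable[⨆ z ∈ T, ms z] (S z) := by
    intro T z hz
    have h1 : ms z ≤ ⨆ z ∈ T, ms z := le_iSup₂ (f := fun z (_ : z ∈ T) => ms z) z hz
    exact (comap_measurable (S z)).mono h1 le_rfl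
  have hX : Measurable[⨆ z ∈ A, ms z]
      (fun ω => process p c Q x₀ k K fun k K τ => S (k, K, τ) ω) := by
    refine @Standing.measurable_process d t m n p c b Ξ _ Q h hQ x₀ k K Ω (⨆ z ∈ A, ms z)
      (fun ω k K τ => S (k, K, τ) ω) ?_ ?_
    · intro k' hk' K' τ
      exact hmeas A (k', K', τ) (Or.inl hk')
    · intro K' hK' τ
      exact hmeas A (k + 1, K', τ) (Or.inr ⟨rfl, hK'⟩)
  have hD : Measurable[⨆ z ∈ B, ms z] (fun ω τ => S (k + 1, K, τ) ω) := by
    refine @measurable_pi_lambda Ω (Fin n) (fun _ => Fin m × Ξ) (⨆ z ∈ B, ms z) _ _ fun τ => ?_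
    exact hmeas B (k + 1, K, τ) ⟨rfl, rfl⟩
  rw [IndepFun_iff_Indep]
  exact indep_of_indep_of_le_left (indep_of_indep_of_le_right hI hD.comap_le) hX.comap_le

/-- The expected Lyapunov function after `K` inner iterations. -/
noncomputable def expLyap (p : Problem d t m n) (c : Params) (Q : Ξ → Rn d → Rn d) (x₀ : Rn d)
    (μ : Measure Ω) (S : ℕ × ℕ × Fin n → Ω → Fin m × Ξ) (a : ℝ) (k K : ℕ) : ENNReal :=
  ∫⁻ ω, ENNReal.ofReal (lyap p c a
    (process p c Q x₀ k K fun k K τ => S (k, K, τ) ω).1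
    (process p c Q x₀ k K fun k K τ => S (k, K, τ) ω).2) ∂μ

/-- The expected primal gap after `K` inner iterations. -/
noncomputable def expGap (p : Problem d t m n) (c : Params) (Q : Ξ → Rn d → Rn d) (x₀ : Rn d)
    (μ : Measure Ω) (S : ℕ × ℕ × Fin n → Ω → Fin m × Ξ) (k K : ℕ) : ENNReal :=
  ∫⁻ ω, ENNReal.ofReal (G p c (process p c Q x₀ k K fun k K τ => S (k, K, τ) ω).1
    (primal p c (process p c Q x₀ k K fun k K τ => S (k, K, τ) ω).1
      (process p c Q x₀ k K fun k K τ => S (k, K, τ) ω).2)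
    - Gstar p c (process p c Q x₀ k K fun k K τ => S (k, K, τ) ω).1) ∂μ

/-! ### Expected decrease along an inner loop -/

theorem Standing.measurable_process' (h : Standing p c b)
    (hQ : Measurable fun z : Ξ × Rn d => Q z.1 z.2) (hS : ∀ z, Measurable (S z)) (x₀ : Rn d)
    (k K : ℕ) : Measurable fun ω => process p c Q x₀ k K fun k K τ => S (k, K, τ) ω :=
  h.measurable_process hQ x₀ k K (fun _ _ _ _ => hS _) fun _ _ _ => hS _

theorem Standing.expLyap_succ_le (h : Standing p c b) (hQ : IsContraction ν Q c.del)
    (hmean : ∀ x, ∫ ζ, Q ζ x ∂ν = c.del • x) (hS : ∀ z, Measurable (S z)) (hind : iIndepFun S μ)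
    (hlaw : ∀ z, μ.map (S z) = (uniformOn (Set.univ : Set (Fin m))).prod ν) (x₀ : Rn d)
    (k K : ℕ) :
    expLyap p c Q x₀ μ S 1 k (K + 1) ≤ ∫⁻ ω, ENNReal.ofReal (lyapNext p c
      (process p c Q x₀ k K fun k K τ => S (k, K, τ) ω).1
      (process p c Q x₀ k K fun k K τ => S (k, K, τ) ω).2) ∂μ := by
  have hX := h.measurable_process' hQ.measurable hS x₀ k K
  have hD : Measurable fun ω τ => S (k + 1, K, τ) ω := measurable_pi_lambda _ fun τ => hS _
  set F : (Rn d × State d t m n) × (Fin n → Fin m × Ξ) → ENNReal := fun z =>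
    ENNReal.ofReal (lyap p c 1 z.1.1 (step p c Q z.1.1 z.2 z.1.2)) with hF
  have hFm : Measurable F := by
    have hy : Measurable fun z : (Rn d × State d t m n) × (Fin n → Fin m × Ξ) => z.1.1 :=
      measurable_fst.comp measurable_fst
    have hs : Measurable fun z : (Rn d × State d t m n) × (Fin n → Fin m × Ξ) => z.1.2 :=
      measurable_snd.comp measurable_fst
    have hr : ∀ τ, Measurable fun z : (Rn d × State d t m n) × (Fin n → Fin m × Ξ) => z.2 τ :=
      fun τ => (measurable_pi_apply τ).comp measurable_snd
    exact (h.measurable_lyap 1 hy (h.measurable_step hQ.measurable hy hs hr)).ennreal_ofReal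
  have e := lintegral_comp_of_indepFun hX hD
    (h.indepFun_process hQ.measurable hS hind x₀ k K) hFm
  have e' : expLyap p c Q x₀ μ S 1 k (K + 1) = ∫⁻ ω, F
      (process p c Q x₀ k K fun k K τ => S (k, K, τ) ω, fun τ => S (k + 1, K, τ) ω) ∂μ := rfl
  rw [e', e]
  refine lintegral_mono fun ω => ?_
  exact (h.lintegral_lyap_step_le hQ hmean (iIndepFun.isDraw h hS hind hlaw (k + 1) K) _
    (h.invariant_process x₀ k K _)).2

theorem Standing.lyapNext_nonneg (h : Standing p c b) (hQ : IsContraction ν Q c.del)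
    (hmean : ∀ x, ∫ ζ, Q ζ x ∂ν = c.del • x) (hS : ∀ z, Measurable (S z)) (hind : iIndepFun S μ)
    (hlaw : ∀ z, μ.map (S z) = (uniformOn (Set.univ : Set (Fin m))).prod ν) (y : Rn d)
    {s : State d t m n} (hs : Invariant p c s) : 0 ≤ lyapNext p c y s :=
  (h.lintegral_lyap_step_le hQ hmean (iIndepFun.isDraw h hS hind hlaw 0 0) y hs).1

theorem Standing.expLyap_one_le (h : Standing p c b) (hQ : IsContraction ν Q c.del)
    (hmean : ∀ x, ∫ ζ, Q ζ x ∂ν = c.del • x) (hS : ∀ z, Measurable (S z)) (hind : iIndepFun S μ)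
    (hlaw : ∀ z, μ.map (S z) = (uniformOn (Set.univ : Set (Fin m))).prod ν) (x₀ : Rn d)
    (k : ℕ) : expLyap p c Q x₀ μ S 1 k 1 ≤ 2 * expLyap p c Q x₀ μ S (1 - c.del) k 0 := by
  refine (h.expLyap_succ_le hQ hmean hS hind hlaw x₀ k 0).trans ?_
  have hX := h.measurable_process' hQ.measurable hS x₀ k 0
  rw [expLyap, ← lintegral_const_mul _
    (h.measurable_lyap _ hX.fst hX.snd).ennreal_ofReal]
  refine lintegral_mono fun ω => ?_
  have h1 := h.lyapNext_le (process p c Q x₀ k 0 fun k K τ => S (k, K, τ) ω).1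
    (h.invariant_process (Q := Q) x₀ k 0 fun k K τ => S (k, K, τ) ω).feasible
  have e : (2 : ENNReal) = ENNReal.ofReal 2 := by simp
  dsimp only
  rw [e, ← ENNReal.ofReal_mul (by norm_num)]
  exact ENNReal.ofReal_le_ofReal h1

theorem Standing.expLyap_contract (h : Standing p c b) (hQ : IsContraction ν Q c.del)
    (hmean : ∀ x, ∫ ζ, Q ζ x ∂ν = c.del • x) (hS : ∀ z, Measurable (S z)) (hind : iIndepFun S μ)
    (hlaw : ∀ z, μ.map (S z) = (uniformOn (Set.univ : Set (Fin m))).prod ν) (x₀ : Rn d)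
    (k K : ℕ) :
    expLyap p c Q x₀ μ S 1 k (K + 1) + ENNReal.ofReal c.theta * expGap p c Q x₀ μ S k K
      ≤ ENNReal.ofReal (1 - c.theta) * expLyap p c Q x₀ μ S 1 k K := by
  have hX := h.measurable_process' hQ.measurable hS x₀ k K
  have hθ := h.theta_pos
  have hθ1 : 0 ≤ 1 - c.theta := by
    have := h.theta_le_del; linarith [h.del_lt]
  refine (add_le_add_left (h.expLyap_succ_le hQ hmean hS hind hlaw x₀ k K) _).trans ?_
  rw [expLyap, expGap, ← lintegral_const_mul _ (h.measurable_lyap _ hX.fst hX.snd).ennreal_ofReal,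
    ← lintegral_const_mul _ (h.measurable_primalGap hX.fst hX.snd).ennreal_ofReal,
    ← lintegral_add_right _ ((h.measurable_primalGap hX.fst hX.snd).ennreal_ofReal.const_mul _)]
  refine lintegral_mono fun ω => ?_
  have hinv := h.invariant_process (Q := Q) x₀ k K fun k K τ => S (k, K, τ) ω
  dsimp only
  rw [← ENNReal.ofReal_mul hθ.le, ← ENNReal.ofReal_mul hθ1,
    ← ENNReal.ofReal_add (h.lyapNext_nonneg hQ hmean hS hind hlaw _ hinv)
      (mul_nonneg hθ.le (sub_nonneg.2 (h.Gstar_le _ _)))]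
  exact ENNReal.ofReal_le_ofReal (h.lyapNext_add_le _ _)

theorem Standing.expLyap_le (h : Standing p c b) (hQ : IsContraction ν Q c.del)
    (hmean : ∀ x, ∫ ζ, Q ζ x ∂ν = c.del • x) (hS : ∀ z, Measurable (S z)) (hind : iIndepFun S μ)
    (hlaw : ∀ z, μ.map (S z) = (uniformOn (Set.univ : Set (Fin m))).prod ν) (x₀ : Rn d)
    (k K : ℕ) :
    expLyap p c Q x₀ μ S 1 k (K + 1)
      ≤ ENNReal.ofReal ((1 - c.theta) ^ K) * (2 * expLyap p c Q x₀ μ S (1 - c.del) k 0) := by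
  have hθ1 : 0 ≤ 1 - c.theta := by
    have := h.theta_le_del; linarith [h.del_lt]
  induction K with
  | zero => simpa using h.expLyap_one_le hQ hmean hS hind hlaw x₀ k
  | succ K ih =>
    calc expLyap p c Q x₀ μ S 1 k (K + 1 + 1)
        ≤ ENNReal.ofReal (1 - c.theta) * expLyap p c Q x₀ μ S 1 k (K + 1) :=
          le_self_add.trans (h.expLyap_contract hQ hmean hS hind hlaw x₀ k (K + 1))
      _ ≤ ENNReal.ofReal (1 - c.theta) * (ENNReal.ofReal ((1 - c.theta) ^ K) *
          (2 * expLyap p c Q x₀ μ S (1 - c.del) k 0)) := by gcongr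
      _ = _ := by rw [← mul_assoc, ← ENNReal.ofReal_mul hθ1, ← pow_succ']

/-- The primal gap need not be bounded pathwise: the contraction contains θ times its expectation,
and 1 ≤ bXθ, so twice the gap costs 2bX·E lyap and 30 becomes 32. -/
theorem Standing.lintegral_merit_le (h : Standing p c b) (hQ : IsContraction ν Q c.del)
    (hmean : ∀ x, ∫ ζ, Q ζ x ∂ν = c.del • x) (hS : ∀ z, Measurable (S z)) (hind : iIndepFun S μ)
    (hlaw : ∀ z, μ.map (S z) = (uniformOn (Set.univ : Set (Fin m))).prod ν) (x₀ : Rn d)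
    (k K : ℕ) :
    ∫⁻ ω, ENNReal.ofReal (merit p c
      (process p c Q x₀ k K fun k K τ => S (k, K, τ) ω).1
      (process p c Q x₀ k K fun k K τ => S (k, K, τ) ω).2) ∂μ
      ≤ ENNReal.ofReal (32 * b * complexity p c) * expLyap p c Q x₀ μ S 1 k K := by
  have hX := h.measurable_process' hQ.measurable hS x₀ k K
  have hθ := h.theta_pos
  have hb := h.hb
  have hXp := h.complexity_pos
  have hc0 : 0 ≤ 30 * b * complexity p c := by positivity
  have h1 : ∫⁻ ω, ENNReal.ofReal (merit p c
      (process p c Q x₀ k K fun k K τ => S (k, K, τ) ω).1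
      (process p c Q x₀ k K fun k K τ => S (k, K, τ) ω).2) ∂μ
      ≤ ENNReal.ofReal (30 * b * complexity p c) * expLyap p c Q x₀ μ S 1 k K
        + ENNReal.ofReal 2 * expGap p c Q x₀ μ S k K := by
    rw [expLyap, expGap, ← lintegral_const_mul _ (h.measurable_lyap _ hX.fst hX.snd).ennreal_ofReal,
      ← lintegral_const_mul _ (h.measurable_primalGap hX.fst hX.snd).ennreal_ofReal,
      ← lintegral_add_right _ ((h.measurable_primalGap hX.fst hX.snd).ennreal_ofReal.const_mul _)]
    refine lintegral_mono fun ω => ?_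
    have hinv := h.invariant_process (Q := Q) x₀ k K fun k K τ => S (k, K, τ) ω
    dsimp only
    rw [← ENNReal.ofReal_mul hc0, ← ENNReal.ofReal_mul zero_le_two,
      ← ENNReal.ofReal_add (mul_nonneg hc0 (h.lyap_nonneg zero_le_one _ hinv.feasible))
        (mul_nonneg zero_le_two (sub_nonneg.2 (h.Gstar_le _ _)))]
    exact ENNReal.ofReal_le_ofReal (h.merit_le hinv.feasible)
  have h2 : ENNReal.ofReal c.theta * expGap p c Q x₀ μ S k K ≤ expLyap p c Q x₀ μ S 1 k K := by
    refine (le_add_self.trans (h.expLyap_contract hQ hmean hS hind hlaw x₀ k K)).trans ?_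
    refine (mul_le_mul_left (ENNReal.ofReal_le_one.2 (by linarith)) _).trans (one_mul _).le
  have h3 : 1 ≤ b * complexity p c * c.theta := by
    have := h.theta_ge
    rw [div_le_iff₀ (by positivity)] at this
    linarith
  refine h1.trans ?_
  have h4 : ENNReal.ofReal 2 * expGap p c Q x₀ μ S k K
      ≤ ENNReal.ofReal (2 * (b * complexity p c)) * expLyap p c Q x₀ μ S 1 k K := by
    calc ENNReal.ofReal 2 * expGap p c Q x₀ μ S k K
        ≤ ENNReal.ofReal (2 * (b * complexity p c) * c.theta) * expGap p c Q x₀ μ S k K := by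
          gcongr; linarith
      _ = ENNReal.ofReal (2 * (b * complexity p c)) *
          (ENNReal.ofReal c.theta * expGap p c Q x₀ μ S k K) := by
          rw [ENNReal.ofReal_mul (by positivity), mul_assoc]
      _ ≤ _ := by gcongr
  refine (add_le_add_right h4 _).trans ?_
  rw [← add_mul, ← ENNReal.ofReal_add hc0 (by positivity)]
  apply le_of_eq
  congr 2
  ring

end

/-! ### Expected number of inner iterations -/

section

variable {d t m n : ℕ} {p : Problem d t m n} {c : Params} {b : ℝ}
  {Ξ : Type*} {Q : Ξ → Rn d → Rn d}

theorem lt_merit_of_lt_stopTime {y : Rn d} {r : ℕ → Fin n → Fin m × Ξ} {s₀ : State d t m n}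
    {ε : ℝ} {K : ℕ} (hK : 1 ≤ K) (hlt : (K : ℕ∞) < stopTime p c Q y r s₀ ε) :
    ε < merit p c y (innerIter p c Q y r s₀ K) := by
  by_contra hcon
  exact absurd hlt (not_lt.2 (sInf_le ⟨K, hK, not_lt.1 hcon, rfl⟩))

/-- Markov's inequality applied pathwise and summed: each iteration after K₀ and before the stop has
stopping quantity above ε and contributes at least 1 to the series. -/
theorem stopTime_le_add_tsum {y : Rn d} {r : ℕ → Fin n → Fin m × Ξ} {s₀ : State d t m n}
    {ε : ℝ} (hε : 0 < ε) (K₀ : ℕ) :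
    (stopTime p c Q y r s₀ ε : ENNReal) ≤ K₀ + 1 +
      ∑' j : ℕ, ENNReal.ofReal (merit p c y (innerIter p c Q y r s₀ (K₀ + j + 1)))
        / ENNReal.ofReal ε := by
  set f : ℕ → ENNReal := fun j =>
    ENNReal.ofReal (merit p c y (innerIter p c Q y r s₀ (K₀ + j + 1))) / ENNReal.ofReal ε
  have hε' : ENNReal.ofReal ε ≠ 0 := by simpa using hε
  have claim : ∀ M : ℕ, (M : ℕ∞) ≤ stopTime p c Q y r s₀ ε →
      (M : ENNReal) ≤ K₀ + 1 + ∑' j, f j := by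
    intro M hM
    -- The shift by 1 keeps the iteration index at least 1, as the stopping rule does not test index
    -- 0.
    have h1 : ∑ j ∈ Finset.range (M - (K₀ + 1)), (1 : ENNReal) ≤ ∑' j, f j := by
      refine (Finset.sum_le_sum fun j hj => ?_).trans (ENNReal.sum_le_tsum _)
      have hj' : K₀ + j + 1 < M := by
        have := Finset.mem_range.1 hj
        omega
      have h2 := lt_merit_of_lt_stopTime (K := K₀ + j + 1) (by omega)
        (lt_of_lt_of_le (by exact_mod_cast hj') hM)
      rw [ENNReal.le_div_iff_mul_le (Or.inl hε') (Or.inl ENNReal.ofReal_ne_top), one_mul]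
      exact ENNReal.ofReal_le_ofReal h2.le
    have h2 : (M : ENNReal) ≤ K₀ + 1 + (M - (K₀ + 1) : ℕ) := by
      have : M ≤ K₀ + 1 + (M - (K₀ + 1)) := by omega
      exact_mod_cast this
    refine h2.trans (add_le_add_right ?_ _)
    simpa using h1
  cases hT : stopTime p c Q y r s₀ ε with
  | coe N => simpa using claim N hT.ge
  -- If the loop never stops, the claim holds for every M, so the right-hand side is infinite too.
  | top =>
    rw [hT] at claim
    have : (K₀ : ENNReal) + 1 + ∑' j, f j = ⊤ := by
      refine ENNReal.eq_top_of_forall_nnreal_le fun x => ?_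
      obtain ⟨M, hM⟩ := exists_nat_ge x
      refine le_trans ?_ (claim M le_top)
      exact_mod_cast hM
    rw [this]
    exact le_top

variable [MeasurableSpace Ξ] {Ω : Type*} [mΩ : MeasurableSpace Ω] {μ : Measure Ω}
  [IsProbabilityMeasure μ] {ν : Measure Ξ} [IsProbabilityMeasure ν]
  {S : ℕ × ℕ × Fin n → Ω → Fin m × Ξ}

theorem mul_one_sub_pow_le_one {A θ : ℝ} (hA : 1 ≤ A) (hθ : 0 < θ) (hθ1 : θ ≤ 1) {K : ℕ}
    (hK : Real.log A / θ ≤ K) : A * (1 - θ) ^ K ≤ 1 := by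
  have h1 : (1 - θ) ^ K ≤ Real.exp (-Real.log A) := by
    calc (1 - θ) ^ K ≤ Real.exp (-θ) ^ K := by
          have := Real.add_one_le_exp (-θ)
          gcongr
          linarith
      _ = Real.exp (-(K * θ)) := by rw [← Real.exp_nat_mul]; ring_nf
      _ ≤ _ := by
          rw [div_le_iff₀ hθ] at hK
          exact Real.exp_le_exp.2 (by linarith)
  rw [Real.exp_neg, Real.exp_log (by linarith)] at h1
  calc A * (1 - θ) ^ K ≤ A * A⁻¹ := by gcongr
    _ = 1 := mul_inv_cancel₀ (by linarith)

theorem Standing.lintegral_innerCount_le_of_lyap_le (h : Standing p c b)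
    (hQ : IsContraction ν Q c.del)
    (hmean : ∀ x, ∫ ζ, Q ζ x ∂ν = c.del • x) (hS : ∀ z, Measurable (S z)) (hind : iIndepFun S μ)
    (hlaw : ∀ z, μ.map (S z) = (uniformOn (Set.univ : Set (Fin m))).prod ν) {x₀ : Rn d}
    {k : ℕ} (hε : 0 < eps p c x₀ (k + 1)) {B : ℝ} (hB : 1 ≤ B)
    (hlyap : ∀ᵐ ω ∂μ, lyap p c (1 - c.del)
      (outer p c Q x₀ (fun k K τ => S (k, K, τ) ω) k).y
      (outer p c Q x₀ (fun k K τ => S (k, K, τ) ω) k).s ≤ B * eps p c x₀ (k + 1)) :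
    ∫⁻ ω, (innerCount p c Q x₀ (fun k K τ => S (k, K, τ) ω) k : ENNReal) ∂μ
      ≤ ENNReal.ofReal (b * complexity p c * (Real.log (64 * b * complexity p c * B) + 2)) := by
  set ε := eps p c x₀ (k + 1) with hεdef
  have hθ := h.theta_pos
  have hb := h.hb
  have hX2 := h.two_le_complexity
  set X := complexity p c with hX
  set A := 64 * b * X * B with hA
  have hθs : c.theta ≤ 1 / 100 := by linarith [h.theta_le_del, h.del_lt]
  have hθ0 : 0 ≤ 1 - c.theta := by linarith
  have hA1 : 1 ≤ A := by
    have h1 : 1 ≤ 64 * b := by linarith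
    have h2 : 1 ≤ 64 * b * X := by nlinarith
    nlinarith
  have hlogA : 0 ≤ Real.log A := Real.log_nonneg hA1
  -- After K₀ steps the prefactor A = 32bX·2·B is consumed, so the j-th tail term is at most
  -- (1-θ)^j. Rounding and the extra iteration cost 2, which 2 ≤ 1/θ ≤ bX absorbs.
  set K₀ := ⌈Real.log A / c.theta⌉₊ with hK₀
  have hK₀1 : Real.log A / c.theta ≤ K₀ := Nat.le_ceil _
  have hK₀2 : (K₀ : ℝ) < Real.log A / c.theta + 1 := Nat.ceil_lt_add_one (by positivity)
  have hpow := mul_one_sub_pow_le_one hA1 hθ (by linarith) hK₀1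
  have hε' : ENNReal.ofReal ε ≠ 0 := by simpa using hε
  set M : ℕ → Ω → ENNReal := fun K ω => ENNReal.ofReal (merit p c
      (process p c Q x₀ k K fun k K τ => S (k, K, τ) ω).1
      (process p c Q x₀ k K fun k K τ => S (k, K, τ) ω).2) with hM
  have hMm : ∀ K, Measurable (M K) := fun K =>
    (h.measurable_merit (h.measurable_process' hQ.measurable hS x₀ k K).fst
      (h.measurable_process' hQ.measurable hS x₀ k K).snd).ennreal_ofReal
  have hE0 : expLyap p c Q x₀ μ S (1 - c.del) k 0 ≤ ENNReal.ofReal (B * ε) := by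
    calc expLyap p c Q x₀ μ S (1 - c.del) k 0 ≤ ∫⁻ _, ENNReal.ofReal (B * ε) ∂μ := by
          refine lintegral_mono_ae ?_
          filter_upwards [hlyap] with ω hω
          exact ENNReal.ofReal_le_ofReal hω
      _ = _ := by simp
  have hterm : ∀ j, ∫⁻ ω, M (K₀ + j + 1) ω / ENNReal.ofReal ε ∂μ
      ≤ ENNReal.ofReal ((1 - c.theta) ^ j) := by
    intro j
    simp only [div_eq_mul_inv]
    rw [lintegral_mul_const _ (hMm _), ← div_eq_mul_inv]
    refine ENNReal.div_le_of_le_mul ?_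
    have e2 : (2 : ENNReal) = ENNReal.ofReal 2 := by simp
    calc ∫⁻ ω, M (K₀ + j + 1) ω ∂μ
        ≤ ENNReal.ofReal (32 * b * X) * expLyap p c Q x₀ μ S 1 k (K₀ + j + 1) :=
          h.lintegral_merit_le hQ hmean hS hind hlaw x₀ k _
      _ ≤ ENNReal.ofReal (32 * b * X) * (ENNReal.ofReal ((1 - c.theta) ^ (K₀ + j)) *
          (2 * ENNReal.ofReal (B * ε))) := by
          gcongr
          refine (h.expLyap_le hQ hmean hS hind hlaw x₀ k (K₀ + j)).trans ?_
          gcongr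
      _ = ENNReal.ofReal (A * (1 - c.theta) ^ K₀ * ((1 - c.theta) ^ j * ε)) := by
          rw [e2, ← ENNReal.ofReal_mul (by norm_num), ← ENNReal.ofReal_mul (by positivity),
            ← ENNReal.ofReal_mul (by positivity)]
          congr 1
          rw [pow_add, hA]
          ring
      _ ≤ ENNReal.ofReal ((1 - c.theta) ^ j * ε) := by
          refine ENNReal.ofReal_le_ofReal ?_
          exact mul_le_of_le_one_left (by positivity) hpow
      _ = _ := ENNReal.ofReal_mul (by positivity)
  have hgeo : ∑' j : ℕ, ENNReal.ofReal ((1 - c.theta) ^ j) = ENNReal.ofReal (1 / c.theta) := by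
    rw [← ENNReal.ofReal_tsum_of_nonneg (fun j => by positivity)
      (summable_geometric_of_lt_one hθ0 (by linarith)),
      tsum_geometric_of_lt_one hθ0 (by linarith)]
    congr 1
    rw [sub_sub_cancel, one_div]
  have hmain : ∫⁻ ω, (innerCount p c Q x₀ (fun k K τ => S (k, K, τ) ω) k : ENNReal) ∂μ
      ≤ K₀ + 1 + ENNReal.ofReal (1 / c.theta) := by
    calc ∫⁻ ω, (innerCount p c Q x₀ (fun k K τ => S (k, K, τ) ω) k : ENNReal) ∂μ
        ≤ ∫⁻ ω, ((K₀ : ENNReal) + 1 + ∑' j, M (K₀ + j + 1) ω / ENNReal.ofReal ε) ∂μ :=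
          lintegral_mono fun ω => stopTime_le_add_tsum hε K₀
      _ = K₀ + 1 + ∑' j, ∫⁻ ω, M (K₀ + j + 1) ω / ENNReal.ofReal ε ∂μ := by
          rw [lintegral_add_left measurable_const, lintegral_const, measure_univ, mul_one,
            lintegral_tsum fun j => ((hMm _).div_const _).aemeasurable]
      _ ≤ K₀ + 1 + ∑' j : ℕ, ENNReal.ofReal ((1 - c.theta) ^ j) := by
          gcongr with j
          exact hterm j
      _ = _ := by rw [hgeo]
  refine hmain.trans ?_
  have e1 : (K₀ : ENNReal) + 1 = ENNReal.ofReal (K₀ + 1) := by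
    rw [ENNReal.ofReal_add (by positivity) zero_le_one]
    simp
  rw [e1, ← ENNReal.ofReal_add (by positivity) (by positivity)]
  refine ENNReal.ofReal_le_ofReal ?_
  have h1 : 1 / c.theta ≤ b * X := by
    have := h.theta_ge
    rw [div_le_iff₀ (by positivity)] at this
    rw [div_le_iff₀ hθ]
    linarith
  have h2 : 2 ≤ 1 / c.theta := by
    rw [le_div_iff₀ hθ]
    linarith
  have h3 : Real.log A / c.theta ≤ b * X * Real.log A := by
    rw [div_eq_mul_one_div, mul_comm]
    gcongr
  linarith

/-! ### Warm start -/

/-- Finiteness is essential: `outer` uses `toNat`, which sends ⊤ to 0, and the state reached then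
need not satisfy the stopping rule. -/
theorem Standing.accuracy_of_innerCount_ne_top (h : Standing p c b) {x₀ : Rn d}
    {r : ℕ → ℕ → Fin n → Fin m × Ξ} {k : ℕ} (hk : innerCount p c Q x₀ r k ≠ ⊤) :
    G p c (outer p c Q x₀ r k).y (outer p c Q x₀ r (k + 1)).x
      ≤ Gstar p c (outer p c Q x₀ r k).y + eps p c x₀ (k + 1) ∧
    ∀ y', lyap p c (1 - c.del) y' (outer p c Q x₀ r (k + 1)).s
      ≤ (1 + 3 * b) * eps p c x₀ (k + 1) + c.kap * ‖y' - (outer p c Q x₀ r k).y‖ ^ 2 := by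
  have hN : innerCount p c Q x₀ r k = ((innerCount p c Q x₀ r k).toNat : ℕ∞) :=
    (ENat.natCast_toNat hk).symm
  have h1 := (stopTime_eq_coe_iff.1 hN).1.2
  exact h.of_merit_le (h.invariant_innerIter _ _ (h.invariant_outer x₀ r k) _) h1

theorem Standing.gap_le_one (h : Standing p c b) (hρ0 : 0 ≤ c.rho0) :
    Real.sqrt c.q - c.rho0 ≤ 1 := by linarith [h.sqrt_q_le_one]

theorem Standing.eps_pos (h : Standing p c b) (hρ : c.rho0 < Real.sqrt c.q) {x₀ : Rn d}
    (hx₀ : p.Pstar < p.P x₀) (k : ℕ) : 0 < eps p c x₀ k := by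
  have h1 : 0 < 1 - c.rho0 := by linarith [h.sqrt_q_le_one]
  have h2 : 0 < p.P x₀ - p.Pstar := sub_pos.2 hx₀
  unfold eps
  positivity

/-- The end-of-loop bound is combined with the displacement of the center, after rescaling from
ε_{k+1} to ε_{k+2} = (1-ρ₀)ε_{k+1}; 289 + 3b is 288 + (1 + 3b). -/
theorem Standing.lyap_warm_start_le (h : Standing p c b) (hρ0 : 0 ≤ c.rho0)
    (hρ : c.rho0 < Real.sqrt c.q) {x₀ : Rn d} (hx₀ : p.Pstar < p.P x₀)
    {r : ℕ → ℕ → Fin n → Fin m × Ξ} {k : ℕ}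
    (hk : ∀ j < k + 1, innerCount p c Q x₀ r j ≠ ⊤) :
    lyap p c (1 - c.del) (outer p c Q x₀ r (k + 1)).y (outer p c Q x₀ r (k + 1)).s
      ≤ (289 + 3 * b) / (Real.sqrt c.q - c.rho0) ^ 6 * eps p c x₀ (k + 2) := by
  have h1 := (h.accuracy_of_innerCount_ne_top (hk k k.lt_succ_self)).2
    (outer p c Q x₀ r (k + 1)).y
  have h2 := h.norm_center_step_le hρ0 hρ r k fun j hj =>
    (h.accuracy_of_innerCount_ne_top (hk j hj)).1
  have hg1 := h.gap_le_one hρ0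
  have hη1 := h.sqrt_q_le_one
  set g := Real.sqrt c.q - c.rho0 with hg
  have hg0 : 0 < g := sub_pos.2 hρ
  have he1 := h.eps_pos hρ hx₀ (k + 1)
  have hb := h.hb
  have h3 : eps p c x₀ (k + 2) = eps p c x₀ (k + 1) * (1 - c.rho0) := by
    unfold eps
    ring
  have h4 : eps p c x₀ (k + 1) ≤ 1 / g ^ 6 * eps p c x₀ (k + 2) := by
    rw [h3, one_div_mul_eq_div, le_div_iff₀ (by positivity)]
    gcongr
    calc g ^ 6 ≤ g ^ 1 := pow_le_pow_of_le_one hg0.le hg1 (by norm_num)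
      _ ≤ 1 - c.rho0 := by rw [pow_one]; linarith
  calc _ ≤ (1 + 3 * b) * (1 / g ^ 6 * eps p c x₀ (k + 2)) + 288 / g ^ 6 * eps p c x₀ (k + 2) := by
        refine h1.trans (add_le_add ?_ h2)
        gcongr
    _ = _ := by ring

theorem Standing.initGap_nonneg (h : Standing p c b) {x₀ : Rn d} (hx₀ : p.Pstar < p.P x₀) :
    0 ≤ initGap p c x₀ :=
  div_nonneg (sub_nonneg.2 (h.dual_le_Gstar x₀ h.dualFeasible_zero)) (sub_pos.2 hx₀).le

/-- All errors vanish at the start, so the Lyapunov value is the initial dual gap. The constant is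
inflated to the warm-start form so that both cases share one logarithmic estimate. -/
theorem Standing.lyap_cold_start_le (h : Standing p c b) (hρ0 : 0 ≤ c.rho0)
    (hρ : c.rho0 < Real.sqrt c.q) {x₀ : Rn d} (hx₀ : p.Pstar < p.P x₀)
    (r : ℕ → ℕ → Fin n → Fin m × Ξ) :
    lyap p c (1 - c.del) (outer p c Q x₀ r 0).y (outer p c Q x₀ r 0).s
      ≤ (289 + 3 * b) / (Real.sqrt c.q - c.rho0) ^ 6 * (1 + initGap p c x₀) * eps p c x₀ 1 := by
  have hΔ : 0 < p.P x₀ - p.Pstar := sub_pos.2 hx₀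
  have hI := h.initGap_nonneg hx₀
  have hg1 := h.gap_le_one hρ0
  have hη1 := h.sqrt_q_le_one
  have hb := h.hb
  have e1 : lyap p c (1 - c.del) (outer p c Q x₀ r 0).y (outer p c Q x₀ r 0).s
      = initGap p c x₀ * (p.P x₀ - p.Pstar) := by
    rw [initGap, div_mul_cancel₀ _ hΔ.ne']
    simp [lyap, outer, State.errMean, State.errSq]
  rw [e1]
  set g := Real.sqrt c.q - c.rho0 with hg
  have hg0 : 0 < g := sub_pos.2 hρ
  have h4 : 1 ≤ 1 / g ^ 6 * (1 - c.rho0) := by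
    rw [one_div_mul_eq_div, le_div_iff₀ (by positivity), one_mul]
    calc g ^ 6 ≤ g ^ 1 := pow_le_pow_of_le_one hg0.le hg1 (by norm_num)
      _ ≤ 1 - c.rho0 := by rw [pow_one]; linarith
  have h5 : 1 ≤ (289 + 3 * b) * (2 / 9) := by linarith
  calc initGap p c x₀ * (p.P x₀ - p.Pstar)
      ≤ (1 + initGap p c x₀) * (p.P x₀ - p.Pstar) * 1 * 1 := by
        rw [mul_one, mul_one]; gcongr; linarith
    _ ≤ (1 + initGap p c x₀) * (p.P x₀ - p.Pstar) * ((289 + 3 * b) * (2 / 9))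
          * (1 / g ^ 6 * (1 - c.rho0)) := by gcongr
    _ = _ := by unfold eps; ring

/-! ### The bound on the number of inner iterations -/

/-- The constant of the complexity bound. -/
noncomputable def iterConst (b : ℝ) : ℝ := b * (Real.log (64 * b * (289 + 3 * b)) + 10)

theorem iterConst_pos (hb : 100 ≤ b) : 0 < iterConst b := by
  have h1 : 0 ≤ Real.log (64 * b * (289 + 3 * b)) := Real.log_nonneg (by nlinarith)
  unfold iterConst
  positivity

theorem Standing.iteration_bound_le (h : Standing p c b) {g I : ℝ} (hg0 : 0 < g) (hg1 : g ≤ 1)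
    (hI : 0 ≤ I) :
    b * complexity p c *
      (Real.log (64 * b * complexity p c * ((289 + 3 * b) / g ^ 6 * (1 + I))) + 2)
    ≤ iterConst b * complexity p c *
      (1 + Real.log (complexity p c) + Real.log (1 / g) + Real.log (1 + I)) := by
  have hb := h.hb
  have hX2 := h.two_le_complexity
  set X := complexity p c
  have hL : 0 ≤ Real.log (64 * b * (289 + 3 * b)) := Real.log_nonneg (by nlinarith)
  have hlX : 0 ≤ Real.log X := Real.log_nonneg (by linarith)
  have hlg : 0 ≤ Real.log (1 / g) := Real.log_nonneg (by rwa [le_div_iff₀ hg0, one_mul])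
  have hlI : 0 ≤ Real.log (1 + I) := Real.log_nonneg (by linarith)
  have e : Real.log (64 * b * X * ((289 + 3 * b) / g ^ 6 * (1 + I)))
      = Real.log (64 * b * (289 + 3 * b)) + Real.log X + 6 * Real.log (1 / g)
        + Real.log (1 + I) := by
    have e1 : 64 * b * X * ((289 + 3 * b) / g ^ 6 * (1 + I))
        = 64 * b * (289 + 3 * b) * X * (1 / g) ^ 6 * (1 + I) := by
      rw [one_div, inv_pow]
      ring
    rw [e1, Real.log_mul (by positivity) (by positivity),
      Real.log_mul (by positivity) (by positivity), Real.log_mul (by positivity) (by positivity),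
      Real.log_pow]
    norm_num
  rw [e, iterConst]
  set L := Real.log (64 * b * (289 + 3 * b))
  have key : L + Real.log X + 6 * Real.log (1 / g) + Real.log (1 + I) + 2
      ≤ (L + 10) * (1 + Real.log X + Real.log (1 / g) + Real.log (1 + I)) := by
    nlinarith [mul_nonneg hL hlX, mul_nonneg hL hlg, mul_nonneg hL hlI]
  calc b * X * (L + Real.log X + 6 * Real.log (1 / g) + Real.log (1 + I) + 2)
      ≤ b * X * ((L + 10) * (1 + Real.log X + Real.log (1 / g) + Real.log (1 + I))) := by gcongr
    _ = _ := by ring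

/-- Strong induction serves only to know that the earlier loops terminate almost surely; the
constant does not deteriorate with k, because every warm start is measured against its own ε_k. -/
theorem Standing.lintegral_innerCount_le (h : Standing p c b) (hρ0 : 0 ≤ c.rho0)
    (hρ : c.rho0 < Real.sqrt c.q) (hQ : IsContraction ν Q c.del)
    (hmean : ∀ x, ∫ ζ, Q ζ x ∂ν = c.del • x) (hS : ∀ z, Measurable (S z)) (hind : iIndepFun S μ)
    (hlaw : ∀ z, μ.map (S z) = (uniformOn (Set.univ : Set (Fin m))).prod ν) {x₀ : Rn d}
    (hx₀ : p.Pstar < p.P x₀) (k : ℕ) :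
    ∫⁻ ω, (innerCount p c Q x₀ (fun k K τ => S (k, K, τ) ω) k : ENNReal) ∂μ
      ≤ ENNReal.ofReal (iterConst b * complexity p c *
        (1 + Real.log (complexity p c) + Real.log (1 / (Real.sqrt c.q - c.rho0))
          + if k = 0 then Real.log (1 + initGap p c x₀) else 0)) := by
  have hg0 : 0 < Real.sqrt c.q - c.rho0 := sub_pos.2 hρ
  have hg1 := h.gap_le_one hρ0
  have hb := h.hb
  have hB : ∀ I : ℝ, 0 ≤ I → 1 ≤ (289 + 3 * b) / (Real.sqrt c.q - c.rho0) ^ 6 * (1 + I) := by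
    intro I hI
    have h1 : 1 ≤ (289 + 3 * b) / (Real.sqrt c.q - c.rho0) ^ 6 := by
      rw [le_div_iff₀ (by positivity), one_mul]
      have := pow_le_one₀ (n := 6) hg0.le hg1
      linarith
    exact one_le_mul_of_one_le_of_one_le h1 (by linarith)
  induction k using Nat.strong_induction_on with
  | _ k ih =>
    cases k with
    | zero =>
      have hI := h.initGap_nonneg hx₀
      rw [if_pos rfl]
      refine (h.lintegral_innerCount_le_of_lyap_le hQ hmean hS hind hlaw (h.eps_pos hρ hx₀ 1)
        (hB _ hI) (Filter.Eventually.of_forall fun ω =>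
          h.lyap_cold_start_le hρ0 hρ hx₀ _)).trans ?_
      exact ENNReal.ofReal_le_ofReal (h.iteration_bound_le hg0 hg1 hI)
    | succ k =>
      -- A finite expected length forces an almost surely finite length; intersecting over the
      -- earlier loops validates the pathwise warm-start bound.
      have hfin : ∀ᵐ ω ∂μ, ∀ j < k + 1,
          innerCount p c Q x₀ (fun k K τ => S (k, K, τ) ω) j ≠ ⊤ := by
        rw [ae_all_iff]
        intro j
        by_cases hj : j < k + 1
        · obtain ⟨-, hy, hs⟩ := h.measurable_outer hQ.measurable x₀ j
            (r := fun (ω : Ω) k K τ => S (k, K, τ) ω) fun _ _ _ _ => hS _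
          have hmeas : Measurable fun ω =>
              (innerCount p c Q x₀ (fun k K τ => S (k, K, τ) ω) j : ENNReal) :=
            Measurable.of_discrete.comp
              (h.measurable_stopTime hQ.measurable hy hs (fun _ _ => hS _) _)
          filter_upwards [ae_lt_top hmeas ((ih j hj).trans_lt ENNReal.ofReal_lt_top).ne]
            with ω hω _ hcon
          rw [hcon] at hω
          simp at hω
        · exact Filter.Eventually.of_forall fun ω hj' => absurd hj' hj
      rw [if_neg k.succ_ne_zero]
      refine (h.lintegral_innerCount_le_of_lyap_le hQ hmean hS hind hlaw
        (h.eps_pos hρ hx₀ (k + 1 + 1)) (hB 0 le_rfl) ?_).trans ?_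
      · filter_upwards [hfin] with ω hω
        rw [add_zero, mul_one]
        exact h.lyap_warm_start_le hρ0 hρ hx₀ hω
      · simpa using ENNReal.ofReal_le_ofReal (h.iteration_bound_le hg0 hg1 le_rfl)

end

end ECSDCA

/-- The index is shifted: `innerCount` at k is T_{k+1}, so k = 0 is the first loop, which carries
the initial gap. As the expectation is a lower integral with values in [0, ∞], its bound also
contains almost sure termination. -/
theorem mainTheorem10 (b : ℝ) (hb : 100 ≤ b) :
    ∃ C : ℝ, 0 < C ∧
      ∀ (d t m n : ℕ), 0 < m → 0 < n →
      ∀ (p : ECSDCA.Problem d t m n) (c : ECSDCA.Params) (x₀ : ECSDCA.Rn d),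
        -- ranges of the scalar parameters
        0 < c.lam → 0 ≤ c.kap → 0 < c.gam → c.del < 1 →
        0 ≤ c.rho0 → c.rho0 < Real.sqrt c.q →
        -- assumptions on the problem; the starting point is not already optimal
        p.Admissible c.lam c.gam → p.Pstar < p.P x₀ →
        -- step parameter of EC-SDCA
        1 / (b * ECSDCA.complexity p c) ≤ c.theta →
        c.theta ≤ 1 / (100 * ECSDCA.complexity p c) →
        -- weights of the Lyapunov function
        ECSDCA.weightScale p c / b ≤ c.w₁ → c.w₁ ≤ b * ECSDCA.weightScale p c →
        (1 - c.del) * ECSDCA.weightScale p c / b ≤ c.w₂ → c.w₂ ≤ b * ECSDCA.weightScale p c →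
      -- the compressor
      ∀ (Ξ : Type*) [MeasurableSpace Ξ] (ν : Measure Ξ) [IsProbabilityMeasure ν]
        (Q : Ξ → ECSDCA.Rn d → ECSDCA.Rn d),
        ECSDCA.IsContraction ν Q c.del → (∀ x, ∫ ζ, Q ζ x ∂ν = c.del • x) →
      -- independent draws (uniform index, compressor seed) for each outer iteration,
      -- inner iteration and node
      ∀ (Ω : Type*) [MeasurableSpace Ω] (μ : Measure Ω) [IsProbabilityMeasure μ]
        (S : ℕ × ℕ × Fin n → Ω → Fin m × Ξ),
        (∀ z, Measurable (S z)) → iIndepFun S μ →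
        (∀ z, μ.map (S z) = (uniformOn (Set.univ : Set (Fin m))).prod ν) →
      ∀ k : ℕ,
        ∫⁻ ω, (ECSDCA.innerCount p c Q x₀ (fun k K τ => S (k, K, τ) ω) k : ENNReal) ∂μ ≤
          ENNReal.ofReal (C * ECSDCA.complexity p c *
            (1 + Real.log (ECSDCA.complexity p c)
              + Real.log (1 / (Real.sqrt c.q - c.rho0))
              + if k = 0 then Real.log (1 + ECSDCA.initGap p c x₀) else 0)) := by
  refine ⟨ECSDCA.iterConst b, ECSDCA.iterConst_pos hb, ?_⟩
  intro d t m n hm hn p c x₀ hlam hkap hgam hdel hρ0 hρ hadm hx₀ hθ1 hθ2 hw1 hw1' hw2 hw2'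
    Ξ _ ν _ Q hQ hmean Ω _ μ _ S hS hind hlaw k
  have h : ECSDCA.Standing p c b :=
    ⟨hm, hn, hlam, hkap, hgam, hQ.pos, hdel, hadm, hb, hθ1, hθ2, hw1, hw1', hw2, hw2'⟩
  exact h.lintegral_innerCount_le hρ0 hρ hQ hmean hS hind hlaw hx₀ k
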